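/- **Setting.** Let $J\in\mathbb{R}^{n\times n}$ and let $H=H(J)$ be one of the following Hamiltonians on $2n$ spins-$\tfrac12$, where $\sigma^{(i)}_{x,y,z}$ and $\tau^{(j)}_{x,y,z}$ ($1\le i,j\le n$) are the Pauli operators of the two groups of $n$ spins: $$H_1=\sum_{i,j}\tfrac{J_{ij}}{n}\sigma^{(i)}_x\tau^{(j)}_x,\quad H_2=\sum_{i,j}\tfrac{J_{ij}}{n}\bigl[\sigma^{(i)}_x\tau^{(j)}_x+\sigma^{(i)}_z\tau^{(j)}_z\bigr],$$ $$H_3=\sum_{i,j}\tfrac{J_{ij}}{2n}\bigl[\sigma^{(i)}_x\tau^{(j)}_x+\sigma^{(i)}_y\tau^{(j)}_y\bigr],\quad H_4=\sum_{i,j}\tfrac{J_{ij}}{2n}\bigl[\sigma^{(i)}_x\tau^{(j)}_x+\sigma^{(i)}_y\tau^{(j)}_y+\sigma^{(i)}_z\tau^{(j)}_z\bigr].$$ Let $p(t)=p(J;t)=|\langle \mathbf{x}_0|e^{-\mathrm{i}Ht}|\mathbf{y}_0\rangle|^2$ with $\mathbf{x}_0=\mathbf{1}^\sigma\mathbf{0}^\tau$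 and $\mathbf{y}_0=\mathbf{0}^\sigma\mathbf{1}^\tau$, and let $p_K(t)=\sum_{k=0}^{K}\frac{p^{(k)}(0)}{k!}t^k$ be its degree-$K$ Taylor polynomial. **#P-hardness.** Since the oracles below answer exactly on real inputs, algorithms are randomized programs over the reals: finitely many integer registers and finitely many arrays of reals, unit-cost exact field operations and comparisons, no rounding, and independent uniform random reals from $[0,1]$; their only real constants are those generated from $0,1$ and those that belong to the description of the problem (below: the endpoints $a,b$). A query to an oracle costs as many steps as real numbers are passed to it, plus one. A class $\mathcal{O}$ of oracles (the solutions of a computational problem) is *#P-hard* if for every $f\in\#\mathsf{P}$ (defined as usual through polynomial-time Turing machine verifiers) there is an oracle program that, for every oracle, halts in time polynomial in $|x|+k$ on every input $(x,k)$ and that, with every oracle from $\mathcal{O}$, outputs $f(x)$ with error probability at most $1/(k+1)$. Oracles are Borel measurable functions. **Gaussian permanent conjecture for $\varepsilon,\delta\in(0,1)$.** It is #P-hard to estimate $\mathrm{Per}(J)^2$ within an additive error of $\varepsilon\, n!$ with probability at least $1-\delta$ over $J\sim\mathcal{N}(0,1)^{n\times n}$ (for every $n\ge1$). **Theorem.**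 Assume the Gaussian permanent conjecture for some constants $\varepsilon,\delta\in(0,1)$. Let $H$ be any of $H_1,H_2,H_3,H_4$, let $K=K(n)\ge 2n$ be any polynomially bounded function of $n$, let $a<b$ be real numbers, let $q$ be any polynomial with natural-number coefficients and $q(n)>0$ for $n\ge1$, and let $0\le\delta'<\delta$. Then it is #P-hard to compute $p_{K(n)}(t)$ exactly, given $J$ and $t$, with probability at least $\tfrac12+\tfrac1{q(n)}$ over $t$ uniform in $[a,b]$, for a set of matrices $J$ of probability at least $1-\delta'$ over $J\sim\mathcal{N}(0,1)^{n\times n}$ (for every $n\ge1$). In particular (take $\delta'=0$) this holds if the oracle is required to have this success probability over $t$ for every $J$. -/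

import Mathlib

open MeasureTheory ProbabilityTheory
open scoped Nat

noncomputable section

/-! ## The class #P -/

namespace SharpHardness

/-- A predicate on pairs of bit strings that a Turing machine decides in polynomial time. -/
def PolyTimeVerifier (V : List Bool × List Bool → Bool) : Prop :=
  Nonempty (Turing.TM2ComputableInPolyTime
    (Computability.encodingProd (Computability.encodingList Bool)
      (Computability.encodingList Bool)).encode Computability.encodeBool V)

/-- `f` is in #P: it counts the witnesses, of polynomial length, that a polynomial-time
verifier accepts. -/
def InSharpP (f : List Bool → ℕ) : Prop :=
  ∃ (p : Polynomial ℕ) (V : List Bool × List Bool → Bool), PolyTimeVerifier V ∧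
    ∀ x, f x = Set.ncard {y : List Bool | y.length = p.eval x.length ∧ V (x, y) = true}

/-! ## Randomized oracle programs over the reals

A real random-access machine, as a structured programming language with unit-cost exact real
arithmetic (field operations and comparisons, no rounding and no floor function).  A program has
finitely many natural-number registers and finitely many arrays of real cells; array indices are
natural-number expressions.  Real numbers cannot be converted to natural numbers.  The only real
constants are those that a program can build from `0` and `1`, and those that belong to the
description of the oracle problem. -/

/-- Natural-number expressions (subtraction is truncated). -/
inductive NatExpr : Type
  | const (c : ℕ)
  | reg (r : ℕ)
  | add (e₁ e₂ : NatExpr)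
  | sub (e₁ e₂ : NatExpr)
  | mul (e₁ e₂ : NatExpr)

/-- Real expressions: `get a i` is the cell `i` of the array `a`, and `param i` is the `i`-th real
constant of the oracle problem. Division by zero gives zero. -/
inductive RealExpr : Type
  | ofNat (e : NatExpr)
  | param (i : ℕ)
  | get (a : ℕ) (i : NatExpr)
  | add (e₁ e₂ : RealExpr)
  | sub (e₁ e₂ : RealExpr)
  | mul (e₁ e₂ : RealExpr)
  | div (e₁ e₂ : RealExpr)

/-- Tests. -/
inductive TestExpr : Type
  | natLt (e₁ e₂ : NatExpr)
  | realLt (e₁ e₂ : RealExpr)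
  | not (b : TestExpr)
  | and (b₁ b₂ : TestExpr)

/-- Programs. `draw a i` puts a fresh random real number from `[0,1]` into the cell `i` of the
array `a`. `query b i n a` puts into the cell `i` of the array `b` the oracle's answer to the
instance of size parameter `n` that stands in the initial segment of the array `a`. -/
inductive Prog : Type
  | skip
  | setNat (r : ℕ) (e : NatExpr)
  | setReal (a : ℕ) (i : NatExpr) (e : RealExpr)
  | draw (a : ℕ) (i : NatExpr)
  | query (b : ℕ) (i : NatExpr) (n : NatExpr) (a : ℕ)
  | seq (c₁ c₂ : Prog)
  | ite (b : TestExpr) (c₁ c₂ : Prog)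
  | while (b : TestExpr) (c : Prog)

/-- The state of a run: registers, arrays, and the number of random reals drawn so far. -/
structure State where
  nat : ℕ → ℕ
  arr : ℕ → ℕ → ℝ
  pos : ℕ

namespace State

def setNat (s : State) (r v : ℕ) : State :=
  { s with nat := Function.update s.nat r v }

def setReal (s : State) (a i : ℕ) (v : ℝ) : State :=
  { s with arr := Function.update s.arr a (Function.update (s.arr a) i v) }

end State

def NatExpr.eval (s : State) : NatExpr → ℕ
  | .const c => c
  | .reg r => s.nat r
  | .add e₁ e₂ => e₁.eval s + e₂.eval s
  | .sub e₁ e₂ => e₁.eval s - e₂.eval s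
  | .mul e₁ e₂ => e₁.eval s * e₂.eval s

def RealExpr.eval (consts : List ℝ) (s : State) : RealExpr → ℝ
  | .ofNat e => (e.eval s : ℝ)
  | .param i => consts.getD i 0
  | .get a i => s.arr a (i.eval s)
  | .add e₁ e₂ => e₁.eval consts s + e₂.eval consts s
  | .sub e₁ e₂ => e₁.eval consts s - e₂.eval consts s
  | .mul e₁ e₂ => e₁.eval consts s * e₂.eval consts s
  | .div e₁ e₂ => e₁.eval consts s / e₂.eval consts s

def TestExpr.Holds (consts : List ℝ) (s : State) : TestExpr → Prop
  | .natLt e₁ e₂ => e₁.eval s < e₂.eval s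
  | .realLt e₁ e₂ => e₁.eval consts s < e₂.eval consts s
  | .not b => ¬ b.Holds consts s
  | .and b₁ b₂ => b₁.Holds consts s ∧ b₂.Holds consts s

/-- An oracle for instances that consist of `size n` real numbers, `n` being the size parameter. -/
abbrev Oracle (size : ℕ → ℕ) : Type := (n : ℕ) → (Fin (size n) → ℝ) → ℝ

/-- `Exec consts O ω c s T s'`: started in the state `s`, the program `c` halts in the state `s'`
after `T` steps, with the real constants `consts`, the oracle `O` and the random reals `ω`.
Every command and every test costs one step, and a query costs one further step for every
real number that is passed to the oracle. -/
inductive Exec {size : ℕ → ℕ} (consts : List ℝ) (O : Oracle size) (ω : ℕ → unitInterval) :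
    Prog → State → ℕ → State → Prop
  | skip (s : State) : Exec consts O ω .skip s 1 s
  | setNat (r : ℕ) (e : NatExpr) (s : State) :
      Exec consts O ω (.setNat r e) s 1 (s.setNat r (e.eval s))
  | setReal (a : ℕ) (i : NatExpr) (e : RealExpr) (s : State) :
      Exec consts O ω (.setReal a i e) s 1 (s.setReal a (i.eval s) (e.eval consts s))
  | draw (a : ℕ) (i : NatExpr) (s : State) :
      Exec consts O ω (.draw a i) s 1
        { s.setReal a (i.eval s) (ω s.pos : ℝ) with pos := s.pos + 1 }
  | query (b : ℕ) (i n : NatExpr) (a : ℕ) (s : State) :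
      Exec consts O ω (.query b i n a) s (size (n.eval s) + 1)
        (s.setReal b (i.eval s) (O (n.eval s) fun l => s.arr a l))
  | seq {c₁ c₂ : Prog} {s s' s'' : State} {T₁ T₂ : ℕ} :
      Exec consts O ω c₁ s T₁ s' → Exec consts O ω c₂ s' T₂ s'' →
      Exec consts O ω (.seq c₁ c₂) s (T₁ + T₂) s''
  | iteTrue {b : TestExpr} {c₁ c₂ : Prog} {s s' : State} {T : ℕ} :
      b.Holds consts s → Exec consts O ω c₁ s T s' →
      Exec consts O ω (.ite b c₁ c₂) s (T + 1) s'
  | iteFalse {b : TestExpr} {c₁ c₂ : Prog} {s s' : State} {T : ℕ} :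
      ¬ b.Holds consts s → Exec consts O ω c₂ s T s' →
      Exec consts O ω (.ite b c₁ c₂) s (T + 1) s'
  | whileTrue {b : TestExpr} {c : Prog} {s s' s'' : State} {T₁ T₂ : ℕ} :
      b.Holds consts s → Exec consts O ω c s T₁ s' → Exec consts O ω (.while b c) s' T₂ s'' →
      Exec consts O ω (.while b c) s (T₁ + T₂ + 1) s''
  | whileFalse {b : TestExpr} {c : Prog} {s : State} :
      ¬ b.Holds consts s → Exec consts O ω (.while b c) s 1 s

/-- The initial state on input `(x, k)`: the registers `0` and `1` hold the length of `x` and `k`,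
and the array `0` holds the bits of `x`. Everything else is zero. -/
def initState (x : List Bool) (k : ℕ) : State where
  nat := fun r => if r = 0 then x.length else if r = 1 then k else 0
  arr := fun a i => if a = 0 ∧ x.getD i false = true then 1 else 0
  pos := 0

/-- A (search) problem over the reals: the number of real inputs of an instance in terms of the
size parameter, the real constants that belong to the problem's description, and the oracles that
count as a solution. -/
structure OracleProblem where
  size : ℕ → ℕ
  consts : List ℝ
  Solves : Oracle size → Prop

/-- The oracle program `c` runs in polynomial time: whatever the oracle, the random numbers and the
input `(x, k)`, it halts within a number of steps that is polynomial in `|x| + k`. -/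
def PolyTime (P : OracleProblem) (c : Prog) : Prop :=
  ∃ p : Polynomial ℕ, ∀ (O : Oracle P.size) (ω : ℕ → unitInterval) (x : List Bool) (k : ℕ),
    ∃ (T : ℕ) (s : State), Exec P.consts O ω c (initState x k) T s ∧ T ≤ p.eval (x.length + k)

/-- The law of a sequence of independent, uniformly distributed random numbers in `[0,1]`. -/
def coinMeasure : Measure (ℕ → unitInterval) :=
  Measure.infinitePi fun _ : ℕ => (volume : Measure unitInterval)

/-- With the oracle `O`, the program `c` computes `f` on every input `(x, k)`, with an error
probability of at most `1/(k+1)`. The output is the content of the cell `0` of the array `0`. -/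
def ComputesWith (P : OracleProblem) (O : Oracle P.size) (c : Prog) (f : List Bool → ℕ) : Prop :=
  ∀ (x : List Bool) (k : ℕ),
    coinMeasure {ω | ¬ ∃ (T : ℕ) (s : State),
      Exec P.consts O ω c (initState x k) T s ∧ s.arr 0 0 = (f x : ℝ)} ≤ ((k : ENNReal) + 1)⁻¹

/-- `P` is #P-hard (under randomized polynomial-time Turing reductions): every function in #P
is computed by a randomized polynomial-time program with access to an oracle for `P`, the same
program for every oracle that solves `P`. -/
def SharpPHard (P : OracleProblem) : Prop :=
  ∀ f : List Bool → ℕ, InSharpP f → ∃ c : Prog, PolyTime P c ∧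
    ∀ O : Oracle P.size, P.Solves O → ComputesWith P O c f

/-! ## Gaussian matrices and the estimation of their permanents -/

/-- The law `𝒩(0,1)^{n × n}` of a matrix with independent standard Gaussian entries. -/
def gaussianMatrix (n : ℕ) : Measure (Fin n → Fin n → ℝ) :=
  Measure.pi fun _ => Measure.pi fun _ => gaussianReal 0 1

/-- The entries of a matrix, row by row. -/
def flatten {n : ℕ} (J : Fin n → Fin n → ℝ) : Fin (n * n) → ℝ := fun l =>
  J (finProdFinEquiv.symm l).1 (finProdFinEquiv.symm l).2

/-- Estimating `Per(J)²` within an additive error of `ε n!`, with probability at least `1 - δ`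
over a Gaussian matrix `J`, for every `n ≥ 1`. -/
def permanentEstimation (ε δ : ℝ) : OracleProblem where
  size := fun n => n * n
  consts := []
  Solves := fun O => (∀ n, Measurable (O n)) ∧ ∀ n, 1 ≤ n →
    gaussianMatrix n {J | ¬ |O n (flatten J) - (Matrix.of J).permanent ^ 2| ≤ ε * (n ! : ℝ)}
      ≤ ENNReal.ofReal δ

/-- The Gaussian permanent conjecture, for the constants `ε` and `δ`. -/
def GaussianPermanentConjecture (ε δ : ℝ) : Prop :=
  SharpPHard (permanentEstimation ε δ)

/-! ## Spin dynamics on the complete bipartite graph -/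

/-- The `2n` spins: `Sum.inl i` is the `i`-th spin of the part `σ`, and `Sum.inr j` is the `j`-th
spin of the part `τ`. -/
abbrev Site (n : ℕ) : Type := Fin n ⊕ Fin n

/-- Bit strings of length `2n`, the labels of the computational basis. -/
abbrev Config (n : ℕ) : Type := Site n → Fin 2

def pauliX : Matrix (Fin 2) (Fin 2) ℂ := !![0, 1; 1, 0]

def pauliY : Matrix (Fin 2) (Fin 2) ℂ := !![0, -Complex.I; Complex.I, 0]

def pauliZ : Matrix (Fin 2) (Fin 2) ℂ := !![1, 0; 0, -1]

/-- The one-spin operator `A` acting on the spin `s`, and the identity on the other spins. -/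
def onSite {n : ℕ} (A : Matrix (Fin 2) (Fin 2) ℂ) (s : Site n) :
    Matrix (Config n) (Config n) ℂ :=
  Matrix.of fun x y => if ∀ r, r ≠ s → x r = y r then A (x s) (y s) else 0

/-- The operator `σ^(i)_A τ^(j)_A`. -/
def coupling {n : ℕ} (A : Matrix (Fin 2) (Fin 2) ℂ) (i j : Fin n) :
    Matrix (Config n) (Config n) ℂ :=
  onSite A (Sum.inl i) * onSite A (Sum.inr j)

/-- The four models: `H₁` (Ising), `H₂` (xx and zz couplings), `H₃` (XX) and `H₄` (Heisenberg). -/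
inductive Model : Type
  | H1
  | H2
  | H3
  | H4

/-- The Hamiltonian of the model with the coupling matrix `J`. -/
def hamiltonian {n : ℕ} (J : Fin n → Fin n → ℝ) : Model → Matrix (Config n) (Config n) ℂ
  | .H1 => ∑ i, ∑ j, ((J i j / n : ℝ) : ℂ) • coupling pauliX i j
  | .H2 => ∑ i, ∑ j, ((J i j / n : ℝ) : ℂ) • (coupling pauliX i j + coupling pauliZ i j)
  | .H3 => ∑ i, ∑ j, ((J i j / (2 * n) : ℝ) : ℂ) • (coupling pauliX i j + coupling pauliY i j)
  | .H4 => ∑ i, ∑ j, ((J i j / (2 * n) : ℝ) : ℂ) •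
      (coupling pauliX i j + coupling pauliY i j + coupling pauliZ i j)

/-- The initial bit string `y₀ = 0^σ 1^τ`. -/
def initialConfig (n : ℕ) : Config n := Sum.elim (fun _ => 0) (fun _ => 1)

/-- The output bit string `x₀ = 1^σ 0^τ`. -/
def outputConfig (n : ℕ) : Config n := Sum.elim (fun _ => 1) (fun _ => 0)

/-- The output probability `p(t) = |⟨x₀| exp(-iHt) |y₀⟩|²`. -/
def outputProb {n : ℕ} (h : Model) (J : Fin n → Fin n → ℝ) (t : ℝ) : ℝ :=
  ‖(NormedSpace.exp ((-Complex.I * (t : ℂ)) • hamiltonian J h) :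
    Matrix (Config n) (Config n) ℂ) (outputConfig n) (initialConfig n)‖ ^ 2

/-- The Taylor polynomial `p_K` of `p` at `0`, of degree `K`. -/
def truncatedProb {n : ℕ} (h : Model) (J : Fin n → Fin n → ℝ) (K : ℕ) (t : ℝ) : ℝ :=
  ∑ k ∈ Finset.range (K + 1), iteratedDeriv k (outputProb h J) 0 / (k ! : ℝ) * t ^ k

/-- Computing `p_K(t)` exactly, from the `n²` entries of `J` and the real number `t`, with
probability at least `1/2 + 1/q(n)` over `t` uniform in `[a, b]`, for every `n ≥ 1` and for a set of
coupling matrices `J` of Gaussian probability at least `1 - δ`. The degree is `K n`. -/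
def exactTruncatedProb (h : Model) (K : ℕ → ℕ) (a b : ℝ) (q : Polynomial ℕ) (δ : ℝ) :
    OracleProblem where
  size := fun n => n * n + 1
  consts := [a, b]
  Solves := fun O => (∀ n, Measurable (O n)) ∧ ∀ n, 1 ≤ n →
    gaussianMatrix n {J | ¬ (ENNReal.ofReal ((1 / 2 + 1 / ((q.eval n : ℕ) : ℝ)) * (b - a)) ≤
      volume {t : ℝ | t ∈ Set.Icc a b ∧
        O n (Fin.snoc (α := fun _ => ℝ) (flatten J) t) = truncatedProb h J (K n) t})}
      ≤ ENNReal.ofReal δ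

end SharpHardness

end

/-!
The proof reduces the estimation of permanents to the evaluation of truncated output probabilities.

*Why the oracle knows the permanent.* Every term of the Hamiltonian changes at most one spin in each
of the two groups, so the amplitude `⟨x₀| Hᵐ |y₀⟩` vanishes for `m < n`, and for `m = n` only the
products in which every spin is flipped exactly once contribute: a pair of permutations each, which
adds up to `n! Per(J) / nⁿ` for each of the four models. Hence the coefficient of `t²ⁿ` of the
truncated Taylor series is `(Per(J) / nⁿ)²` (`taylorCoeff_outputProb`).

*How to find this coefficient from unreliable values.* The oracle's values at many random times lie
on the graph of a polynomial `p` of bounded degree, except for a fraction of less than one half.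
As for Reed-Solomon codes, one solves the linear system `N(t) = y E(t)` with an error locator `E`,
here normalized to be `1` up to the order `2n`: then `N = p E` has the same coefficient of `t²ⁿ` as
`p` (`decodeValue_eq_coeff`). The system is solved without case distinctions, by an orthogonal
projection that is built up row by row with `x / 0 = 0` (`rowProj_last_column`). So the decoder is a
program of nested loops (`runs_decodeInstance`), and a measurable function of all its data.

*The reduction.* It draws the times once and for all, and then simulates the given program, with
the decoder in place of the queries (`Simulates.exec_translate`, `exec_reduction`). As the times are
fixed, the decoder acts as one oracle for the estimation of permanents. For a matrix on which the
given oracle is reliable, the decoder fails with small probability over the times, by Chebyshev's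
inequality (`coinMeasure_decodedAnswer_ne`). By Fubini's theorem and Markov's inequality, for most
times it fails only on a set of matrices of measure at most `δ - δ'`, besides the set of measure
`δ'` on which the given oracle may be unreliable: it solves the estimation problem
(`exists_bad_times_forall`). The random numbers that the simulated program uses are independent of
the times (`map_splice`). Fubini's theorem for the event that this program fails
(`coinMeasure_simulation_le`) needs that the semantics of programs is measurable
(`measurableSet_exec`).
-/

noncomputable section

namespace SharpHardness

/-! ### The leading Taylor coefficient of the output probability -/

/-- The entries of a two-spin coupling: it can change only the two spins it acts on. -/
lemma coupling_apply {n : ℕ} (A : Matrix (Fin 2) (Fin 2) ℂ) (i j : Fin n) (x y : Config n) :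
    coupling A i j x y =
      if ∀ r, r ≠ Sum.inl i → r ≠ Sum.inr j → x r = y r then
        A (x (Sum.inl i)) (y (Sum.inl i)) * A (x (Sum.inr j)) (y (Sum.inr j)) else 0 := by
  classical
  -- The only intermediate configuration has already the new value at `inl i`.
  set u₀ : Config n := Function.update x (Sum.inl i) (y (Sum.inl i)) with hu₀
  have hne : (Sum.inr j : Site n) ≠ Sum.inl i := by simp
  rw [coupling, Matrix.mul_apply, Finset.sum_eq_single u₀]
  · have h1 : ∀ r, r ≠ Sum.inl i → x r = u₀ r := fun r hr => by
      rw [hu₀, Function.update_of_ne hr]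
    have h2 : u₀ (Sum.inl i) = y (Sum.inl i) := by simp [hu₀]
    have h3 : u₀ (Sum.inr j) = x (Sum.inr j) := (h1 _ hne).symm
    have h4 : (∀ r, r ≠ Sum.inr j → u₀ r = y r) ↔
        ∀ r, r ≠ Sum.inl i → r ≠ Sum.inr j → x r = y r := by
      constructor
      · intro h r hr hr'
        rw [h1 r hr, h r hr']
      · intro h r hr
        by_cases hri : r = Sum.inl i
        · rw [hri, h2]
        · rw [← h1 r hri, h r hri hr]
    simp only [onSite, Matrix.of_apply]
    rw [if_pos h1, h2, h3]
    by_cases h : ∀ r, r ≠ Sum.inl i → r ≠ Sum.inr j → x r = y r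
    · rw [if_pos h, if_pos (h4.2 h)]
    · rw [if_neg h, if_neg (fun h' => h (h4.1 h')), mul_zero]
  · intro u _ hu
    simp only [onSite, Matrix.of_apply]
    by_cases h1 : ∀ r, r ≠ Sum.inl i → x r = u r
    · by_cases h2 : ∀ r, r ≠ Sum.inr j → u r = y r
      · exfalso
        apply hu
        funext r
        by_cases hr : r = Sum.inl i
        · subst hr
          rw [h2 _ hne.symm, hu₀, Function.update_self]
        · rw [hu₀, Function.update_of_ne hr, h1 r hr]
      · rw [if_neg h2, mul_zero]
    · rw [if_neg h1, zero_mul]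
  · simp

/-- The interaction of the spins `σ i` and `τ j`, normalized so that it flips `|01⟩` to `|10⟩` with
amplitude `1`. -/
def interaction {n : ℕ} : Model → Fin n × Fin n → Matrix (Config n) (Config n) ℂ
  | .H1, p => coupling pauliX p.1 p.2
  | .H2, p => coupling pauliX p.1 p.2 + coupling pauliZ p.1 p.2
  | .H3, p => (1 / 2 : ℂ) • (coupling pauliX p.1 p.2 + coupling pauliY p.1 p.2)
  | .H4, p => (1 / 2 : ℂ) •
      (coupling pauliX p.1 p.2 + coupling pauliY p.1 p.2 + coupling pauliZ p.1 p.2)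

lemma hamiltonian_eq_sum_interaction {n : ℕ} (h : Model) (J : Fin n → Fin n → ℝ) :
    hamiltonian J h = ∑ p : Fin n × Fin n, ((J p.1 p.2 / n : ℝ) : ℂ) • interaction h p := by
  rw [Fintype.sum_prod_type]
  have key : ∀ i j : Fin n, ((J i j / (2 * n) : ℝ) : ℂ) = ((J i j / n : ℝ) : ℂ) * (1 / 2) := by
    intro i j
    push_cast
    rw [div_mul_div_comm, mul_one, mul_comm (2 : ℂ)]
  cases h <;> simp only [hamiltonian, interaction, key, mul_smul]

lemma interaction_local {n : ℕ} (h : Model) (p : Fin n × Fin n) (x y : Config n)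
    (hxy : interaction h p x y ≠ 0) (r : Site n) (h1 : r ≠ Sum.inl p.1) (h2 : r ≠ Sum.inr p.2) :
    x r = y r := by
  by_contra hr
  have hc : ∀ A, coupling A p.1 p.2 x y = 0 := fun A => by
    rw [coupling_apply, if_neg fun hall => hr (hall r h1 h2)]
  apply hxy
  cases h <;> simp [interaction, hc]

lemma interaction_flip {n : ℕ} (h : Model) (p : Fin n × Fin n) (x y : Config n)
    (hloc : ∀ r, r ≠ Sum.inl p.1 → r ≠ Sum.inr p.2 → x r = y r)
    (hx1 : x (Sum.inl p.1) = 1) (hx2 : x (Sum.inr p.2) = 0)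
    (hy1 : y (Sum.inl p.1) = 0) (hy2 : y (Sum.inr p.2) = 1) : interaction h p x y = 1 := by
  have hc : ∀ A, coupling A p.1 p.2 x y = A 1 0 * A 0 1 := fun A => by
    rw [coupling_apply, if_pos hloc, hx1, hx2, hy1, hy2]
  cases h <;> simp [interaction, hc, pauliX, pauliY, pauliZ] <;> norm_num

/-- A product of interactions changes only the spins on which its factors act. -/
lemma exists_mem_of_interaction_prod_ne_zero {n : ℕ} (h : Model) (l : List (Fin n × Fin n)) :
    ∀ x y : Config n, (l.map (interaction h)).prod x y ≠ 0 → ∀ r, x r ≠ y r →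
      ∃ p ∈ l, r = Sum.inl p.1 ∨ r = Sum.inr p.2 := by
  induction l with
  | nil =>
    intro x y hxy r hr
    simp only [List.map_nil, List.prod_nil, Matrix.one_apply, ne_eq, ite_eq_right_iff,
      one_ne_zero, imp_false, not_not] at hxy
    exact absurd (congrFun hxy r) hr
  | cons p l ih =>
    intro x y hxy r hr
    rw [List.map_cons, List.prod_cons, Matrix.mul_apply] at hxy
    obtain ⟨u, -, hu⟩ := Finset.exists_ne_zero_of_sum_ne_zero hxy
    have hu1 := left_ne_zero_of_mul hu
    have hu2 := right_ne_zero_of_mul hu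
    by_cases hru : u r = y r
    · refine ⟨p, List.mem_cons_self, ?_⟩
      by_contra hcon
      rw [not_or] at hcon
      exact hr ((interaction_local h p x u hu1 r hcon.1 hcon.2).trans hru)
    · obtain ⟨p', hp', hr'⟩ := ih u y hu2 r hru
      exact ⟨p', List.mem_cons_of_mem _ hp', hr'⟩

/-- Interactions on disjoint pairs of spins, applied to the initial string, flip exactly these
pairs, with amplitude `1`. -/
lemma interaction_prod_flip {n : ℕ} (h : Model) (l : List (Fin n × Fin n)) :
    (l.map Prod.fst).Nodup → (l.map Prod.snd).Nodup → ∀ x : Config n,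
      (∀ i, x (Sum.inl i) = if i ∈ l.map Prod.fst then 1 else 0) →
      (∀ j, x (Sum.inr j) = if j ∈ l.map Prod.snd then 0 else 1) →
      (l.map (interaction h)).prod x (initialConfig n) = 1 := by
  induction l with
  | nil =>
    intro _ _ x hx1 hx2
    have : x = initialConfig n := by
      funext r
      cases r with
      | inl i => simpa [initialConfig] using hx1 i
      | inr j => simpa [initialConfig] using hx2 j
    simp [this]
  | cons p l ih =>
    intro h1 h2 x hx1 hx2
    rw [List.map_cons, List.nodup_cons] at h1 h2
    -- The remaining factors lead to the string `x` with the pair `p` not yet flipped.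
    set u₀ : Config n := Sum.elim (fun i => if i ∈ l.map Prod.fst then 1 else 0)
      (fun j => if j ∈ l.map Prod.snd then 0 else 1) with hu₀
    have hl : ∀ i, u₀ (Sum.inl i) = if i ∈ l.map Prod.fst then 1 else 0 := fun _ => rfl
    have hr : ∀ j, u₀ (Sum.inr j) = if j ∈ l.map Prod.snd then 0 else 1 := fun _ => rfl
    have hloc : ∀ r, r ≠ Sum.inl p.1 → r ≠ Sum.inr p.2 → x r = u₀ r := by
      intro r hr1 hr2
      cases r with
      | inl i =>
        have : i ≠ p.1 := fun e => hr1 (by rw [e])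
        rw [hx1, hl, List.map_cons]
        simp only [List.mem_cons, this, false_or]
      | inr j =>
        have : j ≠ p.2 := fun e => hr2 (by rw [e])
        rw [hx2, hr, List.map_cons]
        simp only [List.mem_cons, this, false_or]
    have hu1 : u₀ (Sum.inl p.1) = 0 := by rw [hl, if_neg h1.1]
    have hu2 : u₀ (Sum.inr p.2) = 1 := by rw [hr, if_neg h2.1]
    rw [List.map_cons, List.prod_cons, Matrix.mul_apply, Finset.sum_eq_single u₀]
    · rw [ih h1.2 h2.2 u₀ hl hr, mul_one]
      exact interaction_flip h p x u₀ hloc (by rw [hx1]; simp) (by rw [hx2]; simp) hu1 hu2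
    · intro u _ hu
      by_contra hne
      have hne1 := left_ne_zero_of_mul hne
      have hne2 := right_ne_zero_of_mul hne
      apply hu
      have hout : ∀ r, (∀ p' ∈ l, ¬ (r = Sum.inl p'.1 ∨ r = Sum.inr p'.2)) →
          u r = initialConfig n r := by
        intro r hr'
        by_contra hcon
        obtain ⟨p', hp', h'⟩ := exists_mem_of_interaction_prod_ne_zero h l u _ hne2 r hcon
        exact hr' p' hp' h'
      funext r
      by_cases hr1 : r = Sum.inl p.1
      · subst hr1
        rw [hu1, hout]
        · rfl
        · rintro p' hp' (h' | h')
          · exact h1.1 (List.mem_map.2 ⟨p', hp', (Sum.inl_injective h').symm⟩)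
          · simp at h'
      by_cases hr2 : r = Sum.inr p.2
      · subst hr2
        rw [hu2, hout]
        · rfl
        · rintro p' hp' (h' | h')
          · simp at h'
          · exact h2.1 (List.mem_map.2 ⟨p', hp', (Sum.inr_injective h').symm⟩)
      rw [← hloc r hr1 hr2]
      exact (interaction_local h p x u hne1 r hr1 hr2).symm
    · simp

/-- The noncommutative multinomial expansion of a power of a sum. -/
lemma sum_pow_eq_sum_words {R ι : Type*} [Semiring R] [Fintype ι] (f : ι → R) (m : ℕ) :
    (∑ i, f i) ^ m = ∑ w : Fin m → ι, ((List.ofFn w).map f).prod := by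
  induction m with
  | zero => simp
  | succ m ih =>
    rw [pow_succ', ih, Finset.sum_mul_sum, ← Fintype.sum_prod_type',
      ← (Fin.consEquiv fun _ : Fin (m + 1) => ι).sum_comp]
    refine Finset.sum_congr rfl fun p _ => ?_
    simp [Fin.consEquiv, List.ofFn_succ]

lemma prod_map_smul {R A ι : Type*} [CommSemiring R] [Semiring A] [Algebra R A]
    (c : ι → R) (f : ι → A) (l : List ι) :
    (l.map fun i => c i • f i).prod = (l.map c).prod • (l.map f).prod := by
  induction l with
  | nil => simp
  | cons i l ih => rw [List.map_cons, List.prod_cons, ih, smul_mul_smul_comm]; simp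

lemma hamiltonian_pow_apply {n : ℕ} (h : Model) (J : Fin n → Fin n → ℝ) (m : ℕ)
    (x y : Config n) :
    (hamiltonian J h ^ m) x y = ∑ w : Fin m → Fin n × Fin n,
      (∏ k, ((J (w k).1 (w k).2 / n : ℝ) : ℂ)) *
        ((List.ofFn w).map (interaction h)).prod x y := by
  rw [hamiltonian_eq_sum_interaction, sum_pow_eq_sum_words, Matrix.sum_apply]
  refine Finset.sum_congr rfl fun w _ => ?_
  rw [prod_map_smul, Matrix.smul_apply, smul_eq_mul, List.map_ofFn, List.prod_ofFn]
  rfl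

lemma surjective_of_interaction_prod_ne_zero {n m : ℕ} (h : Model) (w : Fin m → Fin n × Fin n)
    (hw : ((List.ofFn w).map (interaction h)).prod (outputConfig n) (initialConfig n) ≠ 0) :
    Function.Surjective (fun k => (w k).1) ∧ Function.Surjective (fun k => (w k).2) := by
  have := exists_mem_of_interaction_prod_ne_zero h _ _ _ hw
  constructor
  · intro i
    obtain ⟨p, hp, h'⟩ := this (Sum.inl i) (by simp [outputConfig, initialConfig])
    obtain ⟨k, rfl⟩ := List.mem_ofFn.1 hp
    exact ⟨k, by simpa [eq_comm] using h'⟩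
  · intro i
    obtain ⟨p, hp, h'⟩ := this (Sum.inr i) (by simp [outputConfig, initialConfig])
    obtain ⟨k, rfl⟩ := List.mem_ofFn.1 hp
    exact ⟨k, by simpa [eq_comm] using h'⟩

lemma hamiltonian_pow_apply_of_lt {n m : ℕ} (h : Model) (J : Fin n → Fin n → ℝ) (hm : m < n) :
    (hamiltonian J h ^ m) (outputConfig n) (initialConfig n) = 0 := by
  rw [hamiltonian_pow_apply]
  refine Finset.sum_eq_zero fun w _ => ?_
  by_contra hne
  have := (surjective_of_interaction_prod_ne_zero h w (right_ne_zero_of_mul hne)).1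
  have := Fintype.card_le_of_surjective _ this
  simp at this
  omega

/-- At order `n`, every pair of bijections contributes one product of couplings, and these add up
to `n!` times the permanent. -/
lemma hamiltonian_pow_apply_self {n : ℕ} (h : Model) (J : Fin n → Fin n → ℝ) :
    (hamiltonian J h ^ n) (outputConfig n) (initialConfig n) =
      (n ! : ℂ) * (((Matrix.of J).permanent / n ^ n : ℝ) : ℂ) := by
  classical
  rw [hamiltonian_pow_apply]
  set F : (Fin n → Fin n × Fin n) → ℂ := fun w =>
    (∏ k, ((J (w k).1 (w k).2 / n : ℝ) : ℂ)) *
        ((List.ofFn w).map (interaction h)).prod (outputConfig n) (initialConfig n) with hF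
  let g : Equiv.Perm (Fin n) × Equiv.Perm (Fin n) → (Fin n → Fin n × Fin n) :=
    fun q k => (q.1 k, q.2 k)
  have hg : Function.Injective g := by
    intro q q' hqq
    refine Prod.ext (Equiv.ext fun k => ?_) (Equiv.ext fun k => ?_)
    · exact congrArg Prod.fst (congrFun hqq k)
    · exact congrArg Prod.snd (congrFun hqq k)
  have h1 : ∑ w, F w = ∑ q, F (g q) := by
    refine (Finset.sum_of_injOn g hg.injOn (by simp) ?_ (by simp)).symm
    intro w _ hw
    by_contra hne
    obtain ⟨s1, s2⟩ := surjective_of_interaction_prod_ne_zero h w (right_ne_zero_of_mul hne)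
    apply hw
    refine ⟨(Equiv.ofBijective _ (Finite.injective_iff_bijective.1
      (Finite.injective_iff_surjective.2 s1)), Equiv.ofBijective _
      (Finite.injective_iff_bijective.1 (Finite.injective_iff_surjective.2 s2))), by simp, ?_⟩
    funext k
    rfl
  have h2 : ∀ q, F (g q) = ((∏ k, J (q.1 k) (q.2 k) / n : ℝ) : ℂ) := by
    intro q
    have hfst : (List.ofFn (g q)).map Prod.fst = List.ofFn q.1 := by
      rw [List.map_ofFn]; rfl
    have hsnd : (List.ofFn (g q)).map Prod.snd = List.ofFn q.2 := by
      rw [List.map_ofFn]; rfl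
    have : ((List.ofFn (g q)).map (interaction h)).prod (outputConfig n) (initialConfig n) = 1 := by
      apply interaction_prod_flip
      · rw [hfst]; exact List.nodup_ofFn.2 q.1.injective
      · rw [hsnd]; exact List.nodup_ofFn.2 q.2.injective
      · intro i
        rw [hfst, if_pos (List.mem_ofFn.2 (q.1.surjective i))]; rfl
      · intro i
        rw [hsnd, if_pos (List.mem_ofFn.2 (q.2.surjective i))]; rfl
    rw [hF]
    simp only [this, mul_one, g]
    push_cast
    rfl
  rw [h1, Finset.sum_congr rfl fun q _ => h2 q, ← Complex.ofReal_sum, Fintype.sum_prod_type_right]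
  have h3 : ∀ ρ : Equiv.Perm (Fin n), ∑ π : Equiv.Perm (Fin n), ∏ k, J (π k) (ρ k) / n =
      (Matrix.of J).permanent / n ^ n := by
    intro ρ
    rw [Matrix.permanent, Finset.sum_div, ← Equiv.sum_comp (Equiv.mulRight ρ)]
    refine Finset.sum_congr rfl fun π _ => ?_
    rw [Finset.prod_div_distrib, Finset.prod_const, Finset.card_univ, Fintype.card_fin,
      ← Equiv.prod_comp ρ (fun i => (Matrix.of J) (π i) i)]
    rfl
  rw [Finset.sum_congr rfl fun ρ _ => h3 ρ, Finset.sum_const, Finset.card_univ,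
    Fintype.card_perm, Fintype.card_fin]
  push_cast
  simp

section Taylor

attribute [local instance] Matrix.linftyOpNormedRing Matrix.linftyOpNormedAlgebra

variable {ι : Type*} [Fintype ι] [DecidableEq ι]

lemma hasDerivAt_exp_smul_mul_apply (A B : Matrix ι ι ℂ) (x y : ι) (t : ℝ) :
    HasDerivAt (fun u : ℝ => (NormedSpace.exp (u • A) * B) x y)
      ((NormedSpace.exp (t • A) * (A * B)) x y) t := by
  have h := (hasDerivAt_exp_smul_const (𝕂 := ℝ) A t).mul_const B
  rw [mul_assoc] at h
  exact hasDerivAt_pi.1 (hasDerivAt_pi.1 h x) y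

lemma iteratedDeriv_exp_smul_apply (A : Matrix ι ι ℂ) (x y : ι) (k : ℕ) :
    iteratedDeriv k (fun u : ℝ => NormedSpace.exp (u • A) x y) =
      fun u : ℝ => (NormedSpace.exp (u • A) * A ^ k) x y := by
  induction k with
  | zero => simp
  | succ k ih =>
    rw [iteratedDeriv_succ, ih]
    funext t
    rw [(hasDerivAt_exp_smul_mul_apply A (A ^ k) x y t).deriv, pow_succ']

lemma contDiff_exp_smul_apply (A : Matrix ι ι ℂ) (x y : ι) (k : ℕ) :
    ContDiff ℝ k (fun u : ℝ => NormedSpace.exp (u • A) x y) := by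
  apply contDiff_of_differentiable_iteratedDeriv
  intro m _
  rw [iteratedDeriv_exp_smul_apply]
  exact fun t => (hasDerivAt_exp_smul_mul_apply A _ x y t).differentiableAt

end Taylor

/-- The leading Taylor coefficient of a squared modulus: if the derivatives of `ψ` of order below
`n` vanish at `0`, then that of `|ψ|²` of order `2n` comes from `ψ⁽ⁿ⁾(0)` alone. -/
lemma iteratedDeriv_norm_sq {ψ : ℝ → ℂ} (hψ : ∀ k : ℕ, ContDiff ℝ k ψ) (n : ℕ)
    (h0 : ∀ k < n, iteratedDeriv k ψ 0 = 0) :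
    iteratedDeriv (2 * n) (fun t => ‖ψ t‖ ^ 2) 0 =
      (Nat.choose (2 * n) n : ℝ) * ‖iteratedDeriv n ψ 0‖ ^ 2 := by
  have hconj : ∀ k t, iteratedDeriv k (fun t => (starRingEnd ℂ) (ψ t)) t =
      (starRingEnd ℂ) (iteratedDeriv k ψ t) := by
    intro k
    induction k with
    | zero => simp
    | succ k ih =>
      intro t
      have hd : DifferentiableAt ℝ (iteratedDeriv k ψ) t :=
        ((hψ (k + 1)).differentiable_iteratedDeriv k (by exact_mod_cast Nat.lt_succ_self k)) t
      rw [iteratedDeriv_succ, iteratedDeriv_succ, funext ih]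
      exact (Complex.conjCLE.hasFDerivAt.comp_hasDerivAt t hd.hasDerivAt).deriv
  have hconjS : ∀ k : ℕ, ContDiff ℝ k (fun t => (starRingEnd ℂ) (ψ t)) := fun k =>
    Complex.conjCLE.contDiff.comp (hψ k)
  have hS : ∀ k : ℕ, ContDiff ℝ k (fun t => ‖ψ t‖ ^ 2) := fun k => (hψ k).norm_sq ℝ
  have hre : ∀ k t, ((iteratedDeriv k (fun t => ‖ψ t‖ ^ 2) t : ℝ) : ℂ) =
      iteratedDeriv k (fun t => (starRingEnd ℂ) (ψ t) * ψ t) t := by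
    intro k
    induction k with
    | zero => intro t; simp [Complex.conj_mul']
    | succ k ih =>
      intro t
      have hd : DifferentiableAt ℝ (iteratedDeriv k (fun t => ‖ψ t‖ ^ 2)) t :=
        ((hS (k + 1)).differentiable_iteratedDeriv k (by exact_mod_cast Nat.lt_succ_self k)) t
      rw [iteratedDeriv_succ, iteratedDeriv_succ, ← funext ih]
      exact (hd.hasDerivAt.ofReal_comp).deriv.symm
  apply Complex.ofReal_injective
  rw [hre, iteratedDeriv_fun_mul (hconjS _).contDiffAt (hψ _).contDiffAt,
    Finset.sum_eq_single n]
  · rw [hconj, two_mul, Nat.add_sub_cancel, mul_assoc, Complex.conj_mul']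
    push_cast
    rfl
  · intro k hk hkn
    rw [Finset.mem_range] at hk
    rcases lt_or_gt_of_ne hkn with h | h
    · rw [hconj, h0 k h]; simp
    · rw [h0 (2 * n - k) (by omega)]; simp
  · intro h
    exact absurd (Finset.mem_range.2 (by omega)) h

/-- The coefficient of `t ^ (2n)` of the Taylor series of the output probability. -/
theorem taylorCoeff_outputProb {n : ℕ} (h : Model) (J : Fin n → Fin n → ℝ) :
    iteratedDeriv (2 * n) (outputProb h J) 0 / ((2 * n)! : ℝ) =
      ((Matrix.of J).permanent / n ^ n) ^ 2 := by
  set A : Matrix (Config n) (Config n) ℂ := (-Complex.I) • hamiltonian J h with hA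
  have hp : outputProb h J =
      fun t : ℝ => ‖(NormedSpace.exp (t • A)) (outputConfig n) (initialConfig n)‖ ^ 2 := by
    funext t
    have : (-Complex.I * (t : ℂ)) • hamiltonian J h = t • A := by
      rw [hA, mul_comm, mul_smul, ← Complex.coe_smul]
    rw [outputProb, this]
  have hpow : ∀ k, (A ^ k) (outputConfig n) (initialConfig n) =
      (-Complex.I) ^ k * (hamiltonian J h ^ k) (outputConfig n) (initialConfig n) := by
    intro k
    rw [hA, smul_pow, Matrix.smul_apply, smul_eq_mul]
  have hd : ∀ k, iteratedDeriv k
      (fun t : ℝ => (NormedSpace.exp (t • A)) (outputConfig n) (initialConfig n)) 0 =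
      (-Complex.I) ^ k * (hamiltonian J h ^ k) (outputConfig n) (initialConfig n) := by
    intro k
    rw [iteratedDeriv_exp_smul_apply]
    simp only [zero_smul, NormedSpace.exp_zero, one_mul, hpow]
  rw [hp, iteratedDeriv_norm_sq (contDiff_exp_smul_apply A _ _) n, hd,
    hamiltonian_pow_apply_self, norm_mul, norm_mul, norm_pow, norm_neg, Complex.norm_I, one_pow,
    one_mul, Complex.norm_natCast, Complex.norm_real, Real.norm_eq_abs, mul_pow, sq_abs]
  · have h1 : ((2 * n)! : ℝ) = (Nat.choose (2 * n) n : ℝ) * (n ! : ℝ) ^ 2 := by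
      have := Nat.choose_mul_factorial_mul_factorial (show n ≤ 2 * n by omega)
      rw [two_mul, Nat.add_sub_cancel] at this
      rw [two_mul, ← this]
      push_cast
      ring
    have h2 : (Nat.choose (2 * n) n : ℝ) ≠ 0 := by
      exact_mod_cast (Nat.choose_pos (by omega)).ne'
    have h3 : (n ! : ℝ) ≠ 0 := by exact_mod_cast (Nat.factorial_pos n).ne'
    rw [h1]
    field_simp
  · intro k hk
    rw [hd, hamiltonian_pow_apply_of_lt h J hk, mul_zero]

/-! ### Decoding a polynomial from unreliable values -/

/-- One step of orthogonalization: `P` is multiplied by the orthogonal projection away from the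
vector `P r`. If `P r = 0` then the convention `x / 0 = 0` leaves `P` as it is. -/
def projStep (m : ℕ) (P : ℕ → ℕ → ℝ) (r : ℕ → ℝ) : ℕ → ℕ → ℝ := fun j l =>
  P j l - (∑ i ∈ Finset.range m, P j i * r i) * (∑ i ∈ Finset.range m, P l i * r i) /
    ∑ j ∈ Finset.range m, (∑ i ∈ Finset.range m, P j i * r i) * (∑ i ∈ Finset.range m, P j i * r i)

/-- The `m × m` matrix of the orthogonal projection to the orthogonal complement of the first `i`
rows. -/
def rowProj (m : ℕ) (rows : ℕ → ℕ → ℝ) : ℕ → ℕ → ℕ → ℝ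
  | 0 => fun j l => if j = l then 1 else 0
  | i + 1 => projStep m (rowProj m rows i) (rows i)

/-- The `i`-th projection, as a matrix. -/
def rowProjMatrix (m : ℕ) (rows : ℕ → ℕ → ℝ) (i : ℕ) : Matrix (Fin m) (Fin m) ℝ :=
  Matrix.of fun j l => rowProj m rows i j l

lemma rowProjMatrix_zero (m : ℕ) (rows : ℕ → ℕ → ℝ) : rowProjMatrix m rows 0 = 1 := by
  ext j l
  simp [rowProjMatrix, rowProj, Matrix.one_apply, Fin.ext_iff]

lemma rowProjMatrix_succ (m : ℕ) (rows : ℕ → ℕ → ℝ) (i : ℕ) (u : Fin m → ℝ)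
    (hu : u = (rowProjMatrix m rows i).mulVec fun j => rows i j) :
    rowProjMatrix m rows (i + 1) =
      rowProjMatrix m rows i - (u ⬝ᵥ u)⁻¹ • Matrix.vecMulVec u u := by
  have h : ∀ j : Fin m, u j = ∑ l ∈ Finset.range m, rowProj m rows i j l * rows i l := by
    intro j
    rw [hu, Finset.sum_range]
    rfl
  ext j l
  simp only [rowProjMatrix, rowProj, projStep, Matrix.of_apply, Matrix.sub_apply,
    Matrix.smul_apply, Matrix.vecMulVec_apply, smul_eq_mul, dotProduct, h]
  rw [← Finset.sum_range fun j => (∑ l ∈ Finset.range m, rowProj m rows i j l * rows i l) *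
    ∑ l ∈ Finset.range m, rowProj m rows i j l * rows i l]
  ring

/-- The matrices `rowProjMatrix` are the orthogonal projections to the complements of the rows. -/
lemma rowProjMatrix_spec (m : ℕ) (rows : ℕ → ℕ → ℝ) (i : ℕ) :
    (rowProjMatrix m rows i).transpose = rowProjMatrix m rows i ∧
    rowProjMatrix m rows i * rowProjMatrix m rows i = rowProjMatrix m rows i ∧
    (∀ l < i, (rowProjMatrix m rows i).mulVec (fun j => rows l j) = 0) ∧
    ∀ z : Fin m → ℝ, (∀ l < i, (fun j : Fin m => rows l j) ⬝ᵥ z = 0) →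
      (rowProjMatrix m rows i).mulVec z = z := by
  induction i with
  | zero => simp [rowProjMatrix_zero]
  | succ i ih =>
    obtain ⟨hT, hI, hR, hZ⟩ := ih
    set P := rowProjMatrix m rows i with hP
    set r : Fin m → ℝ := fun j => rows i j with hr
    set u := P.mulVec r with hu
    have hPu : P.mulVec u = u := by rw [hu, Matrix.mulVec_mulVec, hI]
    have huP : Matrix.vecMul u P = u := by rw [← Matrix.mulVec_transpose, hT, hPu]
    have hdot : ∀ z, u ⬝ᵥ z = r ⬝ᵥ P.mulVec z := by
      intro z
      rw [Matrix.dotProduct_mulVec, ← Matrix.mulVec_transpose, hT]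
    have hur : u ⬝ᵥ r = u ⬝ᵥ u := by
      rw [hdot u, hPu, dotProduct_comm]
    rw [rowProjMatrix_succ m rows i u rfl, ← hP]
    refine ⟨?_, ?_, ?_, ?_⟩
    · rw [Matrix.transpose_sub, hT, Matrix.transpose_smul, Matrix.transpose_vecMulVec]
    · rw [sub_mul, mul_sub, mul_sub, hI, Matrix.mul_smul, Matrix.smul_mul, Matrix.smul_mul,
        Matrix.mul_smul, Matrix.mul_vecMulVec, hPu, Matrix.vecMulVec_mul, huP,
        Matrix.vecMulVec_mul_vecMulVec]
      by_cases h0 : u ⬝ᵥ u = 0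
      · simp [h0]
      · rw [Matrix.vecMulVec_smul, smul_smul, smul_smul, mul_assoc, inv_mul_cancel₀ h0,
          mul_one, sub_self, sub_zero]
    · intro l hl
      rw [Matrix.sub_mulVec, Matrix.smul_mulVec, Matrix.vecMulVec_mulVec]
      rcases Nat.lt_succ_iff_lt_or_eq.1 hl with h | rfl
      · rw [hR l h, hdot (fun j : Fin m => rows l j), hR l h]
        simp
      · change u - (u ⬝ᵥ u)⁻¹ • (MulOpposite.op (u ⬝ᵥ r) • u) = 0
        rw [hur, op_smul_eq_smul, smul_smul]
        by_cases h0 : u ⬝ᵥ u = 0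
        · rw [dotProduct_self_eq_zero.1 h0]
          simp
        · rw [inv_mul_cancel₀ h0, one_smul, sub_self]
    · intro z hz
      have h1 := hZ z fun l hl => hz l (Nat.lt_succ_of_lt hl)
      rw [Matrix.sub_mulVec, Matrix.smul_mulVec, Matrix.vecMulVec_mulVec, h1, hdot z, h1,
        hz i (Nat.lt_succ_self i)]
      simp

/-- A solvable inhomogeneous system, written as orthogonality to rows with last unknown `1`, is
solved by the normalized last column of the projection. -/
lemma rowProj_last_column (m : ℕ) (rows : ℕ → ℕ → ℝ) (M : ℕ)
    (hz : ∃ z : ℕ → ℝ, z m = 1 ∧ ∀ i < M, ∑ j ∈ Finset.range (m + 1), rows i j * z j = 0) :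
    ∀ i < M, ∑ j ∈ Finset.range m, rows i j *
      (rowProj (m + 1) rows M j m / rowProj (m + 1) rows M m m) + rows i m = 0 := by
  obtain ⟨hT, hI, hR, hZ⟩ := rowProjMatrix_spec (m + 1) rows M
  obtain ⟨z, hz1, hz2⟩ := hz
  set P := rowProjMatrix (m + 1) rows M with hP
  set v : Fin (m + 1) → ℝ := fun j => rowProj (m + 1) rows M j m with hv
  have hvP : v = P.mulVec (Pi.single (Fin.last m) 1) := by
    rw [Matrix.mulVec_single_one]
    funext j
    simp [hv, hP, rowProjMatrix]
  have hsymm : ∀ x y : Fin (m + 1) → ℝ, x ⬝ᵥ P.mulVec y = P.mulVec x ⬝ᵥ y := by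
    intro x y
    rw [Matrix.dotProduct_mulVec, ← Matrix.mulVec_transpose, hT]
  have hvlast : v ⬝ᵥ v = v (Fin.last m) := by
    conv_lhs => rw [hvP]
    rw [hsymm, Matrix.mulVec_mulVec, hI, ← hvP, dotProduct_single_one]
  have hzv : (fun j : Fin (m + 1) => z j) ⬝ᵥ v = 1 := by
    rw [hvP, hsymm, hZ, dotProduct_single_one]
    · simpa using hz1
    · intro l hl
      rw [← hz2 l hl, Finset.sum_range]
      rfl
  have hne : v (Fin.last m) ≠ 0 := by
    intro h0
    rw [h0, dotProduct_self_eq_zero] at hvlast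
    rw [hvlast] at hzv
    simp at hzv
  have hlast : v (Fin.last m) = rowProj (m + 1) rows M m m := by simp [hv]
  intro i hi
  have h1 : (fun j : Fin (m + 1) => rows i j) ⬝ᵥ v = 0 := by
    rw [hvP, hsymm, hR i hi, zero_dotProduct]
  have h2 : ∑ j ∈ Finset.range (m + 1), rows i j * rowProj (m + 1) rows M j m = 0 := by
    rw [Finset.sum_range]
    exact h1
  rw [Finset.sum_range_succ] at h2
  rw [hlast] at hne
  have h3 : ∑ j ∈ Finset.range m, rows i j *
      (rowProj (m + 1) rows M j m / rowProj (m + 1) rows M m m) =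
      (∑ j ∈ Finset.range m, rows i j * rowProj (m + 1) rows M j m) /
        rowProj (m + 1) rows M m m := by
    rw [Finset.sum_div]
    exact Finset.sum_congr rfl fun j _ => by ring
  rw [h3, eq_neg_of_add_eq_zero_left h2]
  field_simp
  ring

/-- The linear equation for the data point `(t, y)` in the unknowns `N₀, …, N_d`, `E₁, …, E_e`, `1`:
it says that `N(t) = y E(t)` for `N = ∑ Nⱼ Xʲ` and `E = 1 + ∑ Eₗ X^(2n+l)`. -/
def decodeRow (n d e : ℕ) (t y : ℝ) (j : ℕ) : ℝ :=
  if j < d + 1 then t ^ j else if j < d + 1 + e then -y * t ^ (2 * n + 1 + (j - (d + 1))) else -y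

/-- The decoded coefficient of `t ^ (2n)`, from the data points `(t i, y i)` with `i < M`. -/
def decodeValue (n d e M : ℕ) (t y : ℕ → ℝ) : ℝ :=
  rowProj (d + 1 + e + 1) (fun i => decodeRow n d e (t i) (y i)) M (2 * n) (d + 1 + e) /
    rowProj (d + 1 + e + 1) (fun i => decodeRow n d e (t i) (y i)) M (d + 1 + e) (d + 1 + e)

lemma sum_decodeRow (n d e : ℕ) (t y : ℝ) (z : ℕ → ℝ) :
    ∑ j ∈ Finset.range (d + 1 + e), decodeRow n d e t y j * z j + decodeRow n d e t y (d + 1 + e) =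
      ∑ j ∈ Finset.range (d + 1), z j * t ^ j -
        y * (1 + ∑ l ∈ Finset.range e, z (d + 1 + l) * t ^ (2 * n + 1 + l)) := by
  rw [Finset.sum_range_add]
  have h1 : ∀ j ∈ Finset.range (d + 1), decodeRow n d e t y j * z j = z j * t ^ j := by
    intro j hj
    rw [decodeRow, if_pos (Finset.mem_range.1 hj), mul_comm]
  have h2 : ∀ l ∈ Finset.range e, decodeRow n d e t y (d + 1 + l) * z (d + 1 + l) =
      -y * (z (d + 1 + l) * t ^ (2 * n + 1 + l)) := by
    intro l hl
    rw [decodeRow, if_neg (by omega), if_pos (by have := Finset.mem_range.1 hl; omega),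
      Nat.add_sub_cancel_left]
    ring
  have h3 : decodeRow n d e t y (d + 1 + e) = -y := by
    rw [decodeRow, if_neg (by omega), if_neg (by omega)]
  rw [Finset.sum_congr rfl h1, Finset.sum_congr rfl h2, h3, ← Finset.mul_sum]
  ring

open Polynomial in
/-- An error locator: a polynomial that vanishes on a given finite set of nonzero numbers and
is `1` up to the order `s`. -/
lemma exists_errorLocator (S : Finset ℝ) (hS : ∀ x ∈ S, x ≠ 0) (e s : ℕ) (he : S.card ≤ e) :
    ∃ z : ℕ → ℝ, ∀ x ∈ S, 1 + ∑ l ∈ Finset.range e, z l * x ^ (s + 1 + l) = 0 := by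
  set E₀ : ℝ[X] := ∏ x ∈ S, (X - C x) with hE₀
  have hmonic : E₀.Monic := monic_prod_of_monic _ _ fun x _ => monic_X_sub_C x
  have hdeg : E₀.natDegree = S.card := by
    rw [hE₀, natDegree_prod_of_monic _ _ fun x _ => monic_X_sub_C x]
    simp
  have hcop : IsCoprime (X ^ (s + 1) : ℝ[X]) E₀ := by
    refine IsCoprime.pow_left (IsCoprime.prod_right fun x hx => ?_)
    have := isCoprime_X_sub_C_of_isUnit_sub (a := (0 : ℝ)) (b := x)
      (by simpa using hS x hx)
    simpa using this
  obtain ⟨A, B, hAB⟩ := hcop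
  -- Reducing the cofactor of `E₀` modulo `X ^ (s + 1)` bounds the degree.
  set B' := B %ₘ X ^ (s + 1) with hB'
  have hB'deg : B'.natDegree < s + 1 := by
    have := natDegree_modByMonic_lt B (monic_X_pow (R := ℝ) (s + 1))
      (by intro h; have := congrArg natDegree h; simp at this)
    simpa using this
  set E := B' * E₀ with hE
  have hEdeg : E.natDegree ≤ s + e := by
    refine (natDegree_mul_le).trans ?_
    rw [hdeg]
    omega
  have hdvd : X ^ (s + 1) ∣ E - 1 := by
    have h1 : B = B' + X ^ (s + 1) * (B /ₘ X ^ (s + 1)) := (modByMonic_add_div B _).symm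
    refine ⟨-(A + (B /ₘ X ^ (s + 1)) * E₀), ?_⟩
    rw [hE]
    have : B' = B - X ^ (s + 1) * (B /ₘ X ^ (s + 1)) := eq_sub_of_add_eq h1.symm
    rw [this, ← hAB]
    ring
  rw [X_pow_dvd_iff] at hdvd
  refine ⟨fun l => E.coeff (s + 1 + l), fun x hx => ?_⟩
  have hev : E.eval x = 0 := by
    rw [hE, eval_mul, hE₀, eval_prod, Finset.prod_eq_zero hx (by simp), mul_zero]
  rw [eval_eq_sum_range' (show E.natDegree < s + 1 + e by omega), Finset.sum_range_add,
    Finset.sum_range_succ'] at hev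
  have h0 : E.coeff 0 = 1 := by
    have := hdvd 0 (by omega)
    rw [coeff_sub, coeff_one_zero] at this
    linarith
  have hs : ∑ k ∈ Finset.range s, E.coeff (k + 1) * x ^ (k + 1) = 0 := by
    refine Finset.sum_eq_zero fun k hk => ?_
    have := hdvd (k + 1) (by have := Finset.mem_range.1 hk; omega)
    rw [coeff_sub, coeff_one, if_neg (by omega), sub_zero] at this
    rw [this, zero_mul]
  rw [hs, h0] at hev
  simpa using hev

open Polynomial in
/-- Correctness of the decoder. If the data points with indices in `C` lie on the graph of `p`, and
there are at most `e` others, then the decoder finds the coefficient of `p`. With `M = 2e + 2D + 1`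
points, more of them are correct than the degree `e + 2D` of `N` and of `p E`. -/
theorem decodeValue_eq_coeff (n D e : ℕ) (hn : 2 * n ≤ D) (t y : ℕ → ℝ)
    (ht : ∀ i < 2 * e + 2 * D + 1, t i ≠ 0)
    (hinj : Set.InjOn t {i | i < 2 * e + 2 * D + 1})
    (p : ℝ[X]) (hp : p.natDegree ≤ D) (C : Finset ℕ) (hC : C ⊆ Finset.range (2 * e + 2 * D + 1))
    (hCcard : e + 2 * D + 1 ≤ C.card) (hCp : ∀ i ∈ C, y i = p.eval (t i)) :
    decodeValue n (e + 2 * D) e (2 * e + 2 * D + 1) t y = p.coeff (2 * n) := by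
  set M := 2 * e + 2 * D + 1 with hM
  set d := e + 2 * D with hd
  set rows : ℕ → ℕ → ℝ := fun i => decodeRow n d e (t i) (y i) with hrows
  -- The system is solvable: an error locator `E` and `N = p E` solve it.
  have hsolv : ∃ z : ℕ → ℝ, z (d + 1 + e) = 1 ∧
      ∀ i < M, ∑ j ∈ Finset.range (d + 1 + e + 1), rows i j * z j = 0 := by
    set S := (Finset.range M \ C).image t with hS
    have hScard : S.card ≤ e := by
      refine Finset.card_image_le.trans ?_
      rw [Finset.card_sdiff_of_subset hC, Finset.card_range]
      omega
    have hS0 : ∀ x ∈ S, x ≠ 0 := by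
      intro x hx
      obtain ⟨i, hi, rfl⟩ := Finset.mem_image.1 hx
      exact ht i (Finset.mem_range.1 (Finset.mem_sdiff.1 hi).1)
    obtain ⟨w, hw⟩ := exists_errorLocator S hS0 e (2 * n) hScard
    set E : ℝ[X] := 1 + ∑ l ∈ Finset.range e, Polynomial.C (w l) * X ^ (2 * n + 1 + l) with hE
    have hEev : ∀ x, E.eval x = 1 + ∑ l ∈ Finset.range e, w l * x ^ (2 * n + 1 + l) := by
      intro x
      rw [hE, eval_add, eval_finsetSum]
      simp
    have hEdeg : E.natDegree ≤ e + D := by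
      refine natDegree_add_le_of_degree_le (by simp) (natDegree_sum_le_of_forall_le _ _ ?_)
      intro l hl
      have := Finset.mem_range.1 hl
      exact (natDegree_C_mul_X_pow_le _ _).trans (by omega)
    have hNdeg : (p * E).natDegree < d + 1 := by
      have := natDegree_mul_le (p := p) (q := E)
      omega
    refine ⟨fun j => if j < d + 1 then (p * E).coeff j else
      if j < d + 1 + e then w (j - (d + 1)) else 1, ?_, ?_⟩
    · beta_reduce
      rw [if_neg (by omega), if_neg (by omega)]
    · intro i hi
      rw [Finset.sum_range_succ]
      have h1 : ∀ a : ℝ, a * (if d + 1 + e < d + 1 then (p * E).coeff (d + 1 + e) else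
          if d + 1 + e < d + 1 + e then w (d + 1 + e - (d + 1)) else 1) = a := by
        intro a
        rw [if_neg (by omega), if_neg (by omega), mul_one]
      rw [h1, hrows]
      simp only
      rw [sum_decodeRow]
      have h2 : ∑ j ∈ Finset.range (d + 1), (if j < d + 1 then (p * E).coeff j else
          if j < d + 1 + e then w (j - (d + 1)) else 1) * t i ^ j =
          p.eval (t i) * E.eval (t i) := by
        rw [← eval_mul, eval_eq_sum_range' hNdeg]
        refine Finset.sum_congr rfl fun j hj => ?_
        rw [if_pos (Finset.mem_range.1 hj)]
      have h3 : 1 + ∑ l ∈ Finset.range e, (if d + 1 + l < d + 1 then (p * E).coeff (d + 1 + l) else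
          if d + 1 + l < d + 1 + e then w (d + 1 + l - (d + 1)) else 1) *
            t i ^ (2 * n + 1 + l) = E.eval (t i) := by
        rw [hEev]
        congr 1
        refine Finset.sum_congr rfl fun l hl => ?_
        rw [if_neg (by omega), if_pos (by have := Finset.mem_range.1 hl; omega),
          Nat.add_sub_cancel_left]
      rw [h2, h3]
      by_cases hiC : i ∈ C
      · rw [hCp i hiC, sub_self]
      · have : E.eval (t i) = 0 := by
          rw [hEev]
          exact hw _ (Finset.mem_image.2 ⟨i, Finset.mem_sdiff.2 ⟨Finset.mem_range.2 hi, hiC⟩, rfl⟩)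
        rw [this, mul_zero, mul_zero, sub_self]
  have hsol := rowProj_last_column (d + 1 + e) rows M hsolv
  set z : ℕ → ℝ := fun j => rowProj (d + 1 + e + 1) rows M j (d + 1 + e) /
    rowProj (d + 1 + e + 1) rows M (d + 1 + e) (d + 1 + e) with hz
  -- Any solution satisfies `N = p E`, as `N - p E` has more roots than its degree allows.
  set E : ℝ[X] := 1 + ∑ l ∈ Finset.range e, Polynomial.C (z (d + 1 + l)) * X ^ (2 * n + 1 + l)
    with hE
  set N : ℝ[X] := ∑ j ∈ Finset.range (d + 1), Polynomial.C (z j) * X ^ j with hN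
  have hEev : ∀ x, E.eval x =
      1 + ∑ l ∈ Finset.range e, z (d + 1 + l) * x ^ (2 * n + 1 + l) := by
    intro x
    rw [hE, eval_add, eval_finsetSum]
    simp
  have hNev : ∀ x, N.eval x = ∑ j ∈ Finset.range (d + 1), z j * x ^ j := by
    intro x
    rw [hN, eval_finsetSum]
    simp
  have hEdeg : E.natDegree ≤ e + D := by
    refine natDegree_add_le_of_degree_le (by simp) (natDegree_sum_le_of_forall_le _ _ ?_)
    intro l hl
    have := Finset.mem_range.1 hl
    exact (natDegree_C_mul_X_pow_le _ _).trans (by omega)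
  have hNdeg : N.natDegree ≤ d := by
    refine natDegree_sum_le_of_forall_le _ _ ?_
    intro l hl
    have := Finset.mem_range.1 hl
    exact (natDegree_C_mul_X_pow_le _ _).trans (by omega)
  have hzero : N - p * E = 0 := by
    by_contra hne
    have hdeg : (N - p * E).natDegree ≤ d := by
      refine (natDegree_sub_le _ _).trans (max_le hNdeg ?_)
      have := natDegree_mul_le (p := p) (q := E)
      omega
    have hsub : (C.image t).val ⊆ (N - p * E).roots := by
      intro x hx
      obtain ⟨i, hi, rfl⟩ := Finset.mem_image.1 hx
      rw [mem_roots hne, IsRoot.def, eval_sub, eval_mul, hEev, hNev]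
      have := hsol i (Finset.mem_range.1 (hC hi))
      rw [hrows] at this
      simp only at this
      rw [sum_decodeRow, hCp i hi] at this
      exact this
    have h1 := Polynomial.card_le_degree_of_subset_roots hsub
    rw [Finset.card_image_of_injOn
      (hinj.mono fun i hi => Finset.mem_range.1 (hC hi))] at h1
    omega
  have hNp : N = p * E := sub_eq_zero.1 hzero
  have hcoeff : N.coeff (2 * n) = z (2 * n) := by
    rw [hN, finsetSum_coeff, Finset.sum_eq_single (2 * n)]
    · simp
    · intro j _ hj
      rw [coeff_C_mul_X_pow, if_neg (Ne.symm hj)]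
    · intro h
      exact absurd (Finset.mem_range.2 (by omega)) h
  -- As `E` is `1` up to order `2n`, the coefficients of `p` and of `p E` agree.
  have hEp : (p * E).coeff (2 * n) = p.coeff (2 * n) := by
    rw [hE, mul_add, mul_one, coeff_add, add_eq_left, Finset.mul_sum, finsetSum_coeff]
    refine Finset.sum_eq_zero fun l _ => ?_
    rw [← mul_assoc, coeff_mul_X_pow', if_neg (by omega)]
  rw [hNp, hEp] at hcoeff
  exact hcoeff.symm

/-! ### Measurability of the semantics of programs -/

section Semantics

variable {size : ℕ → ℕ}

open Classical in
/-- The final state of a run in which every loop is iterated at most `F` times. It is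
meaningful if `HaltsFuel` holds. -/
def runFuel (consts : List ℝ) (O : Oracle size) (ω : ℕ → unitInterval) (F : ℕ) :
    Prog → State → State
  | .skip, s => s
  | .setNat r e, s => s.setNat r (e.eval s)
  | .setReal a i e, s => s.setReal a (i.eval s) (e.eval consts s)
  | .draw a i, s => { s.setReal a (i.eval s) (ω s.pos : ℝ) with pos := s.pos + 1 }
  | .query b i n a, s => s.setReal b (i.eval s) (O (n.eval s) fun l => s.arr a l)
  | .seq c₁ c₂, s => runFuel consts O ω F c₂ (runFuel consts O ω F c₁ s)
  | .ite b c₁ c₂, s =>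
      if b.Holds consts s then runFuel consts O ω F c₁ s else runFuel consts O ω F c₂ s
  | .while b c, s => (fun s => if b.Holds consts s then runFuel consts O ω F c s else s)^[F] s

open Classical in
/-- One iteration of a loop; nothing happens if the test fails. -/
def loopStep (consts : List ℝ) (O : Oracle size) (ω : ℕ → unitInterval) (F : ℕ) (b : TestExpr)
    (c : Prog) (s : State) : State :=
  if b.Holds consts s then runFuel consts O ω F c s else s

lemma runFuel_while (consts : List ℝ) (O : Oracle size) (ω : ℕ → unitInterval) (F : ℕ)
    (b : TestExpr) (c : Prog) (s : State) :
    runFuel consts O ω F (.while b c) s = (loopStep consts O ω F b c)^[F] s := rfl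

/-- The run started in the given state halts, and every loop of it makes at most `F` iterations. -/
def HaltsFuel (consts : List ℝ) (O : Oracle size) (ω : ℕ → unitInterval) (F : ℕ) :
    Prog → State → Prop
  | .skip, _ => True
  | .setNat _ _, _ => True
  | .setReal _ _ _, _ => True
  | .draw _ _, _ => True
  | .query _ _ _ _, _ => True
  | .seq c₁ c₂, s =>
      HaltsFuel consts O ω F c₁ s ∧ HaltsFuel consts O ω F c₂ (runFuel consts O ω F c₁ s)
  | .ite b c₁ c₂, s => (b.Holds consts s → HaltsFuel consts O ω F c₁ s) ∧
      (¬ b.Holds consts s → HaltsFuel consts O ω F c₂ s)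
  | .while b c, s => ¬ b.Holds consts ((loopStep consts O ω F b c)^[F] s) ∧
      ∀ i, b.Holds consts ((loopStep consts O ω F b c)^[i] s) →
        HaltsFuel consts O ω F c ((loopStep consts O ω F b c)^[i] s)

lemma exec_runFuel (consts : List ℝ) (O : Oracle size) (ω : ℕ → unitInterval) (F : ℕ) (c : Prog) :
    ∀ s, HaltsFuel consts O ω F c s → ∃ T, Exec consts O ω c s T (runFuel consts O ω F c s) := by
  induction c with
  | skip => exact fun s _ => ⟨_, .skip s⟩
  | setNat r e => exact fun s _ => ⟨_, .setNat r e s⟩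
  | setReal a i e => exact fun s _ => ⟨_, .setReal a i e s⟩
  | draw a i => exact fun s _ => ⟨_, .draw a i s⟩
  | query b i n a => exact fun s _ => ⟨_, .query b i n a s⟩
  | seq c₁ c₂ ih₁ ih₂ =>
    intro s h
    obtain ⟨T₁, h₁⟩ := ih₁ s h.1
    obtain ⟨T₂, h₂⟩ := ih₂ _ h.2
    exact ⟨_, h₁.seq h₂⟩
  | ite b c₁ c₂ ih₁ ih₂ =>
    intro s h
    by_cases hb : b.Holds consts s
    · obtain ⟨T, hT⟩ := ih₁ s (h.1 hb)
      exact ⟨_, by rw [runFuel, if_pos hb]; exact .iteTrue hb hT⟩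
    · obtain ⟨T, hT⟩ := ih₂ s (h.2 hb)
      exact ⟨_, by rw [runFuel, if_neg hb]; exact .iteFalse hb hT⟩
  | _ b c ih =>
    intro s h
    rw [runFuel_while]
    have key : ∀ k ≤ F, ∃ T, Exec consts O ω (.while b c)
        ((loopStep consts O ω F b c)^[F - k] s) T ((loopStep consts O ω F b c)^[F] s) := by
      intro k
      induction k with
      | zero => exact fun _ => ⟨_, .whileFalse h.1⟩
      | succ k ihk =>
        intro hk
        obtain ⟨T, hT⟩ := ihk (by omega)
        have hsucc : F - k = F - (k + 1) + 1 := by omega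
        rw [hsucc, Function.iterate_succ_apply'] at hT
        by_cases hb : b.Holds consts ((loopStep consts O ω F b c)^[F - (k + 1)] s)
        · obtain ⟨T', hT'⟩ := ih _ (h.2 _ hb)
          rw [loopStep, if_pos hb] at hT
          exact ⟨_, .whileTrue hb hT' hT⟩
        · rw [loopStep, if_neg hb] at hT
          exact ⟨_, hT⟩
    obtain ⟨T, hT⟩ := key F le_rfl
    rw [Nat.sub_self] at hT
    exact ⟨T, hT⟩

lemma runFuel_of_exec (consts : List ℝ) (O : Oracle size) (ω : ℕ → unitInterval) {c : Prog}
    {s s' : State} {T : ℕ} (h : Exec consts O ω c s T s') :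
    ∀ F, T ≤ F → HaltsFuel consts O ω F c s ∧ runFuel consts O ω F c s = s' ∧
      ∀ b d, c = .while b d → ∀ i, T ≤ i → (loopStep consts O ω F b d)^[i] s = s' := by
  induction h with
  | skip s => exact fun F _ => ⟨trivial, rfl, by simp⟩
  | setNat r e s => exact fun F _ => ⟨trivial, rfl, by simp⟩
  | setReal a i e s => exact fun F _ => ⟨trivial, rfl, by simp⟩
  | draw a i s => exact fun F _ => ⟨trivial, rfl, by simp⟩
  | query b i n a s => exact fun F _ => ⟨trivial, rfl, by simp⟩
  | seq _ _ ih₁ ih₂ =>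
    intro F hF
    obtain ⟨h1, h2, -⟩ := ih₁ F (by omega)
    obtain ⟨h3, h4, -⟩ := ih₂ F (by omega)
    refine ⟨⟨h1, by rwa [h2]⟩, by rw [runFuel, h2, h4], by simp⟩
  | iteTrue hb _ ih =>
    intro F hF
    obtain ⟨h1, h2, -⟩ := ih F (by omega)
    exact ⟨⟨fun _ => h1, fun hn => absurd hb hn⟩, by rw [runFuel, if_pos hb, h2], by simp⟩
  | iteFalse hb _ ih =>
    intro F hF
    obtain ⟨h1, h2, -⟩ := ih F (by omega)
    exact ⟨⟨fun hn => absurd hn hb, fun _ => h1⟩, by rw [runFuel, if_neg hb, h2], by simp⟩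
  | @whileTrue b c s s' s'' T₁ T₂ hb _ _ ih₁ ih₂ =>
    intro F hF
    obtain ⟨h1, h2, -⟩ := ih₁ F (by omega)
    obtain ⟨h3, h4, h5⟩ := ih₂ F (by omega)
    have hstep : loopStep consts O ω F b c s = s' := by rw [loopStep, if_pos hb, h2]
    have h6 : ∀ i, T₁ + T₂ + 1 ≤ i → (loopStep consts O ω F b c)^[i] s = s'' := by
      intro i hi
      obtain ⟨j, rfl⟩ : ∃ j, i = j + 1 := ⟨i - 1, by omega⟩
      rw [Function.iterate_succ_apply, hstep]
      exact h5 b c rfl j (by omega)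
    refine ⟨⟨?_, ?_⟩, h6 F hF, ?_⟩
    · rw [h6 F hF, ← h5 b c rfl F (by omega)]
      exact h3.1
    · intro i hi
      cases i with
      | zero => exact h1
      | succ i =>
        rw [Function.iterate_succ_apply, hstep] at hi ⊢
        exact h3.2 i hi
    · rintro b' d' h i hi
      cases h
      exact h6 i hi
  | @whileFalse b c s hb =>
    intro F hF
    have h6 : ∀ i, (loopStep consts O ω F b c)^[i] s = s := by
      intro i
      exact Function.iterate_fixed (by rw [loopStep, if_neg hb]) i
    refine ⟨⟨by rwa [h6], fun i hi => absurd (by rwa [h6] at hi) hb⟩, h6 F, ?_⟩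
    rintro b' d' h i hi
    cases h
    exact h6 i

end Semantics

section Measurability

variable {X : Type*} [MeasurableSpace X] {size : ℕ → ℕ}

/-- A random state, all of whose registers and cells are measurable. -/
structure MeasurableState (s : X → State) : Prop where
  nat : ∀ r, Measurable fun x => (s x).nat r
  arr : ∀ a i, Measurable fun x => (s x).arr a i
  pos : Measurable fun x => (s x).pos

lemma measurable_apply_nat {Y : Type*} [MeasurableSpace Y] {f : ℕ → X → Y} {g : X → ℕ}
    (hf : ∀ n, Measurable (f n)) (hg : Measurable g) : Measurable fun x => f (g x) x :=
  (measurable_from_prod_countable_right (f := fun p : ℕ × X => f p.1 p.2) hf).comp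
    (hg.prodMk measurable_id)

namespace MeasurableState

variable {s : X → State}

lemma natExpr (hs : MeasurableState s) (e : NatExpr) : Measurable fun x => e.eval (s x) := by
  induction e with
  | const c => exact measurable_const
  | reg r => exact hs.nat r
  | add e₁ e₂ ih₁ ih₂ => exact ih₁.add ih₂
  | sub e₁ e₂ ih₁ ih₂ => exact ih₁.sub ih₂
  | mul e₁ e₂ ih₁ ih₂ => exact ih₁.mul ih₂

lemma realExpr (hs : MeasurableState s) (consts : List ℝ) (e : RealExpr) :
    Measurable fun x => e.eval consts (s x) := by
  induction e with
  | ofNat e => exact measurable_from_nat.comp (hs.natExpr e)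
  | param i => exact measurable_const
  | get a i => exact measurable_apply_nat (hs.arr a) (hs.natExpr i)
  | add e₁ e₂ ih₁ ih₂ => exact ih₁.add ih₂
  | sub e₁ e₂ ih₁ ih₂ => exact ih₁.sub ih₂
  | mul e₁ e₂ ih₁ ih₂ => exact ih₁.mul ih₂
  | div e₁ e₂ ih₁ ih₂ => exact ih₁.div ih₂

lemma testExpr (hs : MeasurableState s) (consts : List ℝ) (b : TestExpr) :
    MeasurableSet {x | b.Holds consts (s x)} := by
  induction b with
  | natLt e₁ e₂ => exact measurableSet_lt (hs.natExpr e₁) (hs.natExpr e₂)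
  | realLt e₁ e₂ => exact measurableSet_lt (hs.realExpr consts e₁) (hs.realExpr consts e₂)
  | not b ih => exact ih.compl
  | and b₁ b₂ ih₁ ih₂ => exact ih₁.inter ih₂

lemma setReal (hs : MeasurableState s) (a : ℕ) {i : X → ℕ} {v : X → ℝ} (hi : Measurable i)
    (hv : Measurable v) : MeasurableState fun x => (s x).setReal a (i x) (v x) := by
  refine ⟨hs.nat, fun a' j => ?_, hs.pos⟩
  by_cases ha : a' = a
  · subst ha
    have : (fun x => ((s x).setReal a' (i x) (v x)).arr a' j) =
        fun x => if j = i x then v x else (s x).arr a' j := by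
      funext x
      simp [State.setReal, Function.update_apply]
    rw [this]
    exact Measurable.ite (measurableSet_eq_fun measurable_const hi) hv (hs.arr a' j)
  · have : (fun x => ((s x).setReal a (i x) (v x)).arr a' j) = fun x => (s x).arr a' j := by
      funext x
      simp [State.setReal, ha]
    rw [this]
    exact hs.arr a' j

lemma ite (p : X → Prop) [DecidablePred p] (hp : MeasurableSet {x | p x}) {s' : X → State}
    (hs : MeasurableState s) (hs' : MeasurableState s') :
    MeasurableState fun x => if p x then s x else s' x := by
  refine ⟨fun r => ?_, fun a i => ?_, ?_⟩
  · simpa only [apply_ite (fun s : State => s.nat r)] using Measurable.ite hp (hs.nat r) (hs'.nat r)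
  · simpa only [apply_ite (fun s : State => s.arr a i)] using
      Measurable.ite hp (hs.arr a i) (hs'.arr a i)
  · simpa only [apply_ite State.pos] using Measurable.ite hp hs.pos hs'.pos

/-- The run of a program is a measurable function of its initial state, the random numbers and the
(randomized) oracle. -/
theorem runFuel (consts : List ℝ) {O : X → Oracle size} {ω : X → ℕ → unitInterval}
    (hO : ∀ n, Measurable fun p : X × (Fin (size n) → ℝ) => O p.1 n p.2) (hω : Measurable ω)
    (F : ℕ) (c : Prog) : ∀ s : X → State, MeasurableState s →
      MeasurableState (fun x => runFuel consts (O x) (ω x) F c (s x)) ∧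
        MeasurableSet {x | HaltsFuel consts (O x) (ω x) F c (s x)} := by
  classical
  induction c with
  | skip => exact fun s hs => ⟨hs, MeasurableSet.univ⟩
  | setNat r e =>
    intro s hs
    refine ⟨⟨fun r' => ?_, hs.arr, hs.pos⟩, MeasurableSet.univ⟩
    by_cases hr : r' = r
    · subst hr
      simpa [SharpHardness.runFuel, State.setNat] using hs.natExpr e
    · simpa [SharpHardness.runFuel, State.setNat, hr] using hs.nat r'
  | setReal a i e =>
    exact fun s hs => ⟨hs.setReal a (hs.natExpr i) (hs.realExpr consts e), MeasurableSet.univ⟩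
  | draw a i =>
    intro s hs
    have hv : Measurable fun x => (ω x (s x).pos : ℝ) :=
      measurable_subtype_coe.comp
        (measurable_apply_nat (fun n => (measurable_pi_apply n).comp hω) hs.pos)
    have := hs.setReal a (hs.natExpr i) hv
    exact ⟨⟨this.nat, this.arr, hs.pos.add measurable_const⟩, MeasurableSet.univ⟩
  | query b i n a =>
    intro s hs
    refine ⟨hs.setReal b (hs.natExpr i) ?_, MeasurableSet.univ⟩
    refine measurable_apply_nat (f := fun n x => O x n fun l => (s x).arr a l) (fun n => ?_)
      (hs.natExpr n)
    exact (hO n).comp (measurable_id.prodMk (measurable_pi_lambda _ fun l => hs.arr a l))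
  | seq c₁ c₂ ih₁ ih₂ =>
    intro s hs
    obtain ⟨h1, h2⟩ := ih₁ s hs
    obtain ⟨h3, h4⟩ := ih₂ _ h1
    exact ⟨h3, h2.inter h4⟩
  | ite b c₁ c₂ ih₁ ih₂ =>
    intro s hs
    obtain ⟨h1, h2⟩ := ih₁ s hs
    obtain ⟨h3, h4⟩ := ih₂ s hs
    have hb := hs.testExpr consts b
    refine ⟨MeasurableState.ite _ hb h1 h3, ?_⟩
    exact (hb.imp h2).inter (hb.compl.imp h4)
  | _ b c ih =>
    intro s hs
    have hiter : ∀ i, MeasurableState fun x =>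
        (loopStep consts (O x) (ω x) F b c)^[i] (s x) := by
      intro i
      induction i with
      | zero => exact hs
      | succ i ihi =>
        simp only [Function.iterate_succ_apply']
        exact MeasurableState.ite _ (ihi.testExpr consts b) (ih _ ihi).1 ihi
    refine ⟨hiter F, ?_⟩
    have h2 : MeasurableSet {x | ∀ i,
        b.Holds consts ((loopStep consts (O x) (ω x) F b c)^[i] (s x)) →
        HaltsFuel consts (O x) (ω x) F c ((loopStep consts (O x) (ω x) F b c)^[i] (s x))} := by
      rw [Set.ofPred_forall]
      exact MeasurableSet.iInter fun i => ((hiter i).testExpr consts b).imp (ih _ (hiter i)).2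
    exact ((hiter F).testExpr consts b).compl.inter h2

end MeasurableState

/-- The event that a program halts with a given output is measurable. -/
theorem measurableSet_exec (consts : List ℝ) {O : X → Oracle size} {ω : X → ℕ → unitInterval}
    (hO : ∀ n, Measurable fun p : X × (Fin (size n) → ℝ) => O p.1 n p.2) (hω : Measurable ω)
    (c : Prog) (s₀ : State) (v : ℝ) :
    MeasurableSet {x | ∃ (T : ℕ) (s : State), Exec consts (O x) (ω x) c s₀ T s ∧
      s.arr 0 0 = v} := by
  have hs : MeasurableState fun _ : X => s₀ :=
    ⟨fun _ => measurable_const, fun _ _ => measurable_const, measurable_const⟩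
  have : {x | ∃ (T : ℕ) (s : State), Exec consts (O x) (ω x) c s₀ T s ∧ s.arr 0 0 = v} =
      ⋃ F, ({x | HaltsFuel consts (O x) (ω x) F c s₀} ∩
        {x | (runFuel consts (O x) (ω x) F c s₀).arr 0 0 = v}) := by
    ext x
    simp only [Set.mem_ofPred_eq, Set.mem_iUnion, Set.mem_inter_iff]
    constructor
    · rintro ⟨T, s, h, hv⟩
      obtain ⟨h1, h2, -⟩ := runFuel_of_exec consts _ _ h T le_rfl
      exact ⟨T, h1, by rwa [h2]⟩
    · rintro ⟨F, h1, h2⟩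
      obtain ⟨T, hT⟩ := exec_runFuel consts _ _ F c s₀ h1
      exact ⟨T, _, hT, h2⟩
  rw [this]
  refine MeasurableSet.iUnion fun F => ?_
  obtain ⟨h1, h2⟩ := hs.runFuel consts hO hω F c
  exact h2.inter (measurableSet_eq_fun (h1.arr 0 0) measurable_const)

end Measurability

/-! ### Rules for the verification of loops -/

namespace Prog

/-- The program may assign to the register `r`. -/
def WritesNat (r : ℕ) : Prog → Prop
  | .setNat r' _ => r' = r
  | .seq c₁ c₂ => c₁.WritesNat r ∨ c₂.WritesNat r
  | .ite _ c₁ c₂ => c₁.WritesNat r ∨ c₂.WritesNat r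
  | .while _ c => c.WritesNat r
  | _ => False

/-- The program may assign to cells of the array `a`. -/
def WritesArr (a : ℕ) : Prog → Prop
  | .setReal a' _ _ => a' = a
  | .draw a' _ => a' = a
  | .query b _ _ _ => b = a
  | .seq c₁ c₂ => c₁.WritesArr a ∨ c₂.WritesArr a
  | .ite _ c₁ c₂ => c₁.WritesArr a ∨ c₂.WritesArr a
  | .while _ c => c.WritesArr a
  | _ => False

/-- The program may draw random numbers. -/
def Draws : Prog → Prop
  | .draw _ _ => True
  | .seq c₁ c₂ => c₁.Draws ∨ c₂.Draws
  | .ite _ c₁ c₂ => c₁.Draws ∨ c₂.Draws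
  | .while _ c => c.Draws
  | _ => False

/-- The loop `for r = 0, …, e - 1 do c`. -/
def forLoop (r : ℕ) (e : NatExpr) (c : Prog) : Prog :=
  .seq (.setNat r (.const 0)) (.while (.natLt (.reg r) e)
    (.seq c (.setNat r (.add (.reg r) (.const 1)))))

@[simp] lemma writesNat_forLoop {r r' : ℕ} {e : NatExpr} {c : Prog} :
    (forLoop r e c).WritesNat r' ↔ r = r' ∨ c.WritesNat r' := by
  simp only [forLoop, WritesNat]; tauto

@[simp] lemma writesArr_forLoop {r a : ℕ} {e : NatExpr} {c : Prog} :
    (forLoop r e c).WritesArr a ↔ c.WritesArr a := by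
  simp [forLoop, WritesArr]

@[simp] lemma draws_forLoop {r : ℕ} {e : NatExpr} {c : Prog} :
    (forLoop r e c).Draws ↔ c.Draws := by
  simp [forLoop, Draws]

end Prog

open Prog

/-- The states `s` and `s'` agree outside what the program `c` may change. -/
structure Frame (c : Prog) (s s' : State) : Prop where
  nat : ∀ r, ¬ c.WritesNat r → s'.nat r = s.nat r
  arr : ∀ a, ¬ c.WritesArr a → s'.arr a = s.arr a
  pos : ¬ c.Draws → s'.pos = s.pos

section Runs

variable {size : ℕ → ℕ} {consts : List ℝ} {O : Oracle size} {ω : ℕ → unitInterval}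

lemma frame_of_exec {c : Prog} {s s' : State} {T : ℕ} (h : Exec consts O ω c s T s') :
    Frame c s s' := by
  have hset : ∀ (s : State) (a i a' : ℕ) (v : ℝ), ¬ a = a' →
      (s.setReal a i v).arr a' = s.arr a' := by
    intro s a i a' v h
    simp [State.setReal, Function.update_of_ne (Ne.symm h)]
  induction h with
  | skip s => exact ⟨fun _ _ => rfl, fun _ _ => rfl, fun _ => rfl⟩
  | setNat r e s =>
    exact ⟨fun r' h => Function.update_of_ne (Ne.symm h) _ _, fun _ _ => rfl, fun _ => rfl⟩
  | setReal a i e s => exact ⟨fun _ _ => rfl, fun a' h => hset _ _ _ _ _ h, fun _ => rfl⟩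
  | draw a i s =>
    exact ⟨fun _ _ => rfl, fun a' h => hset _ _ _ _ _ h, fun h => absurd trivial h⟩
  | query b i n a s => exact ⟨fun _ _ => rfl, fun a' h => hset _ _ _ _ _ h, fun _ => rfl⟩
  | seq _ _ ih₁ ih₂ =>
    refine ⟨fun r h => ?_, fun a h => ?_, fun h => ?_⟩
    · rw [ih₂.nat r fun h' => h (Or.inr h'), ih₁.nat r fun h' => h (Or.inl h')]
    · rw [ih₂.arr a fun h' => h (Or.inr h'), ih₁.arr a fun h' => h (Or.inl h')]
    · rw [ih₂.pos fun h' => h (Or.inr h'), ih₁.pos fun h' => h (Or.inl h')]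
  | iteTrue _ _ ih =>
    exact ⟨fun r h => ih.nat r fun h' => h (Or.inl h'), fun r h => ih.arr r fun h' => h (Or.inl h'),
      fun h => ih.pos fun h' => h (Or.inl h')⟩
  | iteFalse _ _ ih =>
    exact ⟨fun r h => ih.nat r fun h' => h (Or.inr h'), fun r h => ih.arr r fun h' => h (Or.inr h'),
      fun h => ih.pos fun h' => h (Or.inr h')⟩
  | whileTrue _ _ _ ih₁ ih₂ =>
    refine ⟨fun r h => ?_, fun a h => ?_, fun h => ?_⟩
    · rw [ih₂.nat r h, ih₁.nat r h]
    · rw [ih₂.arr a h, ih₁.arr a h]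
    · rw [ih₂.pos h, ih₁.pos h]
  | whileFalse _ => exact ⟨fun _ _ => rfl, fun _ _ => rfl, fun _ => rfl⟩

variable (consts O ω) in
/-- Started in the state `s`, the program `c` halts within `C` steps, and the arrays then
satisfy `Q`. What happens to the registers is left to `Frame`. -/
def Runs (c : Prog) (s : State) (C : ℕ) (Q : (ℕ → ℕ → ℝ) → Prop) : Prop :=
  ∃ (T : ℕ) (s' : State), Exec consts O ω c s T s' ∧ T ≤ C ∧ Q s'.arr

lemma Runs.setReal {a : ℕ} {i : NatExpr} {e : RealExpr} {s : State} {Q : (ℕ → ℕ → ℝ) → Prop}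
    (h : Q (Function.update s.arr a
      (Function.update (s.arr a) (i.eval s) (e.eval consts s)))) :
    Runs consts O ω (.setReal a i e) s 1 Q :=
  ⟨1, _, .setReal a i e s, le_rfl, h⟩

lemma Runs.query {b a : ℕ} {i n : NatExpr} {s : State} {Q : (ℕ → ℕ → ℝ) → Prop}
    (h : Q (Function.update s.arr b
      (Function.update (s.arr b) (i.eval s) (O (n.eval s) fun l => s.arr a l)))) :
    Runs consts O ω (.query b i n a) s (size (n.eval s) + 1) Q :=
  ⟨_, _, .query b i n a s, le_rfl, h⟩

lemma Runs.seq {c₁ c₂ : Prog} {s : State} {C₁ C₂ : ℕ} {Q₁ Q : (ℕ → ℕ → ℝ) → Prop}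
    (h₁ : Runs consts O ω c₁ s C₁ Q₁)
    (h₂ : ∀ s', Frame c₁ s s' → Q₁ s'.arr → Runs consts O ω c₂ s' C₂ Q) :
    Runs consts O ω (.seq c₁ c₂) s (C₁ + C₂) Q := by
  obtain ⟨T₁, s₁, he₁, hT₁, hQ₁⟩ := h₁
  obtain ⟨T₂, s₂, he₂, hT₂, hQ₂⟩ := h₂ s₁ (frame_of_exec he₁) hQ₁
  exact ⟨_, _, he₁.seq he₂, by omega, hQ₂⟩

lemma Runs.mono {c : Prog} {s : State} {C C' : ℕ} {Q Q' : (ℕ → ℕ → ℝ) → Prop}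
    (h : Runs consts O ω c s C Q) (hC : C ≤ C') (hQ : ∀ A, Q A → Q' A) :
    Runs consts O ω c s C' Q' := by
  obtain ⟨T, s', he, hT, hQ'⟩ := h
  exact ⟨T, s', he, hT.trans hC, hQ _ hQ'⟩

/-- The loop rule, with an invariant `I` that concerns the arrays only. -/
lemma Runs.forLoop {r : ℕ} {e : NatExpr} {c : Prog} {s : State} {N C : ℕ}
    (I : ℕ → (ℕ → ℕ → ℝ) → Prop) (hr : ¬ c.WritesNat r)
    (he : ∀ s', Frame (forLoop r e c) s s' → e.eval s' = N) (h0 : I 0 s.arr)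
    (hstep : ∀ i < N, ∀ s', Frame (Prog.forLoop r e c) s s' → s'.nat r = i → I i s'.arr →
      Runs consts O ω c s' C (I (i + 1))) :
    Runs consts O ω (Prog.forLoop r e c) s (N * (C + 2) + 2) (I N) := by
  have hincr : ∀ i ≤ N, ∀ s', Frame (Prog.forLoop r e c) s s' → s'.nat r = N - i →
      I (N - i) s'.arr → ∃ (T : ℕ) (s'' : State), Exec consts O ω
        (.while (.natLt (.reg r) e) (.seq c (.setNat r (.add (.reg r) (.const 1))))) s' T s'' ∧
        T ≤ i * (C + 2) + 1 ∧ I N s''.arr := by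
    intro i
    induction i with
    | zero =>
      intro _ s' hf hs' hI
      refine ⟨_, _, .whileFalse ?_, by omega, hI⟩
      simp only [TestExpr.Holds, NatExpr.eval, he s' hf, hs', Nat.sub_zero, lt_irrefl,
        not_false_eq_true]
    | succ i ih =>
      intro hi s' hf hs' hI
      obtain ⟨T₁, s₁, he₁, hT₁, hI₁⟩ := hstep (N - (i + 1)) (by omega) s' hf hs' hI
      have hf₁ := frame_of_exec he₁
      set s₂ := s₁.setNat r ((NatExpr.add (.reg r) (.const 1)).eval s₁) with hs₂
      have hN : N - (i + 1) + 1 = N - i := by omega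
      have hr₂ : s₂.nat r = N - i := by
        simp only [hs₂, State.setNat, Function.update_self, NatExpr.eval]
        rw [hf₁.nat r hr, hs', hN]
      have hf₂ : Frame (Prog.forLoop r e c) s s₂ := by
        refine ⟨fun r' h => ?_, fun a h => ?_, fun h => ?_⟩
        · have h' : ¬ (r = r' ∨ c.WritesNat r') := fun h' => h (writesNat_forLoop.2 h')
          rw [not_or] at h'
          rw [← hf.nat r' h, ← hf₁.nat r' h'.2]
          exact Function.update_of_ne (Ne.symm h'.1) _ _
        · rw [← hf.arr a h, ← hf₁.arr a fun h' => h (writesArr_forLoop.2 h')]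
          rfl
        · rw [← hf.pos h, ← hf₁.pos fun h' => h (draws_forLoop.2 h')]
          rfl
      obtain ⟨T₂, s₃, he₂, hT₂, hI₂⟩ := ih (by omega) s₂ hf₂ hr₂ (by rw [hN] at hI₁; exact hI₁)
      refine ⟨_, _, .whileTrue ?_ (he₁.seq (.setNat _ _ _)) he₂, ?_, hI₂⟩
      · simp only [TestExpr.Holds, NatExpr.eval, he s' hf, hs']
        omega
      · rw [Nat.succ_mul]
        omega
  have hf₀ : Frame (Prog.forLoop r e c) s (s.setNat r 0) := by
    refine ⟨fun r' h => ?_, fun _ _ => rfl, fun _ => rfl⟩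
    refine Function.update_of_ne (fun h' => h (writesNat_forLoop.2 (Or.inl h'.symm))) _ _
  obtain ⟨T, s', hT, hTle, hI⟩ := hincr N le_rfl (s.setNat r 0) hf₀
    (by simp [State.setNat]) (by rw [Nat.sub_self]; exact h0)
  exact ⟨_, _, (Exec.setNat r (.const 0) s).seq hT, by omega, hI⟩

/-- A loop that fills a segment of an array. The value of a cell may depend on the cells
that have already been filled. -/
lemma Runs.tabulate {r a : ℕ} {e i : NatExpr} {f : RealExpr} {s : State} {N : ℕ} (off : ℕ)
    (g : ℕ → ℝ)
    (he : ∀ s', Frame (Prog.forLoop r e (.setReal a i f)) s s' → e.eval s' = N)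
    (hf : ∀ l < N, ∀ s', Frame (Prog.forLoop r e (.setReal a i f)) s s' → s'.nat r = l →
      (∀ l' < l, s'.arr a (off + l') = g l') →
      (∀ j, (j < off ∨ off + l ≤ j) → s'.arr a j = s.arr a j) →
      i.eval s' = off + l ∧ f.eval consts s' = g l) :
    Runs consts O ω (Prog.forLoop r e (.setReal a i f)) s (N * 3 + 2) (fun A =>
      (∀ l < N, A a (off + l) = g l) ∧ ∀ j, (j < off ∨ off + N ≤ j) → A a j = s.arr a j) := by
  refine Runs.forLoop (C := 1) (fun n A => (∀ l < n, A a (off + l) = g l) ∧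
    ∀ j, (j < off ∨ off + n ≤ j) → A a j = s.arr a j) (by simp [WritesNat]) he (by simp) ?_
  intro l hl s' hfr hs' hI
  obtain ⟨hi, hv⟩ := hf l hl s' hfr hs' hI.1 hI.2
  refine Runs.setReal ⟨fun l' hl' => ?_, fun j hj => ?_⟩
  · rw [Function.update_self, hi, hv]
    rcases Nat.lt_succ_iff_lt_or_eq.1 hl' with h | rfl
    · rw [Function.update_of_ne (by omega), hI.1 l' h]
    · rw [Function.update_self]
  · rw [Function.update_self, hi, Function.update_of_ne (by omega)]
    exact hI.2 j (by omega)

lemma cell_injective {m j l j' l' : ℕ} (hl : l < m) (hl' : l' < m)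
    (h : j * m + l = j' * m + l') : j = j' ∧ l = l' := by
  have hm : 0 < m := by omega
  have h1 : (j * m + l) / m = j := by
    rw [mul_comm, Nat.mul_add_div hm, Nat.div_eq_of_lt hl, add_zero]
  have h2 : (j' * m + l') / m = j' := by
    rw [mul_comm, Nat.mul_add_div hm, Nat.div_eq_of_lt hl', add_zero]
  have h3 : j = j' := by rw [← h1, h, h2]
  subst h3
  exact ⟨rfl, by omega⟩

/-- The cell of the loop counters in an array that stores a square matrix row by row. -/
def cell (r r' m : ℕ) : NatExpr := .add (.mul (.reg r) (.reg m)) (.reg r')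

/-- A double loop that updates every entry of a square matrix. -/
lemma Runs.tabulate₂ {r r' q a : ℕ} {f : RealExpr} {s : State} {m : ℕ} (g : ℕ → ℕ → ℝ)
    (hrr : r ≠ r') (hqr : q ≠ r) (hqr' : q ≠ r') (hq : s.nat q = m)
    (hf : ∀ j < m, ∀ l < m, ∀ s', Frame (Prog.forLoop r (.reg q)
        (Prog.forLoop r' (.reg q) (.setReal a (cell r r' q) f))) s s' →
      s'.nat r = j → s'.nat r' = l → s'.arr a (j * m + l) = s.arr a (j * m + l) →
      f.eval consts s' = g j l) :
    Runs consts O ω (Prog.forLoop r (.reg q)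
        (Prog.forLoop r' (.reg q) (.setReal a (cell r r' q) f))) s
      (m * (m * 3 + 2 + 2) + 2) (fun A => ∀ j < m, ∀ l < m, A a (j * m + l) = g j l) := by
  have hqs : ∀ s', Frame (Prog.forLoop r (.reg q)
      (Prog.forLoop r' (.reg q) (.setReal a (cell r r' q) f))) s s' → s'.nat q = m := by
    intro s' h
    rw [h.nat q (by simp [WritesNat, hqr.symm, hqr'.symm]), hq]
  refine Runs.mono (Runs.forLoop (N := m) (C := m * 3 + 2)
    (fun n A => (∀ j < n, ∀ l < m, A a (j * m + l) = g j l) ∧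
      ∀ j, n ≤ j → ∀ l < m, A a (j * m + l) = s.arr a (j * m + l))
    (by simp [WritesNat, hrr.symm]) hqs (by simp) ?_) le_rfl (fun A h => h.1)
  intro j hj s₁ hfr₁ hj₁ hI
  have hframe : ∀ s', Frame (Prog.forLoop r' (.reg q) (.setReal a (cell r r' q) f)) s₁ s' →
      Frame (Prog.forLoop r (.reg q)
        (Prog.forLoop r' (.reg q) (.setReal a (cell r r' q) f))) s s' := by
    intro s' h
    refine ⟨fun x hx => ?_, fun x hx => ?_, fun hx => ?_⟩
    · rw [h.nat x fun h' => hx (by simp only [writesNat_forLoop] at h' ⊢; exact Or.inr h'),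
        hfr₁.nat x hx]
    · rw [h.arr x fun h' => hx (by simp only [writesArr_forLoop] at h' ⊢; exact h'), hfr₁.arr x hx]
    · rw [h.pos fun h' => hx (by simp only [draws_forLoop] at h' ⊢; exact h'), hfr₁.pos hx]
  refine Runs.mono (Runs.tabulate (N := m) (j * m) (fun l => g j l)
    (fun s' h => hqs s' (hframe s' h)) ?_) le_rfl ?_
  · intro l hl s' h hl' _ hout
    have hj' : s'.nat r = j := by rw [h.nat r (by simp [WritesNat, hrr.symm]), hj₁]
    refine ⟨by simp only [cell, NatExpr.eval, hj', hl', hqs s' (hframe s' h)], ?_⟩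
    refine hf j hj l hl s' (hframe s' h) hj' hl' ?_
    rw [hout _ (by omega), hI.2 j le_rfl l hl]
  · intro A hA
    have hother : ∀ j', j' ≠ j → ∀ l < m, A a (j' * m + l) = s₁.arr a (j' * m + l) := by
      intro j' hj' l hl
      apply hA.2
      by_contra hcon
      have : j' * m + l = j * m + (j' * m + l - j * m) := by omega
      exact hj' (cell_injective hl (by omega) this).1
    refine ⟨fun j' hj' l hl => ?_, fun j' hj' l hl => ?_⟩
    · rcases Nat.lt_succ_iff_lt_or_eq.1 hj' with h | rfl
      · rw [hother j' h.ne l hl, hI.1 j' h l hl]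
      · exact hA.1 l hl
    · rw [hother j' (by omega) l hl, hI.2 j' (by omega) l hl]

/-- A loop that adds up values in a cell. -/
lemma Runs.accumulate {r a : ℕ} {e i : NatExpr} {f : RealExpr} {s : State} {N : ℕ} (k : ℕ)
    (g : ℕ → ℝ)
    (he : ∀ s', Frame (Prog.forLoop r e (.setReal a i (.add (.get a i) f))) s s' → e.eval s' = N)
    (hi : ∀ s', Frame (Prog.forLoop r e (.setReal a i (.add (.get a i) f))) s s' → i.eval s' = k)
    (hf : ∀ l < N, ∀ s', Frame (Prog.forLoop r e (.setReal a i (.add (.get a i) f))) s s' →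
      s'.nat r = l → (∀ j, j ≠ k → s'.arr a j = s.arr a j) → f.eval consts s' = g l) :
    Runs consts O ω (Prog.forLoop r e (.setReal a i (.add (.get a i) f))) s (N * 3 + 2) (fun A =>
      A a k = s.arr a k + ∑ l ∈ Finset.range N, g l ∧ ∀ j, j ≠ k → A a j = s.arr a j) := by
  refine Runs.forLoop (C := 1) (fun n A => A a k = s.arr a k + ∑ l ∈ Finset.range n, g l ∧
    ∀ j, j ≠ k → A a j = s.arr a j) (by simp [WritesNat]) he (by simp) ?_
  intro l hl s' hfr hs' hI
  refine Runs.setReal ⟨?_, fun j hj => ?_⟩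
  · rw [Function.update_self, hi s' hfr, Function.update_self, RealExpr.eval, RealExpr.eval,
      hi s' hfr, hI.1, hf l hl s' hfr hs' hI.2, Finset.sum_range_succ, add_assoc]
  · rw [Function.update_self, hi s' hfr, Function.update_of_ne hj, hI.2 j hj]

/-- The program that fills the cells `0, …, e` of the array `a` with the powers of `x`. -/
def powers (a r : ℕ) (e : NatExpr) (x : RealExpr) : Prog :=
  .seq (.setReal a (.const 0) (.ofNat (.const 1)))
    (Prog.forLoop r e (.setReal a (.add (.const 1) (.reg r)) (.mul (.get a (.reg r)) x)))

lemma runs_powers {a r : ℕ} {e : NatExpr} {x : RealExpr} {s : State} {N : ℕ} {v : ℝ}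
    (he : ∀ s', Frame (powers a r e x) s s' → e.eval s' = N)
    (hx : ∀ s', Frame (powers a r e x) s s' → x.eval consts s' = v) :
    Runs consts O ω (powers a r e x) s (N * 3 + 3) (fun A => ∀ l ≤ N, A a l = v ^ l) := by
  refine Runs.mono (Runs.seq (Q₁ := fun A => A a 0 = 1) (Runs.setReal ?_) ?_) ?_
    (fun _ h => h) (C := 1 + (N * 3 + 2))
  · simp [NatExpr.eval, RealExpr.eval]
  · intro s₁ hfr₁ h0
    have hframe : ∀ s', Frame (Prog.forLoop r e
        (.setReal a (.add (.const 1) (.reg r)) (.mul (.get a (.reg r)) x))) s₁ s' →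
        Frame (powers a r e x) s s' := by
      intro s' h
      refine ⟨fun y hy => ?_, fun y hy => ?_, fun hy => ?_⟩
      · rw [h.nat y fun h' => hy (Or.inr h'), hfr₁.nat y fun h' => hy (Or.inl h')]
      · rw [h.arr y fun h' => hy (Or.inr h'), hfr₁.arr y fun h' => hy (Or.inl h')]
      · rw [h.pos fun h' => hy (Or.inr h'), hfr₁.pos fun h' => hy (Or.inl h')]
    refine Runs.mono (Runs.tabulate (N := N) 1 (fun l => v ^ (l + 1))
      (fun s' h => he s' (hframe s' h)) ?_) le_rfl ?_
    · intro l hl s' h hl' hin hout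
      refine ⟨by simp [NatExpr.eval, hl'], ?_⟩
      simp only [RealExpr.eval, NatExpr.eval, hl', hx s' (hframe s' h)]
      cases l with
      | zero => rw [hout 0 (by omega), h0]; simp
      | succ l => rw [add_comm l 1, hin l (by omega), add_comm 1 l, ← pow_succ]
    · intro A hA l hl
      cases l with
      | zero => rw [hA.2 0 (by omega), h0, pow_zero]
      | succ l => rw [add_comm l 1, hA.1 l (by omega), add_comm l 1]
  · omega

end Runs

/-! ### The decoder as a program -/

/-- Loads an instance, whose size parameter is in register `6`, from the array `A`. -/
def loadInstance (A : ℕ) : Prog :=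
  forLoop 9 (.mul (.reg 6) (.reg 6)) (.setReal 2 (.reg 9) (.get A (.reg 9)))

/-- Initializes the projection as the identity matrix. -/
def initProj : Prog :=
  -- Truncated subtraction expresses the Kronecker symbol as `1 - ((j - l) + (l - j))`.
  forLoop 8 (.reg 4) (forLoop 9 (.reg 4) (.setReal 4 (cell 8 9 4)
    (.ofNat (.sub (.const 1) (.add (.sub (.reg 8) (.reg 9)) (.sub (.reg 9) (.reg 8)))))))

/-- Queries the oracle at the time with the index in register `7`, and writes the corresponding
row of the decoder's linear system into array `3`. The cell behind the instance in array `2` is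
set to the time. -/
def makeRow : Prog :=
  .seq (.setReal 6 (.const 0)
    (.add (.param 0) (.mul (.sub (.param 1) (.param 0)) (.get 1 (.reg 7)))))
  (.seq (.setReal 2 (.mul (.reg 6) (.reg 6)) (.get 6 (.const 0)))
  (.seq (.query 7 (.const 0) (.reg 6) 2)
  (.seq (powers 3 9 (.reg 3) (.get 6 (.const 0)))
  (.seq (forLoop 9 (.reg 2) (.setReal 3 (.add (.add (.reg 3) (.const 1)) (.reg 9))
    (.mul (.sub (.ofNat (.const 0)) (.get 7 (.const 0)))
      (.get 3 (.add (.add (.mul (.const 2) (.reg 6)) (.const 1)) (.reg 9))))))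
  (.setReal 3 (.add (.add (.reg 3) (.const 1)) (.reg 2))
    (.sub (.ofNat (.const 0)) (.get 7 (.const 0))))))))

/-- Writes the image of the row under the projection (array `4`) into array `5`. -/
def projectRow : Prog :=
  forLoop 8 (.reg 4) (.seq (.setReal 5 (.reg 8) (.ofNat (.const 0)))
    (forLoop 9 (.reg 4) (.setReal 5 (.reg 8)
      (.add (.get 5 (.reg 8)) (.mul (.get 4 (cell 8 9 4)) (.get 3 (.reg 9)))))))

/-- One step of orthogonalization, with the square of the norm of array `5` in array `8`. -/
def updateProj : Prog :=
  .seq projectRow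
  (.seq (.setReal 8 (.const 0) (.ofNat (.const 0)))
  (.seq (forLoop 8 (.reg 4) (.setReal 8 (.const 0)
    (.add (.get 8 (.const 0)) (.mul (.get 5 (.reg 8)) (.get 5 (.reg 8))))))
  (forLoop 8 (.reg 4) (forLoop 9 (.reg 4) (.setReal 4 (cell 8 9 4)
    (.sub (.get 4 (cell 8 9 4))
      (.div (.mul (.get 5 (.reg 8)) (.get 5 (.reg 9))) (.get 8 (.const 0)))))))))

/-- The program that queries the oracle at all times, decodes, and writes `n ^ (2n)` times the
decoded coefficient into the cell `b[iE]`. The instance stands in the array `A`, its size parameter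
`n` in register `6`. Registers `2` to `5` hold the parameters `e`, `d`, `d + 1 + e + 1` and `M` of
the decoder, and array `1` holds the random numbers that determine the times. -/
def decodeInstance (b : ℕ) (iE : NatExpr) (A : ℕ) : Prog :=
  .seq (loadInstance A) (.seq initProj
  (.seq (forLoop 7 (.reg 5) (.seq makeRow updateProj))
  (.seq (powers 9 9 (.mul (.const 2) (.reg 6)) (.ofNat (.reg 6)))
  (.setReal b iE (.mul (.get 9 (.mul (.const 2) (.reg 6)))
    (.div (.get 4 (.add (.mul (.mul (.const 2) (.reg 6)) (.reg 4))
        (.add (.add (.reg 3) (.const 1)) (.reg 2))))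
      (.get 4 (.add (.mul (.add (.add (.reg 3) (.const 1)) (.reg 2)) (.reg 4))
        (.add (.add (.reg 3) (.const 1)) (.reg 2))))))))))

section Runs

variable {a b : ℝ} {O : Oracle fun n => n * n + 1} {ω : ℕ → unitInterval}

lemma runs_loadInstance {A n : ℕ} {s : State} {v : Fin (n * n) → ℝ}
    (hn : s.nat 6 = n) (hA : A ≠ 2) (hv : ∀ l : Fin (n * n), s.arr A l = v l) :
    Runs [a, b] O ω (loadInstance A) s (n * n * 3 + 2) (fun B =>
      ∀ l : Fin (n * n), B 2 l = v l) := by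
  refine Runs.mono (Runs.tabulate (N := n * n) 0 (fun l => s.arr A l) ?_ ?_) le_rfl ?_
  · intro s' h
    simp only [NatExpr.eval, h.nat 6 (by simp [WritesNat]), hn]
  · intro l hl s' h hl' _ _
    simp only [NatExpr.eval, RealExpr.eval, hl', zero_add,
      h.arr A (by simp [WritesArr, hA.symm]), and_self]
  · intro B hB l
    rw [← hv l, ← hB.1 l l.2, zero_add]

lemma runs_initProj {m : ℕ} {s : State} (hm : s.nat 4 = m) (rows : ℕ → ℕ → ℝ) :
    Runs [a, b] O ω initProj s (m * (m * 3 + 2 + 2) + 2) (fun B =>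
      ∀ j < m, ∀ l < m, B 4 (j * m + l) = rowProj m rows 0 j l) := by
  refine Runs.tabulate₂ _ (by decide) (by decide) (by decide) hm ?_
  intro j _ l _ s' _ hj hl _
  simp only [NatExpr.eval, RealExpr.eval, hj, hl, rowProj]
  by_cases h : j = l
  · rw [if_pos h, h]
    simp
  · rw [if_neg h]
    have : 1 - (j - l + (l - j)) = 0 := by omega
    rw [this, Nat.cast_zero]

lemma runs_makeRow {n d e m i : ℕ} {s : State} {v : Fin (n * n) → ℝ} {t : ℝ}
    (h2 : s.nat 2 = e) (h3 : s.nat 3 = d) (h6 : s.nat 6 = n) (h7 : s.nat 7 = i)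
    (ht : a + (b - a) * s.arr 1 i = t) (hv : ∀ l : Fin (n * n), s.arr 2 l = v l)
    (hd : 2 * n + e ≤ d) (hm : m = d + 1 + e + 1) :
    Runs [a, b] O ω makeRow s
      (1 + (1 + ((n * n + 1 + 1) + ((d * 3 + 3) + ((e * 3 + 2) + 1))))) (fun B =>
      (∀ l : Fin (n * n), B 2 l = v l) ∧
        ∀ j < m, B 3 j = decodeRow n d e t (O n (Fin.snoc (α := fun _ => ℝ) v t)) j) := by
  set y := O n (Fin.snoc (α := fun _ => ℝ) v t) with hy
  refine Runs.seq (Q₁ := fun B => B 6 0 = t) (Runs.setReal ?_) ?_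
  · simp [NatExpr.eval, RealExpr.eval, h7, ht]
  intro s₁ f₁ ht₁
  have g₁ : ∀ r, s₁.nat r = s.nat r := fun r => f₁.nat r (by simp [WritesNat])
  refine Runs.seq (Q₁ := fun B => B 2 (n * n) = t ∧ ∀ l : Fin (n * n), B 2 l = v l)
    (Runs.setReal ⟨?_, fun l => ?_⟩) ?_
  · simp [NatExpr.eval, RealExpr.eval, g₁, h6, ht₁]
  · have : (l : ℕ) ≠ n * n := l.2.ne
    simp only [NatExpr.eval, g₁, h6, Function.update_self, Function.update_of_ne this]
    rw [f₁.arr 2 (by simp [WritesArr]), hv]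
  intro s₂ f₂ hQ
  have g₂ : ∀ r, s₂.nat r = s.nat r := fun r => by rw [f₂.nat r (by simp [WritesNat]), g₁]
  refine Runs.seq (Q₁ := fun B => B 7 0 = y)
    (Runs.mono (Runs.query ?_) (by simp [NatExpr.eval, g₂, h6]) fun _ h => h) ?_
  · have hn : NatExpr.eval s₂ (.reg 6) = n := by simp [NatExpr.eval, g₂, h6]
    rw [hn, Function.update_self, hy]
    simp only [NatExpr.eval, Function.update_self]
    congr 1
    funext l
    refine Fin.lastCases ?_ (fun l => ?_) l
    · rw [Fin.snoc_last, Fin.val_last, hQ.1]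
    · rw [Fin.snoc_castSucc, Fin.val_castSucc, hQ.2]
  intro s₃ f₃ hy₃
  have g₃ : ∀ r, s₃.nat r = s.nat r := fun r => by rw [f₃.nat r (by simp [WritesNat]), g₂]
  have ht₃ : s₃.arr 6 0 = t := by
    rw [f₃.arr 6 (by simp [WritesArr]), f₂.arr 6 (by simp [WritesArr]), ht₁]
  refine Runs.seq (runs_powers (N := d) (v := t) ?_ ?_) ?_
  · intro s' f
    simp only [NatExpr.eval, f.nat 3 (by simp [WritesNat, powers]), g₃, h3]
  · intro s' f
    simp only [RealExpr.eval, NatExpr.eval, f.arr 6 (by simp [WritesArr, powers]), ht₃]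
  intro s₄ f₄ hp
  have g₄ : ∀ r, r ≠ 9 → s₄.nat r = s.nat r := fun r hr => by
    rw [f₄.nat r (by simp [WritesNat, powers, hr.symm]), g₃]
  have hy₄ : s₄.arr 7 0 = y := by rw [f₄.arr 7 (by simp [WritesArr, powers]), hy₃]
  refine Runs.seq (Runs.tabulate (N := e) (d + 1) (fun l => -y * t ^ (2 * n + 1 + l)) ?_ ?_) ?_
  · intro s' f
    simp only [NatExpr.eval, f.nat 2 (by simp [WritesNat]), g₄ 2 (by decide), h2]
  · intro l hl s' f hl' hin hout
    simp only [NatExpr.eval, RealExpr.eval, f.nat 3 (by simp [WritesNat]), g₄ 3 (by decide), h3,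
      f.nat 6 (by simp [WritesNat]), g₄ 6 (by decide), h6, hl',
      f.arr 7 (by simp [WritesArr]), hy₄, Nat.cast_zero, zero_sub, true_and]
    rw [hout _ (by omega), hp _ (by omega)]
  intro s₅ f₅ hr
  have g₅ : ∀ r, r ≠ 9 → s₅.nat r = s.nat r := fun r hr => by
    rw [f₅.nat r (by simp [WritesNat, hr.symm]), g₄ r hr]
  have hy₅ : s₅.arr 7 0 = y := by rw [f₅.arr 7 (by simp [WritesArr]), hy₄]
  refine Runs.setReal ⟨fun l => ?_, fun j hj => ?_⟩
  · rw [Function.update_of_ne (by decide), f₅.arr 2 (by simp [WritesArr]),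
      f₄.arr 2 (by simp [WritesArr, powers]), f₃.arr 2 (by simp [WritesArr])]
    exact hQ.2 l
  · simp only [NatExpr.eval, RealExpr.eval, g₅ 3 (by decide), h3, g₅ 2 (by decide), h2, hy₅,
      Nat.cast_zero, zero_sub, Function.update_self]
    rw [decodeRow]
    split_ifs with hj1 hj2
    · rw [Function.update_of_ne (by omega), hr.2 j (by omega), hp j (by omega)]
    · rw [Function.update_of_ne (by omega)]
      have := hr.1 (j - (d + 1)) (by omega)
      rwa [Nat.add_sub_cancel' (by omega)] at this
    · rw [show j = d + 1 + e by omega, Function.update_self]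

lemma runs_projectRow {m : ℕ} {s : State} {P : ℕ → ℕ → ℝ} {r : ℕ → ℝ} (hm : s.nat 4 = m)
    (hP : ∀ j < m, ∀ l < m, s.arr 4 (j * m + l) = P j l) (hr : ∀ j < m, s.arr 3 j = r j) :
    Runs [a, b] O ω projectRow s (m * (1 + (m * 3 + 2) + 2) + 2) (fun B =>
      ∀ j < m, B 5 j = ∑ i ∈ Finset.range m, P j i * r i) := by
  refine Runs.forLoop (N := m) (C := 1 + (m * 3 + 2))
    (fun k B => ∀ j < k, B 5 j = ∑ i ∈ Finset.range m, P j i * r i)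
    (by simp [WritesNat]) ?_ (by simp) ?_
  · intro s' f
    simp only [NatExpr.eval, f.nat 4 (by simp [WritesNat]), hm]
  intro k hk s₁ f₁ hk₁ hI
  refine Runs.seq (Q₁ := fun B => B 5 k = 0 ∧
    ∀ j < k, B 5 j = ∑ i ∈ Finset.range m, P j i * r i) (Runs.setReal ⟨?_, fun j hj => ?_⟩) ?_
  · simp [NatExpr.eval, RealExpr.eval, hk₁]
  · simp only [NatExpr.eval, hk₁, Function.update_self, Function.update_of_ne hj.ne]
    exact hI j hj
  intro s₂ f₂ hQ
  have hk₂ : s₂.nat 8 = k := by rw [f₂.nat 8 (by simp [WritesNat]), hk₁]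
  have hm₂ : s₂.nat 4 = m := by
    rw [f₂.nat 4 (by simp [WritesNat]), f₁.nat 4 (by simp [WritesNat]), hm]
  refine Runs.mono (Runs.accumulate (N := m) k (fun l => P k l * r l) ?_ ?_ ?_) le_rfl ?_
  · intro s' f
    simp only [NatExpr.eval, f.nat 4 (by simp [WritesNat]), hm₂]
  · intro s' f
    simp only [NatExpr.eval, f.nat 8 (by simp [WritesNat]), hk₂]
  · intro l hl s' f hl' _
    simp only [NatExpr.eval, RealExpr.eval, cell, f.nat 8 (by simp [WritesNat]), hk₂,
      f.nat 4 (by simp [WritesNat]), hm₂, hl', f.arr 4 (by simp [WritesArr]),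
      f₂.arr 4 (by simp [WritesArr]), f₁.arr 4 (by simp [WritesArr]), hP k hk l hl,
      f.arr 3 (by simp [WritesArr]), f₂.arr 3 (by simp [WritesArr]),
      f₁.arr 3 (by simp [WritesArr]), hr l hl]
  · intro B hB j hj
    rcases Nat.lt_succ_iff_lt_or_eq.1 hj with h | rfl
    · rw [hB.2 j h.ne, hQ.2 j h]
    · rw [hB.1, hQ.1, zero_add]

lemma runs_updateProj {m : ℕ} {s : State} {P : ℕ → ℕ → ℝ} {r : ℕ → ℝ} (hm : s.nat 4 = m)
    (hP : ∀ j < m, ∀ l < m, s.arr 4 (j * m + l) = P j l) (hr : ∀ j < m, s.arr 3 j = r j) :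
    Runs [a, b] O ω updateProj s
      ((m * (1 + (m * 3 + 2) + 2) + 2) + (1 + ((m * 3 + 2) + (m * (m * 3 + 2 + 2) + 2))))
      (fun B => ∀ j < m, ∀ l < m, B 4 (j * m + l) = projStep m P r j l) := by
  refine Runs.seq (runs_projectRow hm hP hr) ?_
  intro s₁ f₁ hU
  have hm₁ : s₁.nat 4 = m := by rw [f₁.nat 4 (by simp [WritesNat, projectRow]), hm]
  have hP₁ : s₁.arr 4 = s.arr 4 := f₁.arr 4 (by simp [WritesArr, projectRow])
  refine Runs.seq (Q₁ := fun B => B 8 0 = 0) (Runs.setReal ?_) ?_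
  · simp [NatExpr.eval, RealExpr.eval]
  intro s₂ f₂ h0
  have hm₂ : s₂.nat 4 = m := by rw [f₂.nat 4 (by simp [WritesNat]), hm₁]
  refine Runs.seq (Runs.accumulate (N := m) 0 (fun j => (∑ i ∈ Finset.range m, P j i * r i) *
    (∑ i ∈ Finset.range m, P j i * r i)) ?_ ?_ ?_) ?_
  · intro s' f
    simp only [NatExpr.eval, f.nat 4 (by simp [WritesNat]), hm₂]
  · intro s' f
    rfl
  · intro l hl s' f hl' _
    simp only [NatExpr.eval, RealExpr.eval, hl', f.arr 5 (by simp [WritesArr]),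
      f₂.arr 5 (by simp [WritesArr]), hU l hl]
  intro s₃ f₃ hS
  have hm₃ : s₃.nat 4 = m := by rw [f₃.nat 4 (by simp [WritesNat]), hm₂]
  have hS₃ := hS.1
  rw [h0, zero_add] at hS₃
  refine Runs.tabulate₂ _ (by decide) (by decide) (by decide) hm₃ ?_
  intro j hj l hl s' f hj' hl' hcell
  have hU' : s'.arr 5 = s₁.arr 5 := by
    rw [f.arr 5 (by simp [WritesArr]), f₃.arr 5 (by simp [WritesArr]),
      f₂.arr 5 (by simp [WritesArr])]
  simp only [RealExpr.eval, NatExpr.eval, cell, hj', hl', f.nat 4 (by simp [WritesNat]), hm₃,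
    hcell, hU', hU j hj, hU l hl, f.arr 8 (by simp [WritesArr]), hS₃]
  rw [f₃.arr 4 (by simp [WritesArr]), f₂.arr 4 (by simp [WritesArr]), hP₁, hP j hj l hl]
  rfl

/-- A bound for the cost of `decodeInstance`. -/
def decodeCost (n d e m M : ℕ) : ℕ :=
  (n * n * 3 + 2) + ((m * (m * 3 + 2 + 2) + 2) +
    ((M * ((1 + (1 + ((n * n + 1 + 1) + ((d * 3 + 3) + ((e * 3 + 2) + 1))))) +
      ((m * (1 + (m * 3 + 2) + 2) + 2) + (1 + ((m * 3 + 2) + (m * (m * 3 + 2 + 2) + 2)))) + 2) +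
        2) + ((2 * n * 3 + 3) + 1)))

/-- The answer that `decodeInstance` computes. -/
def decodedAnswer (a b : ℝ) (O : Oracle fun n => n * n + 1) (d e M : ℕ) (w : ℕ → ℝ) (n : ℕ)
    (v : Fin (n * n) → ℝ) : ℝ :=
  (n : ℝ) ^ (2 * n) * decodeValue n d e M (fun i => a + (b - a) * w i)
    fun i => O n (Fin.snoc (α := fun _ => ℝ) v (a + (b - a) * w i))

lemma runs_decodeInstance {n d e m M A B i : ℕ} {iE : NatExpr} {s : State} {v : Fin (n * n) → ℝ}
    {w : ℕ → ℝ} (h2 : s.nat 2 = e) (h3 : s.nat 3 = d) (h4 : s.nat 4 = m) (h5 : s.nat 5 = M)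
    (h6 : s.nat 6 = n) (hd : 2 * n + e ≤ d) (hm : m = d + 1 + e + 1)
    (hw : ∀ l < M, s.arr 1 l = w l) (hv : ∀ l : Fin (n * n), s.arr A l = v l)
    (hA : A ≠ 2) (hB : B = 0 ∨ 9 < B)
    (hi : ∀ s', (∀ r, r < 7 ∨ 9 < r → s'.nat r = s.nat r) → iE.eval s' = i) :
    Runs [a, b] O ω (decodeInstance B iE A) s (decodeCost n d e m M) (fun C =>
      C B = Function.update (s.arr B) i (decodedAnswer a b O d e M w n v)) := by
  refine Runs.seq (runs_loadInstance h6 hA hv) ?_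
  intro s₁ f₁ hQ₁
  have g₁ : ∀ r, r < 7 ∨ 9 < r → s₁.nat r = s.nat r := fun r hr =>
    f₁.nat r (by simp [WritesNat, loadInstance]; omega)
  have a₁ : ∀ x, x < 2 ∨ 9 < x → s₁.arr x = s.arr x := fun x hx =>
    f₁.arr x (by simp [WritesArr, loadInstance]; omega)
  set t : ℕ → ℝ := fun i => a + (b - a) * w i with ht
  set y : ℕ → ℝ := fun i => O n (Fin.snoc (α := fun _ => ℝ) v (t i)) with hy
  set rows : ℕ → ℕ → ℝ := fun i => decodeRow n d e (t i) (y i) with hrows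
  refine Runs.seq (runs_initProj (by rw [g₁ 4 (by omega), h4]) rows) ?_
  intro s₂ f₂ hQ₂
  have g₂ : ∀ r, r < 7 ∨ 9 < r → s₂.nat r = s.nat r := fun r hr => by
    rw [f₂.nat r (by simp [WritesNat, initProj]; omega), g₁ r hr]
  have a₂ : ∀ x, x < 2 ∨ 9 < x → s₂.arr x = s.arr x := fun x hx => by
    rw [f₂.arr x (by simp [WritesArr, initProj]; omega), a₁ x hx]
  have hloop : ∀ s', Frame (forLoop 7 (.reg 5) (.seq makeRow updateProj)) s₂ s' →
      (∀ r, r < 7 ∨ 9 < r → s'.nat r = s.nat r) ∧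
      ∀ x, x < 2 ∨ 9 < x → s'.arr x = s.arr x := by
    intro s' f
    refine ⟨fun r hr => ?_, fun x hx => ?_⟩
    · rw [f.nat r (by simp [WritesNat, makeRow, updateProj, projectRow, powers]; omega), g₂ r hr]
    · rw [f.arr x (by simp [WritesArr, makeRow, updateProj, projectRow, powers]; omega), a₂ x hx]
  refine Runs.seq (Runs.forLoop (N := M) (fun k C => (∀ l : Fin (n * n), C 2 l = v l) ∧
    ∀ j < m, ∀ l < m, C 4 (j * m + l) = rowProj m rows k j l)
    (by simp [WritesNat, makeRow, updateProj, projectRow, powers]) ?_ ?_ ?_) ?_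
  · intro s' f
    rw [NatExpr.eval, (hloop s' f).1 5 (by omega), h5]
  · refine ⟨fun l => ?_, hQ₂⟩
    rw [f₂.arr 2 (by simp [WritesArr, initProj]), hQ₁ l]
  · intro k hk s' f hk' hI
    obtain ⟨g', a'⟩ := hloop s' f
    refine Runs.seq (runs_makeRow (t := t k) (by rw [g' 2 (by omega), h2])
      (by rw [g' 3 (by omega), h3]) (by rw [g' 6 (by omega), h6]) hk'
      (by rw [a' 1 (by omega), hw k hk]) hI.1 hd hm) ?_
    intro s₃ f₃ hQ₃
    have hinst : ∀ l : Fin (n * n), s₃.arr 2 l = v l := hQ₃.1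
    have := runs_updateProj (a := a) (b := b) (O := O) (ω := ω) (s := s₃) (m := m)
      (P := rowProj m rows k) (r := rows k)
      (by rw [f₃.nat 4 (by simp [WritesNat, makeRow, powers]), g' 4 (by omega), h4])
      (by rw [f₃.arr 4 (by simp [WritesArr, makeRow, powers])]; exact hI.2) hQ₃.2
    obtain ⟨T, s₄, he, hT, hQ₄⟩ := this
    refine ⟨T, s₄, he, hT, fun l => ?_, hQ₄⟩
    rw [(frame_of_exec he).arr 2 (by simp [WritesArr, updateProj, projectRow]), hinst]
  intro s₃ f₃ hQ₃
  obtain ⟨g₃, a₃⟩ := hloop s₃ f₃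
  refine Runs.seq (runs_powers (N := 2 * n) (v := n) ?_ ?_) ?_
  · intro s' f
    simp only [NatExpr.eval, f.nat 6 (by simp [WritesNat, powers]), g₃ 6 (by omega), h6]
  · intro s' f
    simp only [RealExpr.eval, NatExpr.eval, f.nat 6 (by simp [WritesNat, powers]),
      g₃ 6 (by omega), h6]
  intro s₄ f₄ hQ₄
  have g₄ : ∀ r, r < 7 ∨ 9 < r → s₄.nat r = s.nat r := fun r hr => by
    rw [f₄.nat r (by simp [WritesNat, powers]; omega), g₃ r hr]
  refine Runs.setReal ?_
  rw [Function.update_self, f₄.arr B (by simp [WritesArr, powers]; omega), a₃ B (by omega),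
    hi s₄ g₄]
  congr 1
  simp only [RealExpr.eval, NatExpr.eval, g₄ 6 (by omega), h6, g₄ 4 (by omega), h4,
    g₄ 3 (by omega), h3, g₄ 2 (by omega), h2, hQ₄ (2 * n) le_rfl,
    f₄.arr 4 (by simp [WritesArr, powers])]
  rw [hQ₃.2 (2 * n) (by omega) (d + 1 + e) (by omega),
    hQ₃.2 (d + 1 + e) (by omega) (d + 1 + e) (by omega), decodedAnswer, decodeValue, hm]

end Runs

/-! ### The simulation of a program with the decoder as its oracle -/

/-- The renaming of the registers of the simulated program, which leaves the registers `2` to `10`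
to the simulation. -/
def regMap (r : ℕ) : ℕ := if r < 2 then r else r + 9

/-- The renaming of the arrays of the simulated program, which leaves the arrays `1` to `9` to the
simulation. -/
def arrMap (a : ℕ) : ℕ := if a = 0 then 0 else a + 9

lemma regMap_injective : Function.Injective regMap := by
  intro r r' h
  simp only [regMap] at h
  split_ifs at h <;> omega

lemma arrMap_injective : Function.Injective arrMap := by
  intro r r' h
  simp only [arrMap] at h
  split_ifs at h <;> omega

lemma regMap_range (r : ℕ) : regMap r < 2 ∨ 10 < regMap r := by
  simp only [regMap]
  split_ifs <;> omega

lemma arrMap_range (a : ℕ) : arrMap a = 0 ∨ 9 < arrMap a := by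
  simp only [arrMap]
  split_ifs <;> omega

/-- Renaming of the registers. -/
def NatExpr.rename : NatExpr → NatExpr
  | .const c => .const c
  | .reg r => .reg (regMap r)
  | .add e₁ e₂ => .add e₁.rename e₂.rename
  | .sub e₁ e₂ => .sub e₁.rename e₂.rename
  | .mul e₁ e₂ => .mul e₁.rename e₂.rename

/-- Renaming of the registers and arrays; the problem of estimating permanents has no constants,
so that parameters are replaced by `0`. -/
def RealExpr.rename : RealExpr → RealExpr
  | .ofNat e => .ofNat e.rename
  | .param _ => .ofNat (.const 0)
  | .get a i => .get (arrMap a) i.rename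
  | .add e₁ e₂ => .add e₁.rename e₂.rename
  | .sub e₁ e₂ => .sub e₁.rename e₂.rename
  | .mul e₁ e₂ => .mul e₁.rename e₂.rename
  | .div e₁ e₂ => .div e₁.rename e₂.rename

/-- Renaming of the registers and arrays. -/
def TestExpr.rename : TestExpr → TestExpr
  | .natLt e₁ e₂ => .natLt e₁.rename e₂.rename
  | .realLt e₁ e₂ => .realLt e₁.rename e₂.rename
  | .not b => .not b.rename
  | .and b₁ b₂ => .and b₁.rename b₂.rename

/-- The simulating program: every query is replaced by the decoder. -/
def Prog.translate : Prog → Prog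
  | .skip => .skip
  | .setNat r e => .setNat (regMap r) e.rename
  | .setReal a i e => .setReal (arrMap a) i.rename e.rename
  | .draw a i => .draw (arrMap a) i.rename
  | .query b i n a =>
      .seq (.setNat 6 n.rename) (decodeInstance (arrMap b) i.rename (arrMap a))
  | .seq c₁ c₂ => .seq c₁.translate c₂.translate
  | .ite b c₁ c₂ => .ite b.rename c₁.translate c₂.translate
  | .while b c => .while b.rename c.translate

lemma NatExpr.eval_rename {s s' : State} (h : ∀ r, s'.nat (regMap r) = s.nat r) (e : NatExpr) :
    e.rename.eval s' = e.eval s := by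
  induction e <;> simp_all [NatExpr.rename, NatExpr.eval]

lemma RealExpr.eval_rename {s s' : State} (hn : ∀ r, s'.nat (regMap r) = s.nat r)
    (ha : ∀ a, s'.arr (arrMap a) = s.arr a) (consts : List ℝ) (e : RealExpr) :
    e.rename.eval consts s' = e.eval [] s := by
  induction e <;> simp_all [RealExpr.rename, RealExpr.eval, NatExpr.eval_rename hn, NatExpr.eval]

lemma TestExpr.holds_rename {s s' : State} (hn : ∀ r, s'.nat (regMap r) = s.nat r)
    (ha : ∀ a, s'.arr (arrMap a) = s.arr a) (consts : List ℝ) (b : TestExpr) :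
    b.rename.Holds consts s' ↔ b.Holds [] s := by
  induction b <;> simp_all [TestExpr.rename, TestExpr.Holds, NatExpr.eval_rename hn,
    RealExpr.eval_rename hn ha]

/-- The matrix with the given entries, row by row. -/
def unflatten {n : ℕ} (v : Fin (n * n) → ℝ) : Matrix (Fin n) (Fin n) ℝ :=
  Matrix.of fun i j => v (finProdFinEquiv (i, j))

lemma unflatten_flatten {n : ℕ} (J : Fin n → Fin n → ℝ) : unflatten (flatten J) = Matrix.of J := by
  ext i j
  simp [unflatten, flatten]

/-- The oracle for the estimation of permanents that the simulating program implements, given the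
random numbers `w`. Sizes above `B` are never queried, and there it is the exact solution. -/
def simulatedOracle (a b : ℝ) (O : Oracle fun n => n * n + 1) (e D B : ℕ) (w : ℕ → ℝ) :
    Oracle fun n => n * n := fun n v =>
  if n ≤ B then decodedAnswer a b O (e + 2 * D) e (2 * e + 2 * D + 1) w n v
  else (unflatten v).permanent ^ 2

/-- The state `s'` of the simulating program represents the state `s` of the simulated one. -/
structure Simulates (e D : ℕ) (w : ℕ → ℝ) (s s' : State) : Prop where
  nat : ∀ r, s'.nat (regMap r) = s.nat r
  arr : ∀ a, s'.arr (arrMap a) = s.arr a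
  pos : s'.pos = s.pos + (2 * e + 2 * D + 1)
  reg2 : s'.nat 2 = e
  reg3 : s'.nat 3 = e + 2 * D
  reg4 : s'.nat 4 = e + 2 * D + 1 + e + 1
  reg5 : s'.nat 5 = 2 * e + 2 * D + 1
  times : ∀ l < 2 * e + 2 * D + 1, s'.arr 1 l = w l

lemma decodeCost_mono {n n' : ℕ} (h : n ≤ n') (d e m M : ℕ) :
    decodeCost n d e m M ≤ decodeCost n' d e m M := by
  have : n * n ≤ n' * n' := Nat.mul_le_mul h h
  simp only [decodeCost]
  gcongr

namespace Simulates

variable {e D : ℕ} {w : ℕ → ℝ} {s s' : State}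

lemma setNat (h : Simulates e D w s s') (r v : ℕ) :
    Simulates e D w (s.setNat r v) (s'.setNat (regMap r) v) := by
  have hr := regMap_range r
  refine ⟨fun r' => ?_, h.arr, h.pos, ?_, ?_, ?_, ?_, h.times⟩
  · simp only [State.setNat, Function.update_apply, regMap_injective.eq_iff, h.nat]
  · exact (Function.update_of_ne (by omega) _ _).trans h.reg2
  · exact (Function.update_of_ne (by omega) _ _).trans h.reg3
  · exact (Function.update_of_ne (by omega) _ _).trans h.reg4
  · exact (Function.update_of_ne (by omega) _ _).trans h.reg5

lemma setReal (h : Simulates e D w s s') (a i : ℕ) (v : ℝ) :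
    Simulates e D w (s.setReal a i v) (s'.setReal (arrMap a) i v) := by
  have ha := arrMap_range a
  refine ⟨h.nat, fun a' => ?_, h.pos, h.reg2, h.reg3, h.reg4, h.reg5, fun l hl => ?_⟩
  · simp only [State.setReal, Function.update_apply, arrMap_injective.eq_iff, h.arr]
  · simp only [State.setReal]
    rw [Function.update_of_ne (by omega), h.times l hl]

/-- The simulation of a query. -/
lemma query {a b : ℝ} {O : Oracle fun n => n * n + 1} {ω : ℕ → unitInterval}
    (h : Simulates e D w s s') {B : ℕ} (hB : ∀ n ≤ B, 2 * n ≤ D) (bq : ℕ) (i n : NatExpr) (aq : ℕ)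
    (hn : n.eval s ≤ B) :
    ∃ (T : ℕ) (s'' : State), Exec [a, b] O ω (Prog.translate (.query bq i n aq)) s' T s'' ∧
      T ≤ decodeCost B (e + 2 * D) e (e + 2 * D + 1 + e + 1) (2 * e + 2 * D + 1) + 1 ∧
      Simulates e D w (s.setReal bq (i.eval s)
        (simulatedOracle a b O e D B w (n.eval s) fun l => s.arr aq l)) s'' := by
  set N := n.eval s with hN
  have hne : n.rename.eval s' = N := NatExpr.eval_rename h.nat n
  set s₁ := s'.setNat 6 N with hs₁
  have h₁ : ∀ r, r ≠ 6 → s₁.nat r = s'.nat r := fun r hr => Function.update_of_ne hr _ _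
  have haq := arrMap_range aq
  have hbq := arrMap_range bq
  obtain ⟨T, s₂, he, hT, hQ⟩ := runs_decodeInstance (a := a) (b := b) (O := O) (ω := ω) (n := N)
    (d := e + 2 * D) (e := e) (m := e + 2 * D + 1 + e + 1) (M := 2 * e + 2 * D + 1)
    (A := arrMap aq) (B := arrMap bq) (i := i.eval s) (iE := i.rename) (s := s₁)
    (v := fun l => s.arr aq l) (w := w)
    (by rw [h₁ 2 (by decide), h.reg2]) (by rw [h₁ 3 (by decide), h.reg3])
    (by rw [h₁ 4 (by decide), h.reg4]) (by rw [h₁ 5 (by decide), h.reg5])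
    (by simp [hs₁, State.setNat]) (by have := hB N hn; omega) rfl
    h.times (fun l => by rw [← h.arr]; rfl) (by omega) hbq
    (by
      intro s₃ hs₃
      refine NatExpr.eval_rename (fun r => ?_) i
      have := regMap_range r
      rw [hs₃ _ (by omega), h₁ _ (by omega), h.nat])
  have hf := frame_of_exec he
  have hreg : ∀ r, r < 6 ∨ 9 < r → s₂.nat r = s'.nat r := fun r hr => by
    rw [hf.nat r (by simp [WritesNat, decodeInstance, loadInstance, initProj, makeRow, updateProj,
      projectRow, powers]; omega), h₁ r (by omega)]
  have harr : ∀ x, x < 2 ∨ 9 < x → x ≠ arrMap bq → s₂.arr x = s'.arr x := fun x hx hxb => by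
    rw [hf.arr x (by simp [WritesArr, decodeInstance, loadInstance, initProj, makeRow, updateProj,
      projectRow, powers]; omega)]
    rfl
  refine ⟨1 + T, s₂, Exec.seq (.setNat 6 n.rename s') (by rw [hne]; exact he), ?_, ?_⟩
  · have := decodeCost_mono hn (e + 2 * D) e (e + 2 * D + 1 + e + 1) (2 * e + 2 * D + 1)
    omega
  · refine ⟨fun r => ?_, fun x => ?_, ?_, ?_, ?_, ?_, ?_, fun l hl => ?_⟩
    · have := regMap_range r
      rw [hreg _ (by omega), h.nat]
      rfl
    · by_cases hx : x = bq
      · subst hx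
        rw [hQ]
        simp only [State.setReal, Function.update_self, hs₁, State.setNat, h.arr]
        rw [simulatedOracle, if_pos hn]
      · have := arrMap_range x
        rw [harr _ (by omega) (fun h' => hx (arrMap_injective h')), h.arr]
        simp [State.setReal, hx]
    · rw [hf.pos (by simp [Draws, decodeInstance, loadInstance, initProj, makeRow, updateProj,
        projectRow, powers])]
      exact h.pos
    · rw [hreg 2 (by omega), h.reg2]
    · rw [hreg 3 (by omega), h.reg3]
    · rw [hreg 4 (by omega), h.reg4]
    · rw [hreg 5 (by omega), h.reg5]
    · rw [harr 1 (by omega) (by omega), h.times l hl]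

/-- The simulation: a run of at most `B` steps with the simulated oracle is followed step by step
by the simulating program. -/
theorem exec_translate {a b : ℝ} {O : Oracle fun n => n * n + 1} {ω : ℕ → unitInterval}
    {B : ℕ} (hB : ∀ n ≤ B, 2 * n ≤ D) {c : Prog} {T : ℕ} {s₁ : State}
    (hc : Exec [] (simulatedOracle a b O e D B w) (fun i => ω (i + (2 * e + 2 * D + 1))) c s T s₁)
    (hT : T ≤ B) : ∀ s', Simulates e D w s s' →
    ∃ (T' : ℕ) (s₁' : State), Exec [a, b] O ω c.translate s' T' s₁' ∧
      T' ≤ T *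
        (decodeCost B (e + 2 * D) e (e + 2 * D + 1 + e + 1) (2 * e + 2 * D + 1) + 1) ∧
      Simulates e D w s₁ s₁' := by
  set C := decodeCost B (e + 2 * D) e (e + 2 * D + 1 + e + 1) (2 * e + 2 * D + 1) with hC
  induction hc with
  | skip s => exact fun s' h => ⟨_, _, .skip s', by omega, h⟩
  | setNat r e s =>
    intro s' h
    refine ⟨_, _, .setNat _ _ s', by omega, ?_⟩
    rw [NatExpr.eval_rename h.nat]
    exact h.setNat _ _
  | setReal a i e s =>
    intro s' h
    refine ⟨_, _, .setReal _ _ _ s', by omega, ?_⟩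
    rw [NatExpr.eval_rename h.nat, RealExpr.eval_rename h.nat h.arr]
    exact h.setReal _ _ _
  | draw a i s =>
    intro s' h
    refine ⟨_, _, .draw _ _ s', by omega, ?_⟩
    rw [NatExpr.eval_rename h.nat, h.pos]
    have := h.setReal a (i.eval s) (ω (s.pos + (2 * e + 2 * D + 1)) : ℝ)
    exact ⟨this.nat, this.arr, by simp only; omega, this.reg2, this.reg3, this.reg4, this.reg5,
      this.times⟩
  | query bq i n aq s =>
    intro s' h
    have hn : n.eval s ≤ B := by
      have : n.eval s ≤ n.eval s * n.eval s := Nat.le_mul_self _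
      omega
    obtain ⟨T', s'', h1, h2, h3⟩ := h.query (a := a) (b := b) (O := O) (ω := ω) hB bq i n aq hn
    refine ⟨T', s'', h1, h2.trans ?_, h3⟩
    exact Nat.le_mul_of_pos_left _ (Nat.succ_pos _)
  | seq _ _ ih₁ ih₂ =>
    intro s' h
    obtain ⟨T₁, s₁, h1, h2, h3⟩ := ih₁ (by omega) s' h
    obtain ⟨T₂, s₂, h4, h5, h6⟩ := ih₂ (by omega) s₁ h3
    exact ⟨_, _, h1.seq h4, by rw [add_mul]; omega, h6⟩
  | iteTrue hb _ ih =>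
    intro s' h
    obtain ⟨T₁, s₁, h1, h2, h3⟩ := ih (by omega) s' h
    exact ⟨_, _, .iteTrue ((TestExpr.holds_rename h.nat h.arr _ _).2 hb) h1,
      by rw [add_mul]; omega, h3⟩
  | iteFalse hb _ ih =>
    intro s' h
    obtain ⟨T₁, s₁, h1, h2, h3⟩ := ih (by omega) s' h
    exact ⟨_, _, .iteFalse (fun h' => hb ((TestExpr.holds_rename h.nat h.arr _ _).1 h')) h1,
      by rw [add_mul]; omega, h3⟩
  | whileTrue hb _ _ ih₁ ih₂ =>
    intro s' h
    obtain ⟨T₁, s₁, h1, h2, h3⟩ := ih₁ (by omega) s' h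
    obtain ⟨T₂, s₂, h4, h5, h6⟩ := ih₂ (by omega) s₁ h3
    exact ⟨_, _, .whileTrue ((TestExpr.holds_rename h.nat h.arr _ _).2 hb) h1 h4,
      by rw [add_mul, add_mul]; omega, h6⟩
  | whileFalse hb =>
    intro s' h
    exact ⟨_, _, .whileFalse (fun h' => hb ((TestExpr.holds_rename h.nat h.arr _ _).1 h')),
      by omega, h⟩

end Simulates

/-- The function is given by a polynomial with natural-number coefficients. -/
def IsPolynomial (f : ℕ → ℕ) : Prop := ∃ p : Polynomial ℕ, ∀ L, f L = p.eval L

namespace IsPolynomial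

lemma const (c : ℕ) : IsPolynomial fun _ => c := ⟨Polynomial.C c, by simp⟩

lemma id : IsPolynomial fun L => L := ⟨Polynomial.X, by simp⟩

lemma eval (p : Polynomial ℕ) {f : ℕ → ℕ} (hf : IsPolynomial f) :
    IsPolynomial fun L => p.eval (f L) := by
  obtain ⟨q, hq⟩ := hf
  exact ⟨p.comp q, by simp [hq]⟩

lemma add {f g : ℕ → ℕ} (hf : IsPolynomial f) (hg : IsPolynomial g) :
    IsPolynomial fun L => f L + g L := by
  obtain ⟨p, hp⟩ := hf
  obtain ⟨q, hq⟩ := hg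
  exact ⟨p + q, by simp [hp, hq]⟩

lemma mul {f g : ℕ → ℕ} (hf : IsPolynomial f) (hg : IsPolynomial g) :
    IsPolynomial fun L => f L * g L := by
  obtain ⟨p, hp⟩ := hf
  obtain ⟨q, hq⟩ := hg
  exact ⟨p * q, by simp [hp, hq]⟩

lemma decodeCost {n d e m M : ℕ → ℕ} (hn : IsPolynomial n) (hd : IsPolynomial d)
    (he : IsPolynomial e) (hm : IsPolynomial m) (hM : IsPolynomial M) :
    IsPolynomial fun L => decodeCost (n L) (d L) (e L) (m L) (M L) := by
  simp only [SharpHardness.decodeCost]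
  repeat' first | assumption | exact const _ | apply add | apply mul

lemma exists_natExpr {f : ℕ → ℕ} (hf : IsPolynomial f) (r : ℕ) :
    ∃ e : NatExpr, ∀ s : State, e.eval s = f (s.nat r) := by
  obtain ⟨p, hp⟩ := hf
  suffices h : ∃ e : NatExpr, ∀ s : State, e.eval s = p.eval (s.nat r) by simpa only [hp] using h
  clear hp
  induction p using Polynomial.induction_on' with
  | add p q hp hq =>
    obtain ⟨e₁, h₁⟩ := hp
    obtain ⟨e₂, h₂⟩ := hq
    exact ⟨.add e₁ e₂, fun s => by simp [NatExpr.eval, h₁, h₂]⟩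
  | monomial k c =>
    induction k with
    | zero => exact ⟨.const c, fun s => by simp [NatExpr.eval]⟩
    | succ k ih =>
      obtain ⟨e, he⟩ := ih
      refine ⟨.mul e (.reg r), fun s => ?_⟩
      simp only [NatExpr.eval, he, Polynomial.eval_monomial, pow_succ, mul_assoc]

end IsPolynomial

/-- The loop that fills the cells of array `1` with random numbers. -/
def drawTimes : Prog := forLoop 9 (.reg 5) (.draw 1 (.reg 9))

lemma exec_drawTimes {size : ℕ → ℕ} (consts : List ℝ) (O : Oracle size) (ω : ℕ → unitInterval)
    {M : ℕ} {s : State} (hM : s.nat 5 = M) (hs : s.pos = 0) :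
    ∃ (T : ℕ) (s' : State), Exec consts O ω drawTimes s T s' ∧ T ≤ M * 3 + 2 ∧
      s'.pos = M ∧ ∀ l < M, s'.arr 1 l = (ω l : ℝ) := by
  have key : ∀ i ≤ M, ∀ s' : State, s'.nat 5 = M → s'.nat 9 = M - i → s'.pos = M - i →
      (∀ l < M - i, s'.arr 1 l = (ω l : ℝ)) → ∃ (T : ℕ) (s'' : State), Exec consts O ω
        (.while (.natLt (.reg 9) (.reg 5))
          (.seq (.draw 1 (.reg 9)) (.setNat 9 (.add (.reg 9) (.const 1))))) s' T s'' ∧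
        T ≤ i * 3 + 1 ∧ s''.pos = M ∧ ∀ l < M, s''.arr 1 l = (ω l : ℝ) := by
    intro i
    induction i with
    | zero =>
      intro _ s' h5 h9 hp ha
      refine ⟨_, s', .whileFalse ?_, by omega, hp, ha⟩
      simp [TestExpr.Holds, NatExpr.eval, h5, h9]
    | succ i ih =>
      intro hi s' h5 h9 hp ha
      set s₂ : State := { s'.setReal 1 (s'.nat 9) (ω s'.pos : ℝ) with pos := s'.pos + 1 } with hs₂
      obtain ⟨T, s'', h1, h2, h3⟩ := ih (by omega)
        (s₂.setNat 9 ((NatExpr.add (.reg 9) (.const 1)).eval s₂))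
        (by simp [State.setNat, hs₂, State.setReal, h5])
        (by simp only [State.setNat, hs₂, State.setReal, NatExpr.eval, Function.update_self, h9]
            omega)
        (by simp only [State.setNat, hs₂, hp]; omega)
        (by
          intro l hl
          simp only [State.setNat, hs₂, State.setReal, Function.update_self, h9, hp]
          by_cases h : l = M - (i + 1)
          · rw [h, Function.update_self]
          · rw [Function.update_of_ne h, ha l (by omega)])
      refine ⟨_, s'', .whileTrue ?_ ((Exec.draw 1 (.reg 9) s').seq (.setNat 9 _ _)) h1,
        by omega, h3⟩
      simp only [TestExpr.Holds, NatExpr.eval, h5, h9]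
      omega
  obtain ⟨T, s', h1, h2, h3⟩ := key M le_rfl (s.setNat 9 0) (by simp [State.setNat, hM])
    (by simp [State.setNat]) (by simp [State.setNat, hs]) (by simp)
  exact ⟨_, s', (Exec.setNat 9 (.const 0) s).seq h1, by omega, h3⟩

/-- The reduction: computes the parameters of the decoder from the input length, draws the times,
and simulates the program `c` on the input `(x, 2k + 1)`. -/
def reduction (e₂ e₃ e₄ e₅ : NatExpr) (c : Prog) : Prog :=
  .seq (.setNat 10 (.add (.reg 0) (.reg 1))) (.seq (.setNat 2 e₂) (.seq (.setNat 3 e₃)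
    (.seq (.setNat 4 e₄) (.seq (.setNat 5 e₅) (.seq drawTimes
      (.seq (.setNat 1 (.add (.mul (.const 2) (.reg 1)) (.const 1))) c.translate))))))

/-- The run of the reduction. -/
theorem exec_reduction {e D B : ℕ → ℕ} (hB : ∀ L, ∀ n ≤ B L, 2 * n ≤ D L) {e₂ e₃ e₄ e₅ : NatExpr}
    (h₂ : ∀ s : State, e₂.eval s = e (s.nat 10))
    (h₃ : ∀ s : State, e₃.eval s = e (s.nat 10) + 2 * D (s.nat 10))
    (h₄ : ∀ s : State, e₄.eval s =
      e (s.nat 10) + 2 * D (s.nat 10) + 1 + e (s.nat 10) + 1)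
    (h₅ : ∀ s : State, e₅.eval s = 2 * e (s.nat 10) + 2 * D (s.nat 10) + 1)
    {a b : ℝ} {O : Oracle fun n => n * n + 1} {ω : ℕ → unitInterval} {c : Prog}
    (x : List Bool) (k L : ℕ) (hL : L = x.length + k) {T : ℕ} {s : State}
    (hc : Exec [] (simulatedOracle a b O (e L) (D L) (B L) fun l => (ω l : ℝ))
      (fun i => ω (i + (2 * e L + 2 * D L + 1))) c (initState x (2 * k + 1)) T s)
    (hT : T ≤ B L) :
    ∃ (T' : ℕ) (s' : State), Exec [a, b] O ω (reduction e₂ e₃ e₄ e₅ c) (initState x k) T' s' ∧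
      T' ≤ 8 + (2 * e L + 2 * D L + 1) * 3 + B L *
        (decodeCost (B L) (e L + 2 * D L) (e L) (e L + 2 * D L + 1 + e L + 1)
          (2 * e L + 2 * D L + 1) + 1) ∧ s'.arr 0 0 = s.arr 0 0 := by
  set s₀ := initState x k with hs₀
  set s₁ := s₀.setNat 10 ((NatExpr.add (.reg 0) (.reg 1)).eval s₀) with hs₁
  set s₂ := s₁.setNat 2 (e₂.eval s₁) with hs₂
  set s₃ := s₂.setNat 3 (e₃.eval s₂) with hs₃
  set s₄ := s₃.setNat 4 (e₄.eval s₃) with hs₄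
  set s₅ := s₄.setNat 5 (e₅.eval s₄) with hs₅
  have upd : ∀ (s : State) (r v : ℕ), r ≠ 10 → (s.setNat r v).nat 10 = s.nat 10 :=
    fun s r v h => Function.update_of_ne (Ne.symm h) _ _
  have k₁ : s₁.nat 10 = L := by simp [hs₁, hs₀, State.setNat, NatExpr.eval, initState, hL]
  have k₂ : s₂.nat 10 = L := (upd s₁ 2 (e₂.eval s₁) (by decide)).trans k₁
  have k₃ : s₃.nat 10 = L := (upd s₂ 3 (e₃.eval s₂) (by decide)).trans k₂
  have k₄ : s₄.nat 10 = L := (upd s₃ 4 (e₄.eval s₃) (by decide)).trans k₃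
  have v₂ : e₂.eval s₁ = e L := by rw [h₂, k₁]
  have v₃ : e₃.eval s₂ = e L + 2 * D L := by rw [h₃, k₂]
  have v₄ : e₄.eval s₃ = e L + 2 * D L + 1 + e L + 1 := by rw [h₄, k₃]
  have v₅ : e₅.eval s₄ = 2 * e L + 2 * D L + 1 := by rw [h₅, k₄]
  have r₂ : s₅.nat 2 = e L := by
    rw [← v₂]; simp [hs₅, hs₄, hs₃, hs₂, State.setNat]
  have r₃ : s₅.nat 3 = e L + 2 * D L := by
    rw [← v₃]; simp [hs₅, hs₄, hs₃, State.setNat]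
  have r₄ : s₅.nat 4 = e L + 2 * D L + 1 + e L + 1 := by
    rw [← v₄]; simp [hs₅, hs₄, State.setNat]
  have r₅ : s₅.nat 5 = 2 * e L + 2 * D L + 1 := by
    rw [← v₅]; simp [hs₅, State.setNat]
  have rr : ∀ r, r < 2 ∨ 10 < r → s₅.nat r = s₀.nat r := by
    intro r hr
    simp only [hs₅, hs₄, hs₃, hs₂, hs₁, State.setNat]
    rw [Function.update_of_ne (by omega), Function.update_of_ne (by omega),
      Function.update_of_ne (by omega), Function.update_of_ne (by omega),
      Function.update_of_ne (by omega)]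
  have ra : s₅.arr = s₀.arr := rfl
  obtain ⟨T₁, s₆, x₆, hT₁, hp, ht⟩ := exec_drawTimes [a, b] O ω r₅ rfl
  have hf := frame_of_exec x₆
  have q : ∀ r, r ≠ 9 → s₆.nat r = s₅.nat r := fun r hr =>
    hf.nat r (by simp [WritesNat, drawTimes, hr.symm])
  have qa : ∀ x, x ≠ 1 → s₆.arr x = s₀.arr x := fun x hx => by
    rw [hf.arr x (by simp [WritesArr, drawTimes, hx.symm]), ra]
  set s₇ := s₆.setNat 1 ((NatExpr.add (.mul (.const 2) (.reg 1)) (.const 1)).eval s₆) with hs₇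
  have v₇ : (NatExpr.add (.mul (.const 2) (.reg 1)) (.const 1)).eval s₆ = 2 * k + 1 := by
    simp [NatExpr.eval, q 1 (by decide), rr 1 (by omega), hs₀, initState]
  have u : ∀ r, r ≠ 1 → s₇.nat r = s₆.nat r := fun r hr => Function.update_of_ne hr _ _
  have hsim : Simulates (e L) (D L) (fun l => (ω l : ℝ)) (initState x (2 * k + 1)) s₇ := by
    refine ⟨fun r => ?_, fun y => ?_, ?_, ?_, ?_, ?_, ?_, ht⟩
    · by_cases h1 : r = 1
      · subst h1
        simp [hs₇, v₇, State.setNat, regMap, initState]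
      · have h2 := regMap_range r
        have h3 : regMap r ≠ 1 := by simp only [regMap]; split_ifs <;> omega
        rw [u _ h3, q _ (by omega), rr _ h2, hs₀]
        by_cases h0 : r = 0
        · simp [h0, regMap, initState]
        · have : regMap r = r + 9 := by rw [regMap, if_neg (by omega)]
          simp [initState, h0, h1, this]
    · have h2 := arrMap_range y
      change s₆.arr _ = _
      rw [qa _ (by omega), hs₀]
      by_cases h0 : y = 0
      · simp [h0, arrMap, initState]
      · have : arrMap y = y + 9 := by rw [arrMap, if_neg h0]
        simp [initState, h0, this]
    · change s₆.pos = 0 + _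
      rw [hp, zero_add]
    · rw [u 2 (by decide), q 2 (by decide), r₂]
    · rw [u 3 (by decide), q 3 (by decide), r₃]
    · rw [u 4 (by decide), q 4 (by decide), r₄]
    · rw [u 5 (by decide), q 5 (by decide), r₅]
  obtain ⟨T₂, s₈, x₈, hT₂, hsim'⟩ := Simulates.exec_translate (hB L) hc hT s₇ hsim
  refine ⟨_, s₈, (Exec.setNat 10 _ s₀).seq ((Exec.setNat 2 e₂ s₁).seq ((Exec.setNat 3 e₃ s₂).seq
    ((Exec.setNat 4 e₄ s₃).seq ((Exec.setNat 5 e₅ s₄).seq (x₆.seq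
      ((Exec.setNat 1 _ s₆).seq x₈)))))), ?_, ?_⟩
  · have := Nat.mul_le_mul_right (decodeCost (B L) (e L + 2 * D L) (e L)
      (e L + 2 * D L + 1 + e L + 1) (2 * e L + 2 * D L + 1) + 1) hT
    omega
  · exact congrFun (hsim'.arr 0) 0

/-! ### The probability that the decoder fails -/

instance : IsProbabilityMeasure coinMeasure := by
  unfold coinMeasure; infer_instance

instance (n : ℕ) : IsProbabilityMeasure (gaussianMatrix n) := by
  unfold gaussianMatrix; infer_instance

/-- A random number in `[0,1]` has, as a position in `[a, b]`, the normalized Lebesgue measure as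
its law. -/
lemma volume_affine_preimage {a b : ℝ} (hab : a < b) {S : Set ℝ} (hS : S ⊆ Set.Icc a b) {c : ℝ}
    (hc : ENNReal.ofReal (c * (b - a)) ≤ volume S) :
    ENNReal.ofReal c ≤ volume {u : unitInterval | a + (b - a) * (u : ℝ) ∈ S} := by
  have hba : 0 < b - a := sub_pos.2 hab
  have h1 : volume {u : unitInterval | a + (b - a) * (u : ℝ) ∈ S} =
      volume ((fun x => (b - a) * x) ⁻¹' ((fun y => a + y) ⁻¹' S)) := by
    change Measure.comap Subtype.val volume _ = _
    rw [comap_subtype_coe_apply measurableSet_Icc]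
    congr 1
    ext x
    simp only [Set.mem_image, Set.mem_ofPred_eq, Subtype.exists, Set.mem_preimage]
    constructor
    · rintro ⟨y, hy, h, rfl⟩
      exact h
    · intro h
      obtain ⟨h2, h3⟩ := hS h
      refine ⟨x, ⟨?_, ?_⟩, h, rfl⟩
      · nlinarith
      · nlinarith
  rw [h1, Real.volume_preimage_mul_left hba.ne', measure_preimage_add,
    abs_of_pos (inv_pos.2 hba)]
  refine le_trans (le_of_eq ?_) (mul_le_mul_right hc _)
  rw [← ENNReal.ofReal_mul (inv_pos.2 hba).le]
  congr 1
  field_simp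

/-- Chebyshev's inequality for the number of random numbers that hit a given set. -/
lemma coinMeasure_count_le {A : Set unitInterval} [DecidablePred (· ∈ A)] (hA : MeasurableSet A)
    {c s : ℝ} (hc : ENNReal.ofReal c ≤ volume A) (hs : 0 < s) {M : ℕ} (hM : 0 < M) :
    coinMeasure {w | (((Finset.range M).filter fun i => w i ∈ A).card : ℝ) ≤ M * (c - s)} ≤
      ENNReal.ofReal (1 / (M * s ^ 2)) := by
  set f : unitInterval → ℝ := A.indicator 1 with hf
  have hfm : Measurable f := measurable_one.indicator hA
  have hf01 : ∀ u, f u ∈ Set.Icc (0 : ℝ) 1 := by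
    intro u
    by_cases h : u ∈ A <;> simp [hf, h]
  set X : ℕ → (ℕ → unitInterval) → ℝ := fun i w => f (w i) with hX
  have hXm : ∀ i, Measurable (X i) := fun i => hfm.comp (measurable_pi_apply i)
  have hXL : ∀ i, MemLp (X i) 2 coinMeasure := fun i =>
    MemLp.of_bound (hXm i).aestronglyMeasurable 1 (Filter.Eventually.of_forall fun w => by
      rw [Real.norm_eq_abs, abs_le]
      exact ⟨by linarith [(hf01 (w i)).1], (hf01 (w i)).2⟩)
  have hind : iIndepFun X coinMeasure := iIndepFun_infinitePi (X := fun _ => f) fun _ => hfm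
  have hvar1 : ∀ i, variance (X i) coinMeasure ≤ 1 := by
    intro i
    have hb : ∀ᵐ w ∂coinMeasure, X i w ∈ Set.Icc (0 : ℝ) 1 :=
      Filter.Eventually.of_forall fun w => hf01 (w i)
    have := variance_le_sq_of_bounded hb (hXm i).aemeasurable
    linarith
  have hvar : variance (∑ i ∈ Finset.range M, X i) coinMeasure ≤ M := by
    rw [IndepFun.variance_sum (fun i _ => hXL i) fun i _ j _ hij => hind.indepFun hij]
    refine (Finset.sum_le_sum fun i _ => hvar1 i).trans ?_
    rw [Finset.sum_const, Finset.card_range, nsmul_one]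
  have hmean : ∀ i, coinMeasure[X i] = (volume A).toReal := by
    intro i
    have : coinMeasure[X i] = ∫ u, f u ∂(coinMeasure.map fun w => w i) := by
      rw [integral_map (measurable_pi_apply i).aemeasurable hfm.aestronglyMeasurable]
    rw [this, coinMeasure, Measure.infinitePi_map_eval, hf, integral_indicator_one hA]
    rfl
  have hsum : coinMeasure[∑ i ∈ Finset.range M, X i] = M * (volume A).toReal := by
    have : coinMeasure[∑ i ∈ Finset.range M, X i] =
        ∑ i ∈ Finset.range M, coinMeasure[X i] := by
      rw [← integral_finsetSum _ fun i _ => (hXL i).integrable (by norm_num)]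
      simp
    rw [this, Finset.sum_congr rfl fun i _ => hmean i]
    simp
  have hcA : c ≤ (volume A).toReal := by
    rw [ENNReal.ofReal_le_iff_le_toReal (measure_ne_top _ _)] at hc
    exact hc
  have hM' : (0 : ℝ) < M := by exact_mod_cast hM
  have hcount : ∀ w : ℕ → unitInterval,
      (((Finset.range M).filter fun i => w i ∈ A).card : ℝ) =
        (∑ i ∈ Finset.range M, X i) w := by
    intro w
    rw [Finset.card_filter, Finset.sum_apply]
    push_cast
    refine Finset.sum_congr rfl fun i _ => ?_
    by_cases h : w i ∈ A <;> simp [hX, hf, h]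
  calc _ ≤ coinMeasure {w | M * s ≤ |(∑ i ∈ Finset.range M, X i) w -
        coinMeasure[∑ i ∈ Finset.range M, X i]|} := by
        refine measure_mono fun w hw => ?_
        simp only [Set.mem_ofPred_eq, hcount, hsum] at hw ⊢
        rw [le_abs]
        right
        nlinarith
    _ ≤ ENNReal.ofReal (variance (∑ i ∈ Finset.range M, X i) coinMeasure / (M * s) ^ 2) :=
        meas_ge_le_variance_div_sq (memLp_finsetSum' _ fun i _ => hXL i) (by positivity)
    _ ≤ ENNReal.ofReal (1 / (M * s ^ 2)) := by
        apply ENNReal.ofReal_le_ofReal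
        rw [div_le_div_iff₀ (by positivity) (by positivity)]
        calc _ ≤ (M : ℝ) * (M * s ^ 2) := by gcongr
          _ = _ := by ring

/-- The random times are almost surely distinct and nonzero. -/
lemma ae_times_injective {a b : ℝ} (hab : a < b) :
    ∀ᵐ w ∂coinMeasure, (∀ i, a + (b - a) * ((w i : unitInterval) : ℝ) ≠ 0) ∧
      Function.Injective fun i => a + (b - a) * ((w i : unitInterval) : ℝ) := by
  have hba : b - a ≠ 0 := (sub_pos.2 hab).ne'
  have h1 : ∀ i, ∀ᵐ w ∂coinMeasure, a + (b - a) * ((w i : unitInterval) : ℝ) ≠ 0 := by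
    intro i
    have hsub : {u : unitInterval | a + (b - a) * (u : ℝ) = 0}.Subsingleton := by
      intro u hu v hv
      have h : (b - a) * (u : ℝ) = (b - a) * (v : ℝ) := by
        simp only [Set.mem_ofPred_eq] at hu hv
        linarith
      exact Subtype.ext (mul_left_cancel₀ hba h)
    have h0 := hsub.measure_zero volume
    have hm : Measurable fun w : ℕ → unitInterval => w i := measurable_pi_apply i
    have : (coinMeasure.map fun w => w i) {u : unitInterval | a + (b - a) * (u : ℝ) = 0} = 0 := by
      rw [coinMeasure, Measure.infinitePi_map_eval, h0]
    rw [Measure.map_apply hm hsub.measurableSet] at this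
    rw [ae_iff]
    simpa using this
  have h2 : ∀ i j, i ≠ j → ∀ᵐ w ∂coinMeasure, (w i : unitInterval) ≠ w j := by
    intro i j hij
    have hm : Measurable fun w : ℕ → unitInterval => (w i, w j) :=
      (measurable_pi_apply i).prodMk (measurable_pi_apply j)
    have hd : MeasurableSet {p : unitInterval × unitInterval | p.1 = p.2} :=
      measurableSet_eq_fun measurable_fst measurable_snd
    have : (coinMeasure.map fun w => (w i, w j))
        {p : unitInterval × unitInterval | p.1 = p.2} = 0 := by
      rw [coinMeasure, Measure.infinitePi_map_eval_prod hij, Measure.measure_prod_null hd]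
      refine Filter.Eventually.of_forall fun u => ?_
      have : Prod.mk u ⁻¹' {p : unitInterval × unitInterval | p.1 = p.2} = {u} := by
        ext v
        simp [eq_comm]
      change volume (Prod.mk u ⁻¹' {p : unitInterval × unitInterval | p.1 = p.2}) = 0
      rw [this]
      exact measure_singleton u
    rw [Measure.map_apply hm hd] at this
    rw [ae_iff]
    simpa using this
  have h3 : ∀ᵐ w ∂coinMeasure, ∀ i j, i ≠ j → (w i : unitInterval) ≠ w j := by
    rw [ae_all_iff]
    intro i
    rw [ae_all_iff]
    intro j
    by_cases h : i = j
    · simp [h]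
    · filter_upwards [h2 i j h] with w hw _ using hw
  filter_upwards [ae_all_iff.2 h1, h3] with w hw1 hw2
  refine ⟨hw1, fun i j hij => ?_⟩
  by_contra hne
  apply hw2 i j hne
  have : (b - a) * (w i : ℝ) = (b - a) * (w j : ℝ) := by
    simp only at hij
    linarith
  exact Subtype.ext (mul_left_cancel₀ hba this)

open Polynomial in
/-- The truncated Taylor series, as a polynomial. -/
def truncatedPoly {n : ℕ} (h : Model) (J : Fin n → Fin n → ℝ) (K : ℕ) : ℝ[X] :=
  ∑ k ∈ Finset.range (K + 1), C (iteratedDeriv k (outputProb h J) 0 / (k ! : ℝ)) * X ^ k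

lemma eval_truncatedPoly {n : ℕ} (h : Model) (J : Fin n → Fin n → ℝ) (K : ℕ) (t : ℝ) :
    (truncatedPoly h J K).eval t = truncatedProb h J K t := by
  rw [truncatedPoly, Polynomial.eval_finsetSum]
  simp [truncatedProb]

lemma natDegree_truncatedPoly_le {n : ℕ} (h : Model) (J : Fin n → Fin n → ℝ) (K : ℕ) :
    (truncatedPoly h J K).natDegree ≤ K := by
  refine Polynomial.natDegree_sum_le_of_forall_le _ _ fun k hk => ?_
  exact (Polynomial.natDegree_C_mul_X_pow_le _ _).trans (Nat.lt_succ_iff.1 (Finset.mem_range.1 hk))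

lemma coeff_truncatedPoly {n : ℕ} (h : Model) (J : Fin n → Fin n → ℝ) {K : ℕ} (hK : 2 * n ≤ K) :
    (truncatedPoly h J K).coeff (2 * n) = ((Matrix.of J).permanent / n ^ n) ^ 2 := by
  rw [← taylorCoeff_outputProb h J, truncatedPoly, Polynomial.finsetSum_coeff,
    Finset.sum_eq_single (2 * n)]
  · simp
  · intro j _ hj
    rw [Polynomial.coeff_C_mul_X_pow, if_neg (Ne.symm hj)]
  · intro h
    exact absurd (Finset.mem_range.2 (by omega)) h

/-- For a coupling matrix on which the oracle is reliable, the decoder fails with small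
probability over the random times. -/
theorem coinMeasure_decodedAnswer_ne {a b : ℝ} (hab : a < b) {O : Oracle fun n => n * n + 1}
    (hO : ∀ n, Measurable (O n)) (h : Model) {n K D e Q q : ℕ} (hn : 1 ≤ n) (hK : 2 * n ≤ K)
    (hKD : K ≤ D) (hq : 0 < q) (hqQ : q ≤ Q) (he : Q * (2 * D + 1) ≤ e) (J : Fin n → Fin n → ℝ)
    (hJ : ENNReal.ofReal ((1 / 2 + 1 / (q : ℝ)) * (b - a)) ≤
      volume {t : ℝ | t ∈ Set.Icc a b ∧
        O n (Fin.snoc (α := fun _ => ℝ) (flatten J) t) = truncatedProb h J K t}) :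
    coinMeasure {w | decodedAnswer a b O (e + 2 * D) e (2 * e + 2 * D + 1)
      (fun l => (w l : ℝ)) n (flatten J) ≠ (Matrix.of J).permanent ^ 2} ≤
      ENNReal.ofReal (4 * Q ^ 2 / (2 * e + 2 * D + 1 : ℕ)) := by
  classical
  set M := 2 * e + 2 * D + 1 with hM
  set S := {t : ℝ | t ∈ Set.Icc a b ∧
    O n (Fin.snoc (α := fun _ => ℝ) (flatten J) t) = truncatedProb h J K t} with hS
  set A : Set unitInterval := {u | a + (b - a) * (u : ℝ) ∈ S} with hA
  have hSm : MeasurableSet S := by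
    have hsnoc : Measurable fun t : ℝ => (Fin.snoc (α := fun _ => ℝ) (flatten J) t :
        Fin (n * n + 1) → ℝ) := by
      refine measurable_pi_lambda _ fun l => ?_
      refine Fin.lastCases ?_ (fun l => ?_) l
      · simpa using measurable_id'
      · simp
    have hpoly : Measurable fun t => truncatedProb h J K t := by
      simp only [← eval_truncatedPoly]
      exact (truncatedPoly h J K).continuous.measurable
    exact measurableSet_Icc.inter (measurableSet_eq_fun ((hO n).comp hsnoc) hpoly)
  have hAm : MeasurableSet A := by
    refine hSm.preimage ?_
    exact measurable_const.add (measurable_const.mul measurable_subtype_coe)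
  have hAvol := volume_affine_preimage hab (S := S) (fun t ht => ht.1) hJ
  have hQ : 0 < Q := by omega
  have hQ' : (0 : ℝ) < Q := by exact_mod_cast hQ
  have hq' : (0 : ℝ) < q := by exact_mod_cast hq
  have hqQ' : (q : ℝ) ≤ Q := by exact_mod_cast hqQ
  have hcheb := coinMeasure_count_le hAm hAvol (s := 1 / (2 * Q)) (by positivity) (M := M)
    (by omega)
  have hval : 1 / ((M : ℝ) * (1 / (2 * Q)) ^ 2) = 4 * Q ^ 2 / M := by
    field_simp
    ring
  rw [hval] at hcheb
  refine le_trans (measure_mono_ae ?_) hcheb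
  filter_upwards [ae_times_injective hab] with w hw hne
  by_contra hcount
  apply hne
  change ¬ (((Finset.range M).filter fun i => w i ∈ A).card : ℝ) ≤
    M * (1 / 2 + 1 / (q : ℝ) - 1 / (2 * Q)) at hcount
  rw [not_le] at hcount
  -- The number of correct values exceeds `M / 2 + M / (2 Q)`, and `M ≥ Q (2 D + 1)`.
  have hcard : e + 2 * D + 1 ≤ ((Finset.range M).filter fun i => w i ∈ A).card := by
    have h1 : (1 : ℝ) / Q ≤ 1 / q := one_div_le_one_div_of_le hq' hqQ'
    have h2 : (M : ℝ) * (1 / 2 + 1 / (2 * Q)) ≤ M * (1 / 2 + 1 / (q : ℝ) - 1 / (2 * Q)) := by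
      have : (1 : ℝ) / Q = 1 / (2 * Q) + 1 / (2 * Q) := by field_simp; ring
      gcongr
      linarith
    have h3 : ((Q * (2 * D + 1) : ℕ) : ℝ) ≤ (M : ℕ) := by
      exact_mod_cast he.trans (by omega)
    have h4 : ((2 * D + 1 : ℕ) : ℝ) ≤ M / Q := by
      rw [le_div_iff₀ hQ']
      push_cast at h3 ⊢
      linarith
    have h5 : (M : ℝ) * (1 / 2 + 1 / (2 * Q)) = M / 2 + (M / Q) / 2 := by
      field_simp
    have h6 : (M : ℝ) = 2 * e + 2 * D + 1 := by rw [hM]; push_cast; ring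
    have h7 : ((e + 2 * D + 1 : ℕ) : ℝ) <
        ((Finset.range M).filter fun i => w i ∈ A).card := by
      refine lt_of_le_of_lt ?_ (h2.trans_lt hcount)
      rw [h5]
      push_cast at h4 ⊢
      linarith
    exact_mod_cast h7.le
  rw [decodedAnswer, decodeValue_eq_coeff n D e (hK.trans hKD) _ _ (fun i _ => hw.1 i)
    hw.2.injOn (truncatedPoly h J K) ((natDegree_truncatedPoly_le h J K).trans hKD)
    ((Finset.range M).filter fun i => w i ∈ A) (Finset.filter_subset _ _) hcard ?_,
    coeff_truncatedPoly h J hK]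
  · have : (n : ℝ) ≠ 0 := by exact_mod_cast (by omega : n ≠ 0)
    rw [div_pow, ← pow_mul, mul_comm n 2]
    field_simp
  · intro i hi
    rw [eval_truncatedPoly]
    exact (Finset.mem_filter.1 hi).2.2

section Measurability

variable {X : Type*} [MeasurableSpace X]

lemma measurable_rowProj (m : ℕ) {rows : X → ℕ → ℕ → ℝ}
    (hrows : ∀ i j, Measurable fun x => rows x i j) (i : ℕ) :
    ∀ j l, Measurable fun x => rowProj m (rows x) i j l := by
  induction i with
  | zero => exact fun j l => measurable_const
  | succ i ih =>
    intro j l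
    have hU : ∀ j, Measurable fun x =>
        ∑ k ∈ Finset.range m, rowProj m (rows x) i j k * rows x i k :=
      fun j => Finset.measurable_fun_sum _ fun k _ => (ih j k).mul (hrows i k)
    exact (ih j l).sub (((hU j).mul (hU l)).div
      (Finset.measurable_fun_sum _ fun k _ => (hU k).mul (hU k)))

lemma measurable_decodedAnswer {a b : ℝ} {O : Oracle fun n => n * n + 1}
    (hO : ∀ n, Measurable (O n)) (d e M n : ℕ) {w : X → ℕ → ℝ} (hw : ∀ l, Measurable fun x => w x l)
    {v : X → Fin (n * n) → ℝ} (hv : Measurable v) :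
    Measurable fun x => decodedAnswer a b O d e M (w x) n (v x) := by
  have ht : ∀ i, Measurable fun x => a + (b - a) * w x i := fun i =>
    measurable_const.add (measurable_const.mul (hw i))
  have hy : ∀ i, Measurable fun x =>
      O n (Fin.snoc (α := fun _ => ℝ) (v x) (a + (b - a) * w x i)) := by
    intro i
    refine (hO n).comp (measurable_pi_lambda _ fun l => ?_)
    refine Fin.lastCases ?_ (fun l => ?_) l
    · simpa using ht i
    · simpa [Function.comp_def] using (measurable_pi_apply l).comp hv
  have hrows : ∀ i j, Measurable fun x => decodeRow n d e (a + (b - a) * w x i)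
      (O n (Fin.snoc (α := fun _ => ℝ) (v x) (a + (b - a) * w x i))) j := by
    intro i j
    simp only [decodeRow]
    split_ifs
    · exact (ht i).pow_const _
    · exact (hy i).neg.mul ((ht i).pow_const _)
    · exact (hy i).neg
  have hP := measurable_rowProj (d + 1 + e + 1) hrows M
  exact measurable_const.mul ((hP _ _).div (hP _ _))

lemma measurable_permanent {n : ℕ} {J : X → Matrix (Fin n) (Fin n) ℝ}
    (hJ : ∀ i j, Measurable fun x => J x i j) : Measurable fun x => (J x).permanent := by
  simp only [Matrix.permanent]
  exact Finset.measurable_fun_sum _ fun σ _ => Finset.measurable_fun_prod _ fun i _ => hJ _ _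

lemma measurable_simulatedOracle {a b : ℝ} {O : Oracle fun n => n * n + 1}
    (hO : ∀ n, Measurable (O n)) (e D B n : ℕ) {w : X → ℕ → ℝ} (hw : ∀ l, Measurable fun x => w x l)
    {v : X → Fin (n * n) → ℝ} (hv : Measurable v) :
    Measurable fun x => simulatedOracle a b O e D B (w x) n (v x) := by
  by_cases h : n ≤ B
  · simp only [simulatedOracle, if_pos h]
    exact measurable_decodedAnswer hO _ _ _ _ hw hv
  · simp only [simulatedOracle, if_neg h]
    exact (measurable_permanent fun i j => (measurable_pi_apply _).comp hv).pow_const 2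

lemma measurable_flatten (n : ℕ) : Measurable (flatten (n := n)) :=
  measurable_pi_lambda _ fun _ => (measurable_pi_apply _).comp (measurable_pi_apply _)

end Measurability

/-! ### The simulated oracle and its random times -/

/-- The sequence that starts with `M` terms of the first sequence and goes on with the second. -/
def splice (M : ℕ) (p : (ℕ → unitInterval) × (ℕ → unitInterval)) : ℕ → unitInterval := fun i =>
  if i < M then p.1 i else p.2 (i - M)

lemma measurable_splice (M : ℕ) : Measurable (splice M) := by
  refine measurable_pi_lambda _ fun i => ?_
  by_cases h : i < M
  · simp only [splice, if_pos h]
    exact (measurable_pi_apply i).comp measurable_fst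
  · simp only [splice, if_neg h]
    exact (measurable_pi_apply _).comp measurable_snd

/-- The first `M` random numbers and the later ones are independent. -/
lemma map_splice (M : ℕ) : (coinMeasure.prod coinMeasure).map (splice M) = coinMeasure := by
  classical
  refine Measure.eq_infinitePi _ fun s t ht => ?_
  set s₁ := s.filter fun i => i < M with hs₁
  set s₂ := (s.filter fun i => ¬ i < M).image fun i => i - M with hs₂
  have hpre : splice M ⁻¹' (Set.pi s t) =
      (Set.pi s₁ t) ×ˢ (Set.pi s₂ fun i => t (i + M)) := by
    ext p
    simp only [Set.mem_preimage, Set.mem_pi, Finset.mem_coe, Set.mem_prod, hs₁, hs₂,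
      Finset.mem_filter, Finset.mem_image]
    constructor
    · intro h
      refine ⟨fun i hi => ?_, ?_⟩
      · have := h i hi.1
        rwa [splice, if_pos hi.2] at this
      · rintro _ ⟨i, hi, rfl⟩
        have := h i hi.1
        rw [splice, if_neg hi.2] at this
        rwa [Nat.sub_add_cancel (by omega)]
    · rintro ⟨h1, h2⟩ i hi
      by_cases hM : i < M
      · rw [splice, if_pos hM]
        exact h1 i ⟨hi, hM⟩
      · rw [splice, if_neg hM]
        have := h2 (i - M) ⟨i, ⟨hi, hM⟩, rfl⟩
        rwa [Nat.sub_add_cancel (by omega)] at this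
  rw [Measure.map_apply (measurable_splice M)
    (MeasurableSet.pi s.countable_toSet fun i _ => ht i), hpre, Measure.prod_prod, coinMeasure,
    Measure.infinitePi_pi _ fun i _ => ht i, Measure.infinitePi_pi _ fun i _ => ht _, hs₂,
    Finset.prod_image]
  · rw [← Finset.prod_filter_mul_prod_filter_not s (fun i => i < M)]
    congr 1
    refine Finset.prod_congr rfl fun i hi => ?_
    rw [Nat.sub_add_cancel (by have := (Finset.mem_filter.1 hi).2; omega)]
  · intro i hi j hj hij
    have h1 := (Finset.mem_filter.1 hi).2
    have h2 := (Finset.mem_filter.1 hj).2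
    simp only at hij
    omega

lemma rowProj_congr (m : ℕ) {rows rows' : ℕ → ℕ → ℝ} {M : ℕ} (h : ∀ i < M, rows i = rows' i) :
    rowProj m rows M = rowProj m rows' M := by
  induction M with
  | zero => rfl
  | succ M ih =>
    rw [rowProj, rowProj, ih fun i hi => h i (Nat.lt_succ_of_lt hi), h M (Nat.lt_succ_self M)]

/-- The simulated oracle depends only on the random numbers that determine the times. -/
lemma simulatedOracle_congr (a b : ℝ) (O : Oracle fun n => n * n + 1) (e D B : ℕ) {w w' : ℕ → ℝ}
    (h : ∀ i < 2 * e + 2 * D + 1, w i = w' i) :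
    simulatedOracle a b O e D B w = simulatedOracle a b O e D B w' := by
  funext n v
  simp only [simulatedOracle, decodedAnswer, decodeValue]
  rw [rowProj_congr]
  intro i hi
  rw [h i hi]

/-- Outside an event of small probability over the random times, the decoder is correct for all
matrices of size `n` in a set of large measure: Markov's inequality, applied to the measure of the
matrices on which the decoder fails. -/
lemma exists_bad_times {a b : ℝ} (hab : a < b) {O : Oracle fun n => n * n + 1}
    (hO : ∀ n, Measurable (O n)) (h : Model) {n K D e B Q q : ℕ} (hn : 1 ≤ n) (hnB : n ≤ B)
    (hK : 2 * n ≤ K) (hKD : K ≤ D) (hq : 0 < q) (hqQ : q ≤ Q) (he : Q * (2 * D + 1) ≤ e)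
    {δ' θ : ℝ} (hδ' : 0 ≤ δ') (hθ : 0 < θ)
    (hsolve : gaussianMatrix n {J | ¬ (ENNReal.ofReal ((1 / 2 + 1 / (q : ℝ)) * (b - a)) ≤
      volume {t : ℝ | t ∈ Set.Icc a b ∧
        O n (Fin.snoc (α := fun _ => ℝ) (flatten J) t) = truncatedProb h J K t})}
      ≤ ENNReal.ofReal δ') :
    ∃ bad : Set (ℕ → unitInterval), MeasurableSet bad ∧
      coinMeasure bad ≤ ENNReal.ofReal (4 * Q ^ 2 / (2 * e + 2 * D + 1 : ℕ) / θ) ∧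
      ∀ w ∉ bad, gaussianMatrix n {J | simulatedOracle a b O e D B (fun l => (w l : ℝ)) n
        (flatten J) ≠ (Matrix.of J).permanent ^ 2} ≤ ENNReal.ofReal (δ' + θ) := by
  set Z := toMeasurable (gaussianMatrix n)
    {J | ¬ (ENNReal.ofReal ((1 / 2 + 1 / (q : ℝ)) * (b - a)) ≤
      volume {t : ℝ | t ∈ Set.Icc a b ∧
        O n (Fin.snoc (α := fun _ => ℝ) (flatten J) t) = truncatedProb h J K t})} with hZ
  have hZm : MeasurableSet Z := measurableSet_toMeasurable _ _
  have hZle : gaussianMatrix n Z ≤ ENNReal.ofReal δ' := by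
    rw [hZ, measure_toMeasurable]
    exact hsolve
  have hgood : ∀ J ∉ Z, ENNReal.ofReal ((1 / 2 + 1 / (q : ℝ)) * (b - a)) ≤
      volume {t : ℝ | t ∈ Set.Icc a b ∧
        O n (Fin.snoc (α := fun _ => ℝ) (flatten J) t) = truncatedProb h J K t} := by
    intro J hJ
    by_contra hcon
    exact hJ (subset_toMeasurable _ _ hcon)
  set E : Set ((ℕ → unitInterval) × (Fin n → Fin n → ℝ)) :=
    {p | simulatedOracle a b O e D B (fun l => (p.1 l : ℝ)) n (flatten p.2) ≠
      (Matrix.of p.2).permanent ^ 2} ∩ Prod.snd ⁻¹' Zᶜ with hE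
  have hEm : MeasurableSet E := by
    refine MeasurableSet.inter (MeasurableSet.compl (measurableSet_eq_fun ?_ ?_))
      (measurable_snd hZm.compl)
    · exact measurable_simulatedOracle hO e D B n
        (fun l => measurable_subtype_coe.comp ((measurable_pi_apply l).comp measurable_fst))
        ((measurable_flatten n).comp measurable_snd)
    · exact (measurable_permanent fun i j =>
        (measurable_pi_apply j).comp ((measurable_pi_apply i).comp measurable_snd)).pow_const 2
  set η := 4 * (Q : ℝ) ^ 2 / (2 * e + 2 * D + 1 : ℕ) with hη
  have hprod : (coinMeasure.prod (gaussianMatrix n)) E ≤ ENNReal.ofReal η := by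
    rw [Measure.prod_apply_symm hEm]
    refine (lintegral_mono (g := fun _ => ENNReal.ofReal η) fun J => ?_).trans (by simp)
    by_cases hJ : J ∈ Z
    · have : (fun w => (w, J)) ⁻¹' E = ∅ := by
        ext w
        simp [hE, hJ]
      rw [this]
      simp
    · refine le_trans (measure_mono ?_)
        (coinMeasure_decodedAnswer_ne hab hO h hn hK hKD hq hqQ he J (hgood J hJ))
      intro w hw
      have := hw.1
      simp only [Set.mem_ofPred_eq, simulatedOracle, if_pos hnB] at this
      exact this
  set f : (ℕ → unitInterval) → ENNReal := fun w => gaussianMatrix n (Prod.mk w ⁻¹' E) with hf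
  have hfm : Measurable f := measurable_measure_prodMk_left hEm
  refine ⟨{w | ENNReal.ofReal θ ≤ f w}, measurableSet_le measurable_const hfm, ?_, ?_⟩
  · rw [ENNReal.ofReal_div_of_pos hθ, ENNReal.le_div_iff_mul_le
      (Or.inl (by simpa using hθ)) (Or.inl ENNReal.ofReal_ne_top), mul_comm]
    refine (mul_meas_ge_le_lintegral hfm _).trans ?_
    rw [← Measure.prod_apply hEm]
    exact hprod
  · intro w hw
    simp only [Set.mem_ofPred_eq, not_le] at hw
    calc _ ≤ gaussianMatrix n (Z ∪ Prod.mk w ⁻¹' E) := by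
          refine measure_mono fun J hJ => ?_
          by_cases hJZ : J ∈ Z
          · exact Or.inl hJZ
          · exact Or.inr ⟨hJ, hJZ⟩
      _ ≤ gaussianMatrix n Z + gaussianMatrix n (Prod.mk w ⁻¹' E) := measure_union_le _ _
      _ ≤ ENNReal.ofReal δ' + ENNReal.ofReal θ := add_le_add hZle hw.le
      _ = _ := (ENNReal.ofReal_add hδ' hθ.le).symm

/-- With high probability over the random times, the simulated oracle solves the problem of
estimating permanents, for all sizes at once. -/
lemma exists_bad_times_forall {a b : ℝ} (hab : a < b) (h : Model) {K : ℕ → ℕ}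
    {q : Polynomial ℕ} {δ' δ ε : ℝ} (hδ' : 0 ≤ δ') (hδ : δ' < δ) (hε : 0 ≤ ε)
    {O : Oracle fun n => n * n + 1} (hO : (exactTruncatedProb h K a b q δ').Solves O)
    (hK : ∀ n, 2 * n ≤ K n) (hq : ∀ n : ℕ, 1 ≤ n → 0 < q.eval n) {D e B Q : ℕ}
    (hKD : ∀ n ≤ B, K n ≤ D) (hqQ : ∀ n ≤ B, q.eval n ≤ Q) (he : Q * (2 * D + 1) ≤ e) :
    ∃ bad : Set (ℕ → unitInterval), MeasurableSet bad ∧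
      coinMeasure bad ≤
        ENNReal.ofReal (B * (4 * Q ^ 2 / (2 * e + 2 * D + 1 : ℕ) / (δ - δ'))) ∧
      ∀ w ∉ bad, (permanentEstimation ε δ).Solves
        (simulatedOracle a b O e D B fun l => (w l : ℝ)) := by
  obtain ⟨hOm, hOs⟩ := hO
  have hθ : 0 < δ - δ' := sub_pos.2 hδ
  have key : ∀ n ∈ Finset.Icc 1 B, ∃ bad : Set (ℕ → unitInterval), MeasurableSet bad ∧
      coinMeasure bad ≤ ENNReal.ofReal (4 * Q ^ 2 / (2 * e + 2 * D + 1 : ℕ) / (δ - δ')) ∧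
      ∀ w ∉ bad, gaussianMatrix n {J | simulatedOracle a b O e D B (fun l => (w l : ℝ)) n
        (flatten J) ≠ (Matrix.of J).permanent ^ 2} ≤ ENNReal.ofReal (δ' + (δ - δ')) := by
    intro n hn
    obtain ⟨hn1, hnB⟩ := Finset.mem_Icc.1 hn
    exact exists_bad_times hab hOm h hn1 hnB (hK n) (hKD n hnB) (hq n hn1) (hqQ n hnB) he hδ' hθ
      (hOs n hn1)
  choose! bad hbm hbμ hbw using key
  refine ⟨⋃ n ∈ Finset.Icc 1 B, bad n, Finset.measurableSet_biUnion _ hbm, ?_, ?_⟩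
  · refine (measure_biUnion_finset_le _ _).trans ((Finset.sum_le_sum hbμ).trans ?_)
    rw [Finset.sum_const, Nat.card_Icc, Nat.add_sub_cancel, nsmul_eq_mul,
      ENNReal.ofReal_mul (Nat.cast_nonneg B), ENNReal.ofReal_natCast]
  · intro w hw
    have hmeas : ∀ n, Measurable fun v : Fin (n * n) → ℝ =>
        simulatedOracle a b O e D B (fun l => (w l : ℝ)) n v := fun n =>
      measurable_simulatedOracle hOm e D B n (w := fun _ l => (w l : ℝ))
        (fun _ => measurable_const) measurable_id'
    refine ⟨hmeas, fun n hn => ?_⟩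
    · have hsub : {J : Fin n → Fin n → ℝ | ¬ |simulatedOracle a b O e D B (fun l => (w l : ℝ)) n
          (flatten J) - (Matrix.of J).permanent ^ 2| ≤ ε * (n ! : ℝ)} ⊆
          {J | simulatedOracle a b O e D B (fun l => (w l : ℝ)) n (flatten J) ≠
            (Matrix.of J).permanent ^ 2} := by
        intro J hJ heq
        apply hJ
        rw [heq, sub_self, abs_zero]
        positivity
      refine (measure_mono hsub).trans ?_
      by_cases hnB : n ≤ B
      · have hmem : n ∈ Finset.Icc 1 B := Finset.mem_Icc.2 ⟨hn, hnB⟩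
        have := hbw n hmem w fun hwn => hw (Set.mem_biUnion hmem hwn)
        rwa [add_sub_cancel] at this
      · have : {J : Fin n → Fin n → ℝ | simulatedOracle a b O e D B (fun l => (w l : ℝ)) n
            (flatten J) ≠ (Matrix.of J).permanent ^ 2} = ∅ := by
          ext J
          simp [simulatedOracle, hnB, unflatten_flatten]
        rw [this]
        simp

lemma eval_mono (p : Polynomial ℕ) {m n : ℕ} (h : m ≤ n) : p.eval m ≤ p.eval n := by
  rw [Polynomial.eval_eq_sum_range, Polynomial.eval_eq_sum_range]
  gcongr

lemma inv_natCast_add_one (m : ℕ) :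
    ((m : ENNReal) + 1)⁻¹ = ENNReal.ofReal (1 / ((m : ℝ) + 1)) := by
  rw [one_div, ENNReal.ofReal_inv_of_pos (by positivity), ← Nat.cast_add_one, ← Nat.cast_add_one,
    ENNReal.ofReal_natCast]

/-- The error probability of the simulating program: that of the simulated one, with a random
oracle, is at most the probability that the oracle is no solution, plus that of an error with an
oracle that is one. -/
lemma coinMeasure_simulation_le {a b : ℝ} {O : Oracle fun n => n * n + 1}
    (hO : ∀ n, Measurable (O n)) (e D B : ℕ) (c : Prog) (s₀ : State) (v : ℝ)
    {bad : Set (ℕ → unitInterval)} (hbad : MeasurableSet bad) {κ : ENNReal}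
    (hκ : ∀ w ∉ bad, coinMeasure {ω | ¬ ∃ (T : ℕ) (s : State),
      Exec [] (simulatedOracle a b O e D B fun l => (w l : ℝ)) ω c s₀ T s ∧ s.arr 0 0 = v} ≤ κ) :
    coinMeasure {ω | ¬ ∃ (T : ℕ) (s : State),
      Exec [] (simulatedOracle a b O e D B fun l => (ω l : ℝ))
        (fun i => ω (i + (2 * e + 2 * D + 1))) c s₀ T s ∧ s.arr 0 0 = v} ≤
      coinMeasure bad + κ := by
  set M := 2 * e + 2 * D + 1 with hM
  set G : Set (ℕ → unitInterval) := {ω | ¬ ∃ (T : ℕ) (s : State),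
    Exec [] (simulatedOracle a b O e D B fun l => (ω l : ℝ)) (fun i => ω (i + M)) c s₀ T s ∧
      s.arr 0 0 = v} with hG
  have hGm : MeasurableSet G := by
    refine (measurableSet_exec [] (O := fun ω : ℕ → unitInterval =>
      simulatedOracle a b O e D B fun l => (ω l : ℝ)) (ω := fun ω i => ω (i + M))
      (fun n => ?_) ?_ c s₀ v).compl
    · exact measurable_simulatedOracle hO e D B n
        (fun l => measurable_subtype_coe.comp ((measurable_pi_apply l).comp measurable_fst))
        measurable_snd
    · exact measurable_pi_lambda _ fun i => measurable_pi_apply _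
  have hsec : ∀ w, Prod.mk w ⁻¹' (splice M ⁻¹' G) = {ω | ¬ ∃ (T : ℕ) (s : State),
      Exec [] (simulatedOracle a b O e D B fun l => (w l : ℝ)) ω c s₀ T s ∧ s.arr 0 0 = v} := by
    intro w
    ext ω
    have h1 : (simulatedOracle a b O e D B fun l => (splice M (w, ω) l : ℝ)) =
        simulatedOracle a b O e D B fun l => (w l : ℝ) :=
      simulatedOracle_congr a b O e D B fun i hi => by rw [splice, if_pos hi]
    have h2 : (fun i => splice M (w, ω) (i + M)) = ω := by
      funext i
      rw [splice, if_neg (by omega), Nat.add_sub_cancel]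
    simp only [hG, Set.mem_preimage, Set.mem_ofPred_eq, h1, h2]
  have h0 : coinMeasure G = (coinMeasure.prod coinMeasure) (splice M ⁻¹' G) := by
    rw [← Measure.map_apply (measurable_splice M) hGm, map_splice]
  rw [h0, Measure.prod_apply (measurable_splice M hGm)]
  calc _ ≤ ∫⁻ w, (bad.indicator 1 w + κ) ∂coinMeasure := by
        refine lintegral_mono fun w => ?_
        by_cases hw : w ∈ bad
        · rw [Set.indicator_of_mem hw]
          exact prob_le_one.trans le_self_add
        · rw [hsec w]
          exact (hκ w hw).trans le_add_self
    _ = coinMeasure bad + κ := by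
        rw [lintegral_add_right _ measurable_const, lintegral_indicator_one hbad,
          lintegral_const, measure_univ, mul_one]

end SharpHardness

end

theorem mainTheorem6
    (ε δ : ℝ) (hε : ε ∈ Set.Ioo (0 : ℝ) 1) (hδ : δ ∈ Set.Ioo (0 : ℝ) 1)
    (hconj : SharpHardness.GaussianPermanentConjecture ε δ)
    (h : SharpHardness.Model)
    (K : ℕ → ℕ) (hK : ∀ n, 2 * n ≤ K n)
    (hKpoly : ∃ r : Polynomial ℕ, ∀ n, K n ≤ r.eval n)
    (a b : ℝ) (hab : a < b)
    (q : Polynomial ℕ) (hq : ∀ n : ℕ, 1 ≤ n → 0 < q.eval n)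
    (δ' : ℝ) (hδ' : δ' ∈ Set.Ico (0 : ℝ) δ) :
    SharpHardness.SharpPHard (SharpHardness.exactTruncatedProb h K a b q δ') := by
  open SharpHardness in
  intro f hf
  obtain ⟨c, ⟨p, hp⟩, hc⟩ := hconj f hf
  obtain ⟨r, hr⟩ := hKpoly
  have hθ : 0 < δ - δ' := sub_pos.2 hδ'.2
  obtain ⟨C, hC⟩ := exists_nat_ge (8 / (δ - δ'))
  -- The parameters, as functions of `L = |x| + k`: the simulated program makes `B` steps at most,
  -- `D` bounds the degree, and `e` is the number of errors that the decoder can correct. The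
  -- second summand of `e` makes the deviations of Chebyshev's inequality small enough.
  set B : ℕ → ℕ := fun L => p.eval (2 * L + 1) with hB
  set D : ℕ → ℕ := fun L => r.eval (B L) with hD
  set Q : ℕ → ℕ := fun L => q.eval (B L) with hQ
  set e : ℕ → ℕ := fun L =>
    Q L * (2 * D L + 1) + C * (Q L * Q L) * ((B L + 1) * (L + 1)) with he
  have pB : IsPolynomial B :=
    IsPolynomial.eval p (((IsPolynomial.const 2).mul .id).add (.const 1))
  have pD : IsPolynomial D := IsPolynomial.eval r pB
  have pQ : IsPolynomial Q := IsPolynomial.eval q pB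
  have pe : IsPolynomial e :=
    (pQ.mul (((IsPolynomial.const 2).mul pD).add (.const 1))).add
      (((IsPolynomial.const C).mul (pQ.mul pQ)).mul
        ((pB.add (.const 1)).mul (IsPolynomial.id.add (.const 1))))
  have pd : IsPolynomial fun L => e L + 2 * D L := pe.add ((IsPolynomial.const 2).mul pD)
  have pm : IsPolynomial fun L => e L + 2 * D L + 1 + e L + 1 :=
    ((pd.add (.const 1)).add pe).add (.const 1)
  have pM : IsPolynomial fun L => 2 * e L + 2 * D L + 1 :=
    (((IsPolynomial.const 2).mul pe).add ((IsPolynomial.const 2).mul pD)).add (.const 1)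
  obtain ⟨e₂, h₂⟩ := pe.exists_natExpr 10
  obtain ⟨e₃, h₃⟩ := pd.exists_natExpr 10
  obtain ⟨e₄, h₄⟩ := pm.exists_natExpr 10
  obtain ⟨e₅, h₅⟩ := pM.exists_natExpr 10
  have hKD : ∀ L, ∀ n ≤ B L, K n ≤ D L := fun L n hn => (hr n).trans (eval_mono r hn)
  have hBD : ∀ L, ∀ n ≤ B L, 2 * n ≤ D L := fun L n hn => (hK n).trans (hKD L n hn)
  have hTB : ∀ (x : List Bool) (k T : ℕ), T ≤ p.eval (x.length + (2 * k + 1)) →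
      T ≤ B (x.length + k) := fun x k T hT => hT.trans (eval_mono p (by omega))
  refine ⟨reduction e₂ e₃ e₄ e₅ c, ?_, ?_⟩
  · have pcost : IsPolynomial fun L => 8 + (2 * e L + 2 * D L + 1) * 3 + B L *
        (decodeCost (B L) (e L + 2 * D L) (e L) (e L + 2 * D L + 1 + e L + 1)
          (2 * e L + 2 * D L + 1) + 1) :=
      ((IsPolynomial.const 8).add (pM.mul (.const 3))).add
        (pB.mul ((IsPolynomial.decodeCost pB pd pe pm pM).add (.const 1)))
    obtain ⟨P, hP⟩ := pcost
    refine ⟨P, fun O ω x k => ?_⟩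
    obtain ⟨T, s, hex, hT⟩ := hp
      (simulatedOracle a b O (e (x.length + k)) (D (x.length + k)) (B (x.length + k))
        fun l => (ω l : ℝ))
      (fun i => ω (i + (2 * e (x.length + k) + 2 * D (x.length + k) + 1))) x (2 * k + 1)
    obtain ⟨T', s', hex', hT', -⟩ := exec_reduction hBD h₂ h₃ h₄ h₅ x k _ rfl hex
      (hTB x k T hT)
    refine ⟨T', s', hex', ?_⟩
    rw [← hP]
    exact hT'
  · intro O hO x k
    set L := x.length + k with hL
    obtain ⟨bad, hbm, hbμ, hbw⟩ := exists_bad_times_forall hab h hδ'.1 hδ'.2 hε.1.le hO hK hq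
      (hKD L) (fun n hn => eval_mono q hn) (show Q L * (2 * D L + 1) ≤ e L by
        simp only [he]; omega)
    have hsub : {ω | ¬ ∃ (T : ℕ) (s : State), Exec (exactTruncatedProb h K a b q δ').consts O ω
        (reduction e₂ e₃ e₄ e₅ c) (initState x k) T s ∧ s.arr 0 0 = (f x : ℝ)} ⊆
        {ω | ¬ ∃ (T : ℕ) (s : State),
          Exec [] (simulatedOracle a b O (e L) (D L) (B L) fun l => (ω l : ℝ))
            (fun i => ω (i + (2 * e L + 2 * D L + 1))) c (initState x (2 * k + 1)) T s ∧
              s.arr 0 0 = (f x : ℝ)} := by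
      rintro ω hω ⟨T, s, hex, hout⟩
      apply hω
      -- A run of the simulated program is unique, hence as short as promised.
      obtain ⟨T₀, s₀, hex₀, hT₀⟩ := hp (simulatedOracle a b O (e L) (D L) (B L)
        fun l => (ω l : ℝ)) (fun i => ω (i + (2 * e L + 2 * D L + 1))) x (2 * k + 1)
      have hs : s₀ = s := by
        obtain ⟨-, h1, -⟩ := runFuel_of_exec _ _ _ hex (T + T₀) (by omega)
        obtain ⟨-, h2, -⟩ := runFuel_of_exec _ _ _ hex₀ (T + T₀) (by omega)
        exact h2.symm.trans h1
      obtain ⟨T', s', hex', -, hout'⟩ := exec_reduction hBD h₂ h₃ h₄ h₅ x k _ rfl hex₀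
        (hTB x k T₀ hT₀)
      exact ⟨T', s', hex', by rw [hout', hs, hout]⟩
    refine (measure_mono hsub).trans ((coinMeasure_simulation_le hO.1 (e L) (D L) (B L) c
      (initState x (2 * k + 1)) (f x) hbm fun w hw => hc _ (hbw w hw) x (2 * k + 1)).trans ?_)
    have hbad : coinMeasure bad ≤ ENNReal.ofReal (1 / (2 * (k + 1))) := by
      refine hbμ.trans (ENNReal.ofReal_le_ofReal ?_)
      have hM : C * ((Q L : ℝ) * Q L) * ((B L + 1) * (L + 1)) ≤
          ((2 * e L + 2 * D L + 1 : ℕ) : ℝ) := by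
        have : C * (Q L * Q L) * ((B L + 1) * (L + 1)) ≤ 2 * e L + 2 * D L + 1 := by
          simp only [he]
          omega
        exact_mod_cast this
      have hk : (k : ℝ) ≤ L := by exact_mod_cast (by omega : k ≤ L)
      have hMpos : (0 : ℝ) < ((2 * e L + 2 * D L + 1 : ℕ) : ℝ) := by positivity
      have h8 : 8 ≤ C * (δ - δ') := (div_le_iff₀ hθ).1 hC
      rw [div_div, mul_div_assoc', div_le_div_iff₀ (by positivity) (by positivity)]
      calc (B L : ℝ) * (4 * (Q L : ℝ) ^ 2) * (2 * (k + 1))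
          = 8 * ((Q L : ℝ) * Q L * (B L * (k + 1))) := by ring
        _ ≤ (C * (δ - δ')) * ((Q L : ℝ) * Q L * ((B L + 1) * (L + 1))) := by
            gcongr
            linarith
        _ = (C * ((Q L : ℝ) * Q L) * ((B L + 1) * (L + 1))) * (δ - δ') := by ring
        _ ≤ 1 * (((2 * e L + 2 * D L + 1 : ℕ) : ℝ) * (δ - δ')) := by
            rw [one_mul]
            gcongr
    have hhalf : (((2 * k + 1 : ℕ) : ENNReal) + 1)⁻¹ = ENNReal.ofReal (1 / (2 * (k + 1))) := by
      rw [inv_natCast_add_one]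
      congr 2
      push_cast
      ring
    rw [hhalf, inv_natCast_add_one]
    refine (add_le_add_left hbad _).trans (le_of_eq ?_)
    rw [← ENNReal.ofReal_add (by positivity) (by positivity)]
    congr 1
    field_simp
    ring
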